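/- Let $\triangle=\{(x,y): x\ge 0,\ y\ge 0,\ x+y\le 1\}$, $\varpi_{\alpha,\beta,\gamma}(x,y)=x^\alpha y^\beta(1-x-y)^\gamma$, let $\langle f,g\rangle_{\alpha,\beta,\gamma}=\int_\triangle fg\,\varpi_{\alpha,\beta,\gamma}\,dx\,dy$ and $\|f\|_{\alpha,\beta,\gamma}$ be the inner product and norm of $L^2(\varpi_{\alpha,\beta,\gamma})$ on $\triangle$ (real-valued functions), and let $E_n(f)_{\alpha,\beta,\gamma}=\inf\{\|f-p\|_{\alpha,\beta,\gamma}: p \text{ a polynomial in two variables of total degree}\le n\}$. Write $\partial_1=\partial_x$, $\partial_2=\partial_y$, $\partial_3=\partial_2-\partial_1$ (weak derivatives), and let $W_2^r(\varpi)$ be the space of $f\in L^2(\varpi)$ with $\partial_1^{m_1}\partial_2^{m_2}\partial_3^{m_3}f\in L^2(\varpi)$ whenever $m_1+m_2+m_3\le r$. For $a,b\in\mathbb R$ and $n\ge 0$ let $$J_n^{a,b}(t)=\sum_{k=\iota_0}^n\frac{(k+a+1)_{n-k}}{(n-k)!\,k!\,(n+a+b+k+1)_{n-k}}\Big(\frac{t-1}{2}\Big)^k,$$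 where $\iota_0=-n-a-b$ if this number is one of $1,\dots,n$, and $\iota_0=0$ otherwise. For $0\le k\le n$ let $$J_{k,n}^{\alpha,\beta,\gamma}(x,y)=(x+y)^kJ_k^{\alpha,\beta}\Big(\frac{y-x}{x+y}\Big)J_{n-k}^{2k+\alpha+\beta+1,\gamma}(1-2x-2y),$$ $$K_{k,n}^{\alpha,\beta,\gamma}(x,y)=(1-y)^kJ_k^{\gamma,\alpha}\Big(\frac{2x}{1-y}-1\Big)J_{n-k}^{2k+\alpha+\gamma+1,\beta}(2y-1),$$ $$L_{k,n}^{\alpha,\beta,\gamma}(x,y)=(1-x)^kJ_k^{\beta,\gamma}\Big(1-\frac{2y}{1-x}\Big)J_{n-k}^{2k+\beta+\gamma+1,\alpha}(2x-1).$$ For $\alpha,\beta,\gamma>-1$ and fixed constants $\lambda,\lambda_0>0$ consider the Sobolev inner products $$\langle f,g\rangle_{-1,-1,\gamma}=\langle\partial_3f,\partial_3g\rangle_{0,0,\gamma}+\lambda\Big(\int_0^1 u'(t)v'(t)(1-t)^{\gamma+1}dt+\lambda_0u(0)v(0)\Big),\quad u=f(0,\cdot),\ v=g(0,\cdot),$$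 $$\langle f,g\rangle_{-1,\beta,-1}=\langle\partial_1f,\partial_1g\rangle_{0,\beta,0}+\lambda\Big(\int_0^1 u'(t)v'(t)(1-t)^{\beta+1}dt+\lambda_0u(0)v(0)\Big),\quad u(t)=f(t,1-t),\ v(t)=g(t,1-t),$$ $$\langle f,g\rangle_{\alpha,-1,-1}=\langle\partial_2f,\partial_2g\rangle_{\alpha,0,0}+\lambda\Big(\int_0^1 u'(t)v'(t)\,t^{\alpha+1}dt+\lambda_0u(1)v(1)\Big),\quad u=f(\cdot,0),\ v=g(\cdot,0)$$ (boundary values being those of the precise representative), and let $S_n^{-1,-1,\gamma}f$, $S_n^{-1,\beta,-1}f$, $S_n^{\alpha,-1,-1}f$ be the $n$-th partial sums $$\sum_{m=0}^n\sum_{k=0}^m\frac{\langle f,B_{k,m}\rangle}{\langle B_{k,m},B_{k,m}\rangle}B_{k,m}$$ of the orthogonal expansions of $f$ with respect to these inner products and the polynomials $B_{k,m}=J_{k,m}^{-1,-1,\gamma}$, $B_{k,m}=K_{k,m}^{-1,\beta,-1}$, $B_{k,m}=L_{k,m}^{\alpha,-1,-1}$, respectively. Theorem. (i) For every $\gamma>-1$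 there are constants $c_1,c_2>0$ depending only on $\gamma$ such that for all $f\in W_2^1(\varpi_{0,0,\gamma})\cap W_2^2(\varpi_{0,0,\gamma+2})$ and all $n\ge 2$, $$\|f-S_n^{-1,-1,\gamma}f\|_{0,0,\gamma}\le\frac{c_1}{n}E_{n-1}(\partial_3f)_{0,0,\gamma}+\frac{c_2}{n^2}E_{n-2}(\partial_1\partial_2f)_{0,0,\gamma+2}.$$ (ii) For every $\beta>-1$ there are constants $c_1,c_2>0$ depending only on $\beta$ such that for all $f\in W_2^1(\varpi_{0,\beta,0})\cap W_2^2(\varpi_{0,\beta+2,0})$ and all $n\ge 2$, $$\|f-S_n^{-1,\beta,-1}f\|_{0,\beta,0}\le\frac{c_1}{n}E_{n-1}(\partial_1f)_{0,\beta,0}+\frac{c_2}{n^2}E_{n-2}(\partial_2\partial_3f)_{0,\beta+2,0}.$$ (iii) For every $\alpha>-1$ there are constants $c_1,c_2>0$ depending only on $\alpha$ such that for all $f\in W_2^1(\varpi_{\alpha,0,0})\cap W_2^2(\varpi_{\alpha+2,0,0})$ and all $n\ge 2$, $$\|f-S_n^{\alpha,-1,-1}f\|_{\alpha,0,0}\le\frac{c_1}{n}E_{n-1}(\partial_2f)_{\alpha,0,0}+\frac{c_2}{n^2}E_{n-2}(\partial_3\partial_1f)_{\alpha+2,0,0}.$$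 -/

import Mathlib

open MeasureTheory Filter Topology
open scoped ENNReal ContDiff

namespace TriangleSobolev

noncomputable section

/-! ### The triangle, its weights and the weighted `L²` spaces -/

/-- The closed triangle `x ≥ 0, y ≥ 0, x + y ≤ 1`. -/
def triangle : Set (ℝ × ℝ) := {q | 0 ≤ q.1 ∧ 0 ≤ q.2 ∧ q.1 + q.2 ≤ 1}

/-- The open triangle `x > 0, y > 0, x + y < 1`. -/
def openTriangle : Set (ℝ × ℝ) := {q | 0 < q.1 ∧ 0 < q.2 ∧ q.1 + q.2 < 1}

/-- The weight `x ^ α * y ^ β * (1 - x - y) ^ γ`. -/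
def weight (α β γ : ℝ) (q : ℝ × ℝ) : ℝ := q.1 ^ α * q.2 ^ β * (1 - q.1 - q.2) ^ γ

/-- The measure `x ^ α * y ^ β * (1 - x - y) ^ γ dx dy` on the triangle. -/
def triMeasure (α β γ : ℝ) : Measure (ℝ × ℝ) :=
  (volume.restrict triangle).withDensity fun q => ENNReal.ofReal (weight α β γ q)

/-- The norm of `L²` of the triangle with the weight of parameters `α, β, γ`
(equal to `∞` outside that space). -/
def wNorm (α β γ : ℝ) (f : ℝ × ℝ → ℝ) : ℝ≥0∞ := eLpNorm f 2 (triMeasure α β γ)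

/-- The integral of `f g` against the weight of parameters `α, β, γ`. -/
def wInner (α β γ : ℝ) (f g : ℝ × ℝ → ℝ) : ℝ := ∫ q, f q * g q ∂(triMeasure α β γ)

/-- The error of best approximation by polynomials of total degree at most `n` in two variables,
in the weighted `L²` norm. -/
def bestApprox (n : ℕ) (f : ℝ × ℝ → ℝ) (α β γ : ℝ) : ℝ≥0∞ :=
  ⨅ (p : MvPolynomial (Fin 2) ℝ) (_ : p.totalDegree ≤ n),
    wNorm α β γ fun q => f q - MvPolynomial.eval ![q.1, q.2] p

/-! ### Weak derivatives and weighted Sobolev spaces -/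

/-- `g` is the weak derivative of `f` in the direction `v` on the open triangle. -/
def IsWeakDeriv (v : ℝ × ℝ) (f g : ℝ × ℝ → ℝ) : Prop :=
  LocallyIntegrableOn f openTriangle ∧ LocallyIntegrableOn g openTriangle ∧
    ∀ ψ : ℝ × ℝ → ℝ, ContDiff ℝ ∞ ψ → HasCompactSupport ψ → tsupport ψ ⊆ openTriangle →
      ∫ q in openTriangle, f q * fderiv ℝ ψ q v = -∫ q in openTriangle, g q * ψ q

open Classical in
/-- The weak derivative of `f` in the direction `v`, as a function (unique up to a null set;
`0` if there is none). -/
def weakDeriv (v : ℝ × ℝ) (f : ℝ × ℝ → ℝ) : ℝ × ℝ → ℝ :=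
  if h : ∃ g, IsWeakDeriv v f g then h.choose else 0

/-- The directions of `∂₁`, `∂₂` and `∂₃ = ∂₂ - ∂₁`. -/
def dir : Fin 3 → ℝ × ℝ := ![(1, 0), (0, 1), (-1, 1)]

/-- The weak derivative `∂₁` with respect to `x`. -/
def pd₁ (f : ℝ × ℝ → ℝ) : ℝ × ℝ → ℝ := weakDeriv (dir 0) f

/-- The weak derivative `∂₂` with respect to `y`. -/
def pd₂ (f : ℝ × ℝ → ℝ) : ℝ × ℝ → ℝ := weakDeriv (dir 1) f

/-- The weak derivative `∂₃ = ∂₂ - ∂₁`. -/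
def pd₃ (f : ℝ × ℝ → ℝ) : ℝ × ℝ → ℝ := weakDeriv (dir 2) f

/-- The weighted Sobolev space `W₂ʳ`: `f` and all its weak derivatives
`∂₁^m₁ ∂₂^m₂ ∂₃^m₃ f` of order `m₁ + m₂ + m₃ ≤ r` exist and lie in the weighted `L²` space
with the weight of parameters `α, β, γ`. -/
def MemSobolev (α β γ : ℝ) : ℕ → (ℝ × ℝ → ℝ) → Prop
  | 0, f => MemLp f 2 (triMeasure α β γ)
  | r + 1, f => MemLp f 2 (triMeasure α β γ) ∧
      ∀ i : Fin 3, (∃ g, IsWeakDeriv (dir i) f g) ∧ MemSobolev α β γ r (weakDeriv (dir i) f)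

/-! ### Boundary values -/

/-- The value at the point `p` of the triangle of the precise representative of `f`: the limit of
the averages of `f` over the part in the triangle of small balls around `p`. It depends only on the
class of `f` up to null sets, and is the value at `p` of the representative of `f` that is
continuous on the triangle near `p`, whenever there is one. -/
def pval (f : ℝ × ℝ → ℝ) (p : ℝ × ℝ) : ℝ :=
  limUnder (𝓝[>] (0 : ℝ)) fun r => ⨍ q in Metric.ball p r ∩ triangle, f q

/-- The restriction `y ↦ f (0, y)` to the edge `x = 0`. -/
def edgeX (f : ℝ × ℝ → ℝ) (t : ℝ) : ℝ := pval f (0, t)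

/-- The restriction `x ↦ f (x, 0)` to the edge `y = 0`. -/
def edgeY (f : ℝ × ℝ → ℝ) (t : ℝ) : ℝ := pval f (t, 0)

/-- The restriction `x ↦ f (x, 1 - x)` to the edge `x + y = 1`. -/
def edgeZ (f : ℝ × ℝ → ℝ) (t : ℝ) : ℝ := pval f (t, 1 - t)

/-! ### Sobolev inner products -/

/-- `∫₀¹ u' v' (1 - t) ^ (a + 1) dt + l₀ u(0) v(0)`. -/
def inner1L (l₀ a : ℝ) (u v : ℝ → ℝ) : ℝ :=
  (∫ t in (0 : ℝ)..1, deriv u t * deriv v t * (1 - t) ^ (a + 1)) + l₀ * (u 0 * v 0)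

/-- `∫₀¹ u' v' t ^ (a + 1) dt + l₀ u(1) v(1)`. -/
def inner1R (l₀ a : ℝ) (u v : ℝ → ℝ) : ℝ :=
  (∫ t in (0 : ℝ)..1, deriv u t * deriv v t * t ^ (a + 1)) + l₀ * (u 1 * v 1)

/-- The Sobolev inner product for the parameters `(-1, -1, γ)`. -/
def innerJ (l l₀ γ : ℝ) (f g : ℝ × ℝ → ℝ) : ℝ :=
  wInner 0 0 γ (pd₃ f) (pd₃ g) + l * inner1L l₀ γ (edgeX f) (edgeX g)

/-- The Sobolev inner product for the parameters `(-1, β, -1)`. -/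
def innerK (l l₀ β : ℝ) (f g : ℝ × ℝ → ℝ) : ℝ :=
  wInner 0 β 0 (pd₁ f) (pd₁ g) + l * inner1L l₀ β (edgeZ f) (edgeZ g)

/-- The Sobolev inner product for the parameters `(α, -1, -1)`. -/
def innerL (l l₀ α : ℝ) (f g : ℝ × ℝ → ℝ) : ℝ :=
  wInner α 0 0 (pd₂ f) (pd₂ g) + l * inner1R l₀ α (edgeY f) (edgeY g)

/-! ### Jacobi polynomials with arbitrary real parameters -/

/-- The Pochhammer symbol `a (a + 1) ⋯ (a + n - 1)`. -/
def poch (a : ℝ) (n : ℕ) : ℝ := (ascPochhammer ℝ n).eval a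

open Classical in
/-- The first index of summation: `-n - a - b` if this is one of `1, …, n`, and `0` otherwise. -/
def iota₀ (a b : ℝ) (n : ℕ) : ℕ :=
  if h : ∃ j : ℕ, (1 ≤ j ∧ j ≤ n) ∧ (j : ℝ) = -(n : ℝ) - a - b then h.choose else 0

/-- The renormalized Jacobi polynomial `J_n^{a,b}(t)`, of exact degree `n`, for all real `a, b`. -/
def jacobiJ (a b : ℝ) (n : ℕ) (t : ℝ) : ℝ :=
  ∑ k ∈ Finset.Icc (iota₀ a b n) n,
    poch (k + a + 1) (n - k) /
      ((n - k).factorial * k.factorial * poch (n + a + b + k + 1) (n - k)) * ((t - 1) / 2) ^ k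

/-- The Jacobi polynomials on the triangle, first family. -/
def basisJ (α β γ : ℝ) (k n : ℕ) (q : ℝ × ℝ) : ℝ :=
  (q.1 + q.2) ^ k * jacobiJ α β k ((q.2 - q.1) / (q.1 + q.2)) *
    jacobiJ (2 * k + α + β + 1) γ (n - k) (1 - 2 * q.1 - 2 * q.2)

/-- The Jacobi polynomials on the triangle, second family. -/
def basisK (α β γ : ℝ) (k n : ℕ) (q : ℝ × ℝ) : ℝ :=
  (1 - q.2) ^ k * jacobiJ γ α k (2 * q.1 / (1 - q.2) - 1) *
    jacobiJ (2 * k + α + γ + 1) β (n - k) (2 * q.2 - 1)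

/-- The Jacobi polynomials on the triangle, third family. -/
def basisL (α β γ : ℝ) (k n : ℕ) (q : ℝ × ℝ) : ℝ :=
  (1 - q.1) ^ k * jacobiJ β γ k (1 - 2 * q.2 / (1 - q.1)) *
    jacobiJ (2 * k + β + γ + 1) α (n - k) (2 * q.1 - 1)

/-! ### Partial sums of the orthogonal expansions -/

/-- The `n`-th partial sum `∑_{m ≤ n} ∑_{k ≤ m} ⟨f, B k m⟩ / ⟨B k m, B k m⟩ * B k m`. -/
def partialSum (ip : (ℝ × ℝ → ℝ) → (ℝ × ℝ → ℝ) → ℝ) (B : ℕ → ℕ → ℝ × ℝ → ℝ) (n : ℕ)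
    (f : ℝ × ℝ → ℝ) (q : ℝ × ℝ) : ℝ :=
  ∑ m ∈ Finset.range (n + 1), ∑ k ∈ Finset.range (m + 1),
    ip f (B k m) / ip (B k m) (B k m) * B k m q

/-- The operator `S_n^{-1,-1,γ}`. -/
def sumJ (l l₀ γ : ℝ) (n : ℕ) (f : ℝ × ℝ → ℝ) : ℝ × ℝ → ℝ :=
  partialSum (innerJ l l₀ γ) (basisJ (-1) (-1) γ) n f

/-- The operator `S_n^{-1,β,-1}`. -/
def sumK (l l₀ β : ℝ) (n : ℕ) (f : ℝ × ℝ → ℝ) : ℝ × ℝ → ℝ :=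
  partialSum (innerK l l₀ β) (basisK (-1) β (-1)) n f

/-- The operator `S_n^{α,-1,-1}`. -/
def sumL (l l₀ α : ℝ) (n : ℕ) (f : ℝ × ℝ → ℝ) : ℝ × ℝ → ℝ :=
  partialSum (innerL l l₀ α) (basisL α (-1) (-1)) n f

end

end TriangleSobolev

/-! Rotating the barycentric coordinates carries the second and third families, with their weights
and inner products, to the parameters (-1, -1, γ), so only that case is proved. Write z = 1 - x - y,
E = x∂₁ + y∂₂, v = ∂₃f, h = ∂₁∂₂f. Two facts carry the proof.

Orthogonality (`TraceVectors.inner_eq_zero_of_sobPair`). The remainder f - S_n f is Sobolev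
orthogonal to all polynomials of degree at most n. Testing with 1, with powers of x + y (killed by
∂₃) and with multiples of y shows that it vanishes at the origin, that the derivative of its trace
on x = 0 is orthogonal to degree n - 1, and that ∂₃(f - S_n f) is orthogonal to degree n - 1.
Integration by parts, with boundary terms on x = 0 only, then makes f - S_n f and ∂₁∂₂(f - S_n f)
orthogonal to degree n - 2, for the exponents γ and γ + 2. So ∂₃S_n f and ∂₁∂₂S_n f are at least as
close to v and h as any polynomial of degree n - 1 and n - 2.

A bound in each degree (`norm_le_of_degree`). The component Q of degree m satisfies `sobOp` Q = μQ
with μ = m(m + γ), hence ‖Q‖ ≤ C(‖∂₃Q‖ / m + ‖∂₁∂₂Q‖ / m²). Indeed `sobOp` equals (γ + 1)E plus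
terms in z∂₁∂₂Q and in derivatives of ∂₃Q. The latter is an eigenfunction of the Jacobi operator, so
the energy identity bounds these derivatives, with their edge factors, by a multiple of m‖∂₃Q‖. What
is left is EQ, and a Hardy type argument with the Euler field bounds it by the same quantity. Only
the eigenvalue equation is used, so C does not depend on λ and λ₀.

Summation (`exists_norm_sub_sobSum_le`). By the orthogonality, components whose degrees differ by at
least 3 are orthogonal in L², so the squared norm of a block of components is at most 5 times the
sum of their squares. The squares of ∂₃Q and of ∂₁∂₂Q telescope to the squared errors of v and h.
Convergence of the expansion need not be known: the remainder is tested against one polynomial at a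
time, and polynomials are dense.

The analytic work is to justify the integrations by parts for f of Sobolev class. A weak derivative
is a derivative on almost every line, ∂₂f has a trace β on x = 0 because ∂₁∂₂f is integrable near
that edge, and f is continuous up to x = 0 away from the vertex (0, 1), with trace t ↦ c + ∫₀ᵗ β
(`exists_edge_rep`, `exists_trace_identities_of_measurable`). -/

namespace TriangleSobolev

noncomputable section

/-! ### Derivations of polynomials and the two differential operators -/

open MvPolynomial in
/-- The coordinate `x` as a polynomial. -/
abbrev px : MvPolynomial (Fin 2) ℝ := X 0

open MvPolynomial in
/-- The coordinate `y` as a polynomial. -/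
abbrev py : MvPolynomial (Fin 2) ℝ := X 1

/-- The third barycentric coordinate `1 - x - y` as a polynomial. -/
abbrev pz : MvPolynomial (Fin 2) ℝ := 1 - px - py

/-- The derivation `∂₁` of polynomials. -/
def D₁ : Derivation ℝ (MvPolynomial (Fin 2) ℝ) (MvPolynomial (Fin 2) ℝ) := MvPolynomial.pderiv 0

/-- The derivation `∂₂` of polynomials. -/
def D₂ : Derivation ℝ (MvPolynomial (Fin 2) ℝ) (MvPolynomial (Fin 2) ℝ) := MvPolynomial.pderiv 1

/-- The derivation `∂₃ = ∂₂ - ∂₁` of polynomials. -/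
def D₃ : Derivation ℝ (MvPolynomial (Fin 2) ℝ) (MvPolynomial (Fin 2) ℝ) := D₂ - D₁

/-- The Euler derivation `x ∂₁ + y ∂₂`. -/
def eul : Derivation ℝ (MvPolynomial (Fin 2) ℝ) (MvPolynomial (Fin 2) ℝ) := px • D₁ + py • D₂

theorem D₃_apply (p : MvPolynomial (Fin 2) ℝ) : D₃ p = D₂ p - D₁ p := rfl

theorem eul_apply (p : MvPolynomial (Fin 2) ℝ) : eul p = px * D₁ p + py * D₂ p := rfl

@[simp] theorem D₁_px : D₁ px = 1 := by simp [D₁]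
@[simp] theorem D₁_py : D₁ py = 0 := by simp [D₁]
@[simp] theorem D₂_px : D₂ px = 0 := by simp [D₂]
@[simp] theorem D₂_py : D₂ py = 1 := by simp [D₂]
@[simp] theorem D₁_C (a : ℝ) : D₁ (MvPolynomial.C a) = 0 := by simp [D₁]
@[simp] theorem D₂_C (a : ℝ) : D₂ (MvPolynomial.C a) = 0 := by simp [D₂]

/-- The commutator of two derivations is a derivation, so it suffices that it kills both variables.
-/
theorem D₂_D₁ (p : MvPolynomial (Fin 2) ℝ) : D₂ (D₁ p) = D₁ (D₂ p) := by
  have h : ⁅D₂, D₁⁆ = 0 := by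
    apply MvPolynomial.derivation_ext
    intro i
    fin_cases i <;> simp [D₁, D₂, Derivation.commutator_apply, MvPolynomial.pderiv_X]
  have := congrArg (fun D => D p) h
  simpa [Derivation.commutator_apply, sub_eq_zero] using this

/-- The differential operator with eigenvalues `m (m + g)` on the Sobolev orthogonal polynomials
of degree `m` for the parameters `(-1, -1, g)`. -/
def sobOp (g : ℝ) (p : MvPolynomial (Fin 2) ℝ) : MvPolynomial (Fin 2) ℝ :=
  eul (eul p) + MvPolynomial.C g * eul p - (px * D₁ (D₁ p) + py * D₂ (D₂ p))

/-- The Jacobi differential operator on the triangle for the parameters `(0, 0, g)`. -/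
def jacOp (g : ℝ) (p : MvPolynomial (Fin 2) ℝ) : MvPolynomial (Fin 2) ℝ :=
  eul (eul p) + MvPolynomial.C (g + 2) * eul p
    - (px * D₁ (D₁ p) + D₁ p + (py * D₂ (D₂ p) + D₂ p))

/-- Apart from the Euler term, only ∂₁∂₂p and derivatives of ∂₃p remain, and the factors xy, xz, yz
are those that the energy bound `norm_le_of_jacOp_eq` can handle. -/
theorem sobOp_eq (g : ℝ) (p : MvPolynomial (Fin 2) ℝ) :
    sobOp g p = -((px + py) * pz * D₁ (D₂ p)) - pz * (py * D₂ (D₃ p) - px * D₁ (D₃ p))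
      - px * py * D₃ (D₃ p) + MvPolynomial.C (g + 1) * eul p := by
  simp only [sobOp, eul_apply, D₃_apply, map_add, map_sub, Derivation.leibniz, smul_eq_mul, D₂_D₁,
    D₁_px, D₁_py, D₂_px, D₂_py, map_one]
  ring

/-- E² - E is the quadratic form x²∂₁² + 2xy∂₁∂₂ + y²∂₂²; the pure second derivatives are removed by
∂₁² = ∂₁∂₂ - ∂₁∂₃ and ∂₂² = ∂₁∂₂ + ∂₂∂₃. -/
theorem eul_eul_eq (p : MvPolynomial (Fin 2) ℝ) :
    eul (eul p) = (px + py) ^ 2 * D₁ (D₂ p) + (py ^ 2 * D₂ (D₃ p) - px ^ 2 * D₁ (D₃ p))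
      + eul p := by
  simp only [eul_apply, D₃_apply, map_add, map_sub, Derivation.leibniz, smul_eq_mul, D₂_D₁,
    D₁_px, D₁_py, D₂_px, D₂_py]
  ring

/-- This intertwining turns an eigenfunction of `sobOp` for μ into an eigenfunction ∂₃Q of `jacOp`
for μ - (g + 1). -/
theorem D₃_sobOp (g : ℝ) (p : MvPolynomial (Fin 2) ℝ) :
    D₃ (sobOp g p) = jacOp g (D₃ p) + MvPolynomial.C (g + 1) * D₃ p := by
  simp only [sobOp, jacOp, eul_apply, D₃_apply, map_add, map_sub, Derivation.leibniz, smul_eq_mul,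
    D₂_D₁, D₁_px, D₁_py, D₂_px, D₂_py, map_one, D₁_C, D₂_C,
    map_zero, Derivation.map_one_eq_zero]
  simp only [map_ofNat]
  ring

/-- Divergence form: the three groups are those of `triInt_ibp₁`, `triInt_ibp₂` and `triInt_ibp₃`.
-/
theorem jacOp_eq (g : ℝ) (p : MvPolynomial (Fin 2) ℝ) :
    jacOp g p = - D₃ (px * py * D₃ p)
      - (pz * (D₁ p + px * D₁ (D₁ p)) - MvPolynomial.C (g + 1) * (px * D₁ p))
      - (pz * (D₂ p + py * D₂ (D₂ p)) - MvPolynomial.C (g + 1) * (py * D₂ p)) := by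
  simp only [jacOp, eul_apply, D₃_apply, map_add, map_sub, Derivation.leibniz, smul_eq_mul,
    D₂_D₁, D₁_px, D₁_py, D₂_px, D₂_py, map_one]
  simp only [map_ofNat]
  ring

/-- Separates the second order part into a radial piece, in the Euler derivation, and an angular
piece, in ∂₃. -/
theorem add_mul_laplace (p : MvPolynomial (Fin 2) ℝ) :
    (px + py) * (px * D₁ (D₁ p) + py * D₂ (D₂ p)) =
      eul (eul p) - eul p + px * py * D₃ (D₃ p) := by
  simp only [eul_apply, D₃_apply, map_add, map_sub, Derivation.leibniz, smul_eq_mul,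
    D₂_D₁, D₁_px, D₁_py, D₂_px, D₂_py]
  ring

/-! ### The basis polynomials -/

/-- The `k`-th coefficient of `jacobiJ a b n` in powers of `(t - 1) / 2`. -/
def jacCoef (a b : ℝ) (n k : ℕ) : ℝ :=
  poch (k + a + 1) (n - k) /
    ((n - k).factorial * k.factorial * poch (n + a + b + k + 1) (n - k))

theorem poch_zero (x : ℝ) : poch x 0 = 1 := by simp [poch]

theorem poch_succ (x : ℝ) (n : ℕ) : poch x (n + 1) = x * poch (x + 1) n := by
  simp [poch, ascPochhammer_succ_left, Polynomial.eval_comp]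

theorem jacCoef_self (a b : ℝ) (n : ℕ) : jacCoef a b n n = 1 / n.factorial := by
  simp [jacCoef, poch_zero]

/-- The term ratio of the hypergeometric series, which is the Jacobi equation coefficient by
coefficient. In the second alternative both sides vanish. -/
theorem jacCoef_succ {a b : ℝ} {n k : ℕ} (hk : k < n)
    (h : (n : ℝ) + a + b + k + 1 ≠ 0 ∨ (k : ℝ) + a + 1 = 0) :
    jacCoef a b n (k + 1) * ((k + 1) * (k + a + 1)) =
      (n - k) * (n + a + b + k + 1) * jacCoef a b n k := by
  obtain ⟨j, rfl⟩ : ∃ j, n = k + 1 + j := ⟨n - (k + 1), by omega⟩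
  have e1 : k + 1 + j - k = j + 1 := by omega
  have e2 : k + 1 + j - (k + 1) = j := by omega
  simp only [jacCoef, e1, e2, poch_succ, Nat.factorial_succ]
  push_cast
  have e3 : (k : ℝ) + 1 + a + 1 = k + a + 1 + 1 := by ring
  have e4 : (k : ℝ) + 1 + j + a + b + (k + 1) + 1 = k + 1 + j + a + b + k + 1 + 1 := by ring
  rw [e3, e4]
  push_cast at h
  rcases h with h | h
  · generalize poch (k + 1 + j + a + b + k + 1 + 1) j = P
    have hk : (k.factorial : ℝ) ≠ 0 := by positivity
    have hj : (j.factorial : ℝ) ≠ 0 := by positivity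
    have hk1 : (k : ℝ) + 1 ≠ 0 := by positivity
    have hj1 : (j : ℝ) + 1 ≠ 0 := by positivity
    -- If the common Pochhammer factor of the denominators is zero, both coefficients are zero,
    -- since division by zero gives zero.
    by_cases hP : P = 0
    · simp [hP]
    · field_simp
      ring
  · rw [h]; simp

theorem jacCoef_eq_zero {a b : ℝ} {n k : ℕ} (hk : k < n) (h : (k : ℝ) + a + 1 = 0) :
    jacCoef a b n k = 0 := by
  obtain ⟨j, rfl⟩ : ∃ j, n = k + 1 + j := ⟨n - (k + 1), by omega⟩
  have e1 : k + 1 + j - k = j + 1 := by omega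
  simp [jacCoef, e1, poch_succ, h]

theorem iota₀_eq_zero {a b : ℝ} {n : ℕ}
    (h : ∀ j : ℕ, 1 ≤ j → j ≤ n → (j : ℝ) ≠ -(n : ℝ) - a - b) : iota₀ a b n = 0 := by
  rw [iota₀, dif_neg]
  rintro ⟨j, ⟨h1, h2⟩, h3⟩
  exact h j h1 h2 h3

/-- For a = b = -1 the exceptional first index occurs only for n = 1, and the coefficient it omits
is zero anyway. -/
theorem jacobiJ_neg_one (n : ℕ) (t : ℝ) :
    jacobiJ (-1) (-1) n t =
      ∑ k ∈ Finset.range (n + 1), jacCoef (-1) (-1) n k * ((t - 1) / 2) ^ k := by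
  by_cases hn : n = 1
  · subst hn
    have : iota₀ (-1) (-1) 1 = 1 := by
      have h : ∃ j : ℕ, (1 ≤ j ∧ j ≤ 1) ∧ (j : ℝ) = -((1 : ℕ) : ℝ) - (-1) - (-1) :=
        ⟨1, by norm_num⟩
      rw [iota₀, dif_pos h]
      have := h.choose_spec.1
      omega
    rw [jacobiJ, this, Finset.sum_range_succ, Finset.sum_range_one, jacCoef_eq_zero] <;>
      simp [jacCoef]
  · rw [jacobiJ, iota₀_eq_zero]
    · rw [Nat.range_succ_eq_Icc_zero]; rfl
    · intro j h1 h2 h3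
      have h4 : (j : ℝ) + n = 2 := by linarith
      norm_cast at h4
      omega

theorem jacobiJ_eq_sum {a b : ℝ} {n : ℕ} (h : 0 < n → -1 < (n : ℝ) + a + b) (t : ℝ) :
    jacobiJ a b n t = ∑ k ∈ Finset.range (n + 1), jacCoef a b n k * ((t - 1) / 2) ^ k := by
  rw [jacobiJ, iota₀_eq_zero]
  · rw [Nat.range_succ_eq_Icc_zero]; rfl
  · intro j h1 h2 h3
    have h4 := h (by omega)
    have h5 : (1 : ℝ) ≤ j := by exact_mod_cast h1
    linarith

/-- The homogeneous polynomial `(x + y) ^ k J_k^{-1,-1} ((y - x) / (x + y))`. -/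
def angPoly (k : ℕ) : MvPolynomial (Fin 2) ℝ :=
  ∑ i ∈ Finset.range (k + 1),
    MvPolynomial.C (jacCoef (-1) (-1) k i) * ((-px) ^ i * (px + py) ^ (k - i))

/-- The polynomial `J_n^{2 k - 1, g} (1 - 2 (x + y))`. -/
def radPoly (g : ℝ) (k n : ℕ) : MvPolynomial (Fin 2) ℝ :=
  ∑ i ∈ Finset.range (n + 1),
    MvPolynomial.C (jacCoef (2 * k + (-1) + (-1) + 1) g n i) * (-(px + py)) ^ i

/-- The polynomial that agrees with `basisJ (-1) (-1) g k m`. -/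
def basPoly (g : ℝ) (k m : ℕ) : MvPolynomial (Fin 2) ℝ := angPoly k * radPoly g k (m - k)

theorem eval_radPoly {g : ℝ} (hg : -1 < g) (k n : ℕ) (x y : ℝ) :
    MvPolynomial.eval ![x, y] (radPoly g k n) =
      jacobiJ (2 * k + (-1) + (-1) + 1) g n (1 - 2 * x - 2 * y) := by
  rw [jacobiJ_eq_sum]
  · simp only [radPoly, map_sum, map_mul, map_pow, map_neg, map_add, MvPolynomial.eval_C,
      MvPolynomial.eval_X]
    refine Finset.sum_congr rfl fun i _ => ?_
    congr 2
    simp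
    ring
  · intro h
    have : (1 : ℝ) ≤ n := by exact_mod_cast h
    have : (0 : ℝ) ≤ k := by positivity
    linarith

theorem eval_angPoly (k : ℕ) (x y : ℝ) (h : x + y ≠ 0) :
    MvPolynomial.eval ![x, y] (angPoly k) =
      (x + y) ^ k * jacobiJ (-1) (-1) k ((y - x) / (x + y)) := by
  rw [jacobiJ_neg_one]
  simp only [angPoly, map_sum, map_mul, map_pow, map_neg, map_add, MvPolynomial.eval_C,
      MvPolynomial.eval_X, Finset.mul_sum]
  refine Finset.sum_congr rfl fun i hi => ?_
  have hi : i ≤ k := by simpa [Nat.lt_succ_iff] using hi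
  have e : ((y - x) / (x + y) - 1) / 2 = -x / (x + y) := by field_simp; ring
  rw [e, div_pow]
  obtain ⟨j, rfl⟩ := Nat.exists_eq_add_of_le hi
  simp only [Nat.add_sub_cancel_left, pow_add]
  simp
  field_simp

theorem eval_basPoly {g : ℝ} (hg : -1 < g) (k m : ℕ) (q : ℝ × ℝ) (h : q.1 + q.2 ≠ 0) :
    MvPolynomial.eval ![q.1, q.2] (basPoly g k m) = basisJ (-1) (-1) g k m q := by
  rw [basPoly, map_mul, eval_angPoly _ _ _ h, eval_radPoly hg, basisJ]

/-- Used for the Euler derivation and for -x∂₃, which fixes -x. -/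
theorem derivation_pow_of_eq {D : Derivation ℝ (MvPolynomial (Fin 2) ℝ) (MvPolynomial (Fin 2) ℝ)}
    {a : MvPolynomial (Fin 2) ℝ} (h : D a = a) (n : ℕ) : D (a ^ n) = MvPolynomial.C (n : ℝ) * a ^ n := by
  rw [Derivation.leibniz_pow, h]
  rcases n with _ | n
  · simp
  · simp [pow_succ]

theorem derivation_C (D : Derivation ℝ (MvPolynomial (Fin 2) ℝ) (MvPolynomial (Fin 2) ℝ)) (a : ℝ) :
    D (MvPolynomial.C a) = 0 := by
  rw [← MvPolynomial.algebraMap_eq]; exact D.map_algebraMap a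

/-- Euler's identity: every term is homogeneous of degree k. -/
theorem eul_angPoly (k : ℕ) : eul (angPoly k) = MvPolynomial.C (k : ℝ) * angPoly k := by
  have h1 : eul (-px) = -px := by simp [eul_apply]
  have h2 : eul (px + py) = px + py := by simp [eul_apply]
  simp only [angPoly, map_sum, Finset.mul_sum]
  refine Finset.sum_congr rfl fun i hi => ?_
  have hi : i ≤ k := by simpa [Nat.lt_succ_iff] using hi
  obtain ⟨j, rfl⟩ := Nat.exists_eq_add_of_le hi
  simp only [Derivation.leibniz, derivation_pow_of_eq h1, derivation_pow_of_eq h2,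
    Nat.add_sub_cancel_left, smul_eq_mul, derivation_C, Nat.cast_add, map_add]
  ring

theorem px_ne_zero : px ≠ 0 := MvPolynomial.X_ne_zero 0

theorem px_add_py_ne_zero : px + py ≠ 0 := fun h => by
  have := congrArg (MvPolynomial.eval ![1, 0]) h
  simp at this

/-- The angular equation for `angPoly`. -/
theorem D₃_D₃_angPoly (k : ℕ) :
    px * py * D₃ (D₃ (angPoly k)) = MvPolynomial.C (-((k : ℝ) * (k - 1))) * angPoly k := by
  have h1 : (-px • D₃) (-px) = -px := by simp [D₃_apply]
  have h2 : D₃ (px + py) = 0 := by simp [D₃_apply]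
  have h3 : D₃ px = -1 := by simp [D₃_apply]
  set w : MvPolynomial (Fin 2) ℝ := -px with hw
  -- With w = -x, the derivation ∂₃ acts as d/dw and treats x + y as a constant, so w²∂₃² is
  -- diagonal on these monomials.
  have key : ∀ i j : ℕ, w ^ 2 * D₃ (D₃ (w ^ i * (px + py) ^ j)) =
      MvPolynomial.C ((i : ℝ) * (i - 1)) * (w ^ i * (px + py) ^ j) := by
    intro i j
    have h4 : D₃ ((px + py) ^ j) = 0 := by rw [Derivation.leibniz_pow, h2]; simp
    have h5 : w * D₃ (w ^ i) = MvPolynomial.C (i : ℝ) * w ^ i := by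
      exact derivation_pow_of_eq h1 i
    have h6 : D₃ w = 1 := by simp [hw, h3]
    have h7 := congrArg D₃ h5
    simp only [Derivation.leibniz, smul_eq_mul, h6, derivation_C] at h7
    simp only [Derivation.leibniz, smul_eq_mul, h4, map_add, map_zero, map_mul, map_sub, map_one]
    linear_combination (px + py) ^ j * w * h7 + (px + py) ^ j * (MvPolynomial.C (i : ℝ) - 1) * h5
  have hw0 : w ≠ 0 := neg_ne_zero.mpr px_ne_zero
  apply mul_left_cancel₀ hw0
  -- Since x = -w and y = (x + y) + w, one extra factor w expresses xy∂₃² through w²∂₃².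
  have e : w * (px * py * D₃ (D₃ (angPoly k))) =
      -((px + py) + w) * (w ^ 2 * D₃ (D₃ (angPoly k))) := by rw [hw]; ring
  rw [e]
  have e2 : w ^ 2 * D₃ (D₃ (angPoly k)) = ∑ i ∈ Finset.range (k + 1),
      MvPolynomial.C (jacCoef (-1) (-1) k i * ((i : ℝ) * (i - 1))) *
        (w ^ i * (px + py) ^ (k - i)) := by
    simp only [angPoly, map_sum, Finset.mul_sum]
    refine Finset.sum_congr rfl fun i hi => ?_
    have e3 : D₃ (D₃ (MvPolynomial.C (jacCoef (-1) (-1) k i) * (w ^ i * (px + py) ^ (k - i)))) =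
        MvPolynomial.C (jacCoef (-1) (-1) k i) * D₃ (D₃ (w ^ i * (px + py) ^ (k - i))) := by
      rw [MvPolynomial.C_mul', Derivation.map_smul, Derivation.map_smul, MvPolynomial.C_mul']
    rw [e3, MvPolynomial.C_mul]
    linear_combination MvPolynomial.C (jacCoef (-1) (-1) k i) * key i (k - i)
  rw [e2]
  have e4 : -(px + py + w) * (∑ i ∈ Finset.range (k + 1),
      MvPolynomial.C (jacCoef (-1) (-1) k i * ((i : ℝ) * (i - 1))) *
        (w ^ i * (px + py) ^ (k - i))) =
      -(∑ i ∈ Finset.range (k + 1),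
      MvPolynomial.C (jacCoef (-1) (-1) k i * ((i : ℝ) * (i - 1))) *
        (w ^ i * (px + py) ^ (k - i + 1))) - ∑ i ∈ Finset.range (k + 1),
      MvPolynomial.C (jacCoef (-1) (-1) k i * ((i : ℝ) * (i - 1))) *
        (w ^ (i + 1) * (px + py) ^ (k - i)) := by
    rw [Finset.mul_sum, ← Finset.sum_neg_distrib, ← Finset.sum_sub_distrib]
    refine Finset.sum_congr rfl fun i hi => ?_
    ring
  -- The two sums are shifted against each other so that coefficients of the same monomial face each
  -- other; the last term is handled alone.
  rw [e4, Finset.sum_range_succ', Finset.sum_range_succ _ k]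
  simp only [Nat.cast_zero, zero_mul, mul_zero, map_zero, add_zero]
  rw [angPoly, Finset.sum_range_succ, mul_add, mul_add, Finset.mul_sum, Finset.mul_sum,
    ← sub_sub, sub_eq_add_neg, ← Finset.sum_neg_distrib, ← Finset.sum_sub_distrib]
  congr 1
  · refine Finset.sum_congr rfl fun i hi => ?_
    have hi : i < k := by simpa using hi
    -- For i = 0 the factor i + a + 1 vanishes; for i ≥ 1 the denominator factor k + i - 1 is
    -- positive.
    have := jacCoef_succ (a := -1) (b := -1) hi (by
      rcases Nat.eq_zero_or_pos i with h | h
      · right; simp [h]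
      · left
        have h1 : (1 : ℝ) ≤ i := by exact_mod_cast h
        have h2 : (i : ℝ) < k := by exact_mod_cast hi
        intro h3; linarith)
    have e5 : k - (i + 1) + 1 = k - i := by omega
    have h8 : MvPolynomial.C (σ := Fin 2) (jacCoef (-1) (-1) k (i + 1) * (((i + 1 : ℕ) : ℝ) * ((i + 1 : ℕ) - 1)))
        = MvPolynomial.C ((k : ℝ) * (k - 1) * jacCoef (-1) (-1) k i
          - jacCoef (-1) (-1) k i * ((i : ℝ) * (i - 1))) := by
      congr 1
      push_cast
      linarith
    rw [h8, e5]
    simp only [map_sub, map_mul, map_neg, map_one]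
    ring
  · simp only [map_sub, map_mul, map_neg, map_one]
    ring

/-- The radial part contributes k² - k and the angular part -(k² - k). -/
theorem laplace_angPoly (k : ℕ) :
    px * D₁ (D₁ (angPoly k)) + py * D₂ (D₂ (angPoly k)) = 0 := by
  apply mul_left_cancel₀ px_add_py_ne_zero
  rw [add_mul_laplace, D₃_D₃_angPoly, eul_angPoly, Derivation.leibniz, eul_angPoly, derivation_C]
  simp only [map_sub, map_mul, map_neg, map_one, smul_eq_mul]
  ring

/-- The hypergeometric equation in s = x + y, where the Euler derivation is s d/ds: the factor s
shifts the power by one, and `jacCoef_succ` matches the coefficients. -/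
theorem radPoly_eq {g : ℝ} (hg : -1 < g) (k n : ℕ) :
    (px + py) * (eul (eul (radPoly g k n)) + MvPolynomial.C (2 * k + g) * eul (radPoly g k n)
      + MvPolynomial.C (k * (k + g) - (n + k) * (n + k + g)) * radPoly g k n) =
      eul (eul (radPoly g k n)) + MvPolynomial.C (2 * k - 1 : ℝ) * eul (radPoly g k n) := by
  have h1 : eul (-(px + py)) = -(px + py) := by simp [eul_apply]; ring
  set r : MvPolynomial (Fin 2) ℝ := -(px + py) with hr
  have hs : px + py = -r := by rw [hr]; ring
  set d : ℕ → ℝ := jacCoef (2 * k + (-1) + (-1) + 1) g n with hd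
  have hG : radPoly g k n = ∑ i ∈ Finset.range (n + 1), MvPolynomial.C (d i) * r ^ i := rfl
  have hE : eul (radPoly g k n) =
      ∑ i ∈ Finset.range (n + 1), MvPolynomial.C (d i) * (MvPolynomial.C (i : ℝ) * r ^ i) := by
    rw [hG, map_sum]
    refine Finset.sum_congr rfl fun i hi => ?_
    rw [Derivation.leibniz, derivation_C, derivation_pow_of_eq h1]; simp
  have hEE : eul (eul (radPoly g k n)) =
      ∑ i ∈ Finset.range (n + 1), MvPolynomial.C (d i) *
        (MvPolynomial.C (i : ℝ) * (MvPolynomial.C (i : ℝ) * r ^ i)) := by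
    rw [hE, map_sum]
    refine Finset.sum_congr rfl fun i hi => ?_
    simp only [Derivation.leibniz, derivation_C, derivation_pow_of_eq h1]; simp
  have e1 : eul (eul (radPoly g k n)) + MvPolynomial.C (2 * k + g) * eul (radPoly g k n)
      + MvPolynomial.C (k * (k + g) - (n + k) * (n + k + g)) * radPoly g k n =
      ∑ i ∈ Finset.range (n + 1), MvPolynomial.C
        (d i * ((i + k) * (i + k + g) - (n + k) * (n + k + g))) * r ^ i := by
    rw [hEE, hE, hG, Finset.mul_sum, Finset.mul_sum, ← Finset.sum_add_distrib,
      ← Finset.sum_add_distrib]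
    refine Finset.sum_congr rfl fun i hi => ?_
    simp only [map_sub, map_mul, map_add, map_ofNat]
    ring
  have e2 : eul (eul (radPoly g k n)) + MvPolynomial.C (2 * k - 1 : ℝ) * eul (radPoly g k n) =
      ∑ i ∈ Finset.range (n + 1), MvPolynomial.C (d i * (i * (i + 2 * k - 1))) * r ^ i := by
    rw [hEE, hE, Finset.mul_sum, ← Finset.sum_add_distrib]
    refine Finset.sum_congr rfl fun i hi => ?_
    simp only [map_sub, map_mul, map_add, map_ofNat]
    ring
  -- On the left the coefficient i = n is zero, on the right the coefficient i = 0; what remains has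
  -- the same length.
  rw [e1, e2, hs, Finset.sum_range_succ, Finset.sum_range_succ']
  simp only [sub_self, mul_zero, map_zero, zero_mul, Nat.cast_zero, add_zero]
  rw [Finset.mul_sum]
  refine Finset.sum_congr rfl fun i hi => ?_
  have hi : i < n := by simpa using hi
  have hi1 : (1 : ℝ) ≤ n := by exact_mod_cast (by omega : 1 ≤ n)
  have := jacCoef_succ (a := 2 * k + (-1) + (-1) + 1) (b := g) hi (by
    left
    have : (0 : ℝ) ≤ k := by positivity
    have : (0 : ℝ) ≤ i := by positivity
    intro h; linarith)
  have e3 : d (i + 1) * (((i + 1 : ℕ) : ℝ) * ((i + 1 : ℕ) + 2 * k - 1)) =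
      -(d i * ((i + k) * (i + k + g) - (n + k) * (n + k + g))) := by
    push_cast
    linear_combination this
  rw [e3, map_neg, pow_succ]
  ring

theorem D₃_radPoly (g : ℝ) (k n : ℕ) : D₃ (radPoly g k n) = 0 := by
  have h1 : D₃ (-(px + py)) = 0 := by simp [D₃_apply]
  rw [radPoly, map_sum]
  refine Finset.sum_eq_zero fun i _ => ?_
  rw [Derivation.leibniz, Derivation.leibniz_pow, h1, derivation_C]; simp

/-- The basis polynomials are eigenfunctions of `sobOp`. -/
theorem sobOp_basPoly {g : ℝ} (hg : -1 < g) {k m : ℕ} (hk : k ≤ m) :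
    sobOp g (basPoly g k m) = MvPolynomial.C ((m : ℝ) * (m + g)) * basPoly g k m := by
  obtain ⟨n, rfl⟩ := Nat.exists_eq_add_of_le hk
  have hrad := radPoly_eq hg k n
  have hang := laplace_angPoly k
  have heul := eul_angPoly k
  have hD : D₁ (radPoly g k n) = D₂ (radPoly g k n) := by
    have h2 := D₃_radPoly g k n
    rw [D₃_apply, sub_eq_zero] at h2
    exact h2.symm
  rw [basPoly, Nat.add_sub_cancel_left]
  set h := angPoly k
  set G := radPoly g k n
  -- The radial equation carries a factor x + y, so the identity is proved after multiplication by
  -- it.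
  apply mul_left_cancel₀ px_add_py_ne_zero
  have hE : eul G = (px + py) * D₂ G := by rw [eul_apply, hD]; ring
  have hEE : eul (eul G) = eul G + (px + py) ^ 2 * D₂ (D₂ G) := by
    have : D₁ (D₂ G) = D₂ (D₂ G) := by rw [← D₂_D₁, hD]
    have e : eul (D₂ G) = (px + py) * D₂ (D₂ G) := by rw [eul_apply, this]; ring
    have e2 : eul (px + py) = px + py := by simp [eul_apply]
    nth_rewrite 1 [hE]
    rw [Derivation.leibniz, e, e2, hE, smul_eq_mul, smul_eq_mul]; ring
  have hD12 : D₁ (D₁ G) = D₂ (D₂ G) := by rw [hD, ← D₂_D₁, hD]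
  -- The radial factor depends on x + y only, so its two partial derivatives agree and the cross
  -- terms combine into the Euler derivation of the angular factor.
  have hlap : px * D₁ (D₁ (h * G)) + py * D₂ (D₂ (h * G)) =
      (px * D₁ (D₁ h) + py * D₂ (D₂ h)) * G + 2 * eul h * D₂ G + (px + py) * h * D₂ (D₂ G) := by
    have hD21 : D₁ (D₂ G) = D₂ (D₂ G) := by rw [← hD12, hD]
    simp only [Derivation.leibniz, map_add, smul_eq_mul, eul_apply, hD, hD21]
    ring
  have hE1 : eul (h * G) = h * (MvPolynomial.C (k : ℝ) * G + eul G) := by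
    rw [Derivation.leibniz, heul, smul_eq_mul, smul_eq_mul]; ring
  have hE2 : eul (eul (h * G)) = h * (MvPolynomial.C (k : ℝ) ^ 2 * G
      + 2 * MvPolynomial.C (k : ℝ) * eul G + eul (eul G)) := by
    rw [hE1]
    simp only [Derivation.leibniz, map_add, smul_eq_mul, derivation_C, heul]
    ring
  rw [sobOp, hlap, hang, hE2, hE1, heul]
  simp only [map_add, map_mul, map_sub, map_one, map_ofNat, Nat.cast_add] at hrad ⊢
  linear_combination h * hrad + h * hEE
     + (2 * MvPolynomial.C (k : ℝ) - 0) * h * hE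

theorem D₃_basPoly_zero (g : ℝ) (m : ℕ) : D₃ (basPoly g 0 m) = 0 := by
  have h3 : D₃ (angPoly 0) = 0 := by simp [angPoly]
  rw [basPoly, Derivation.leibniz, D₃_radPoly, h3, smul_zero, smul_zero, add_zero]

theorem D₃_D₃_basPoly (g : ℝ) (k m : ℕ) :
    px * py * D₃ (D₃ (basPoly g k m)) =
      MvPolynomial.C (-((k : ℝ) * (k - 1))) * basPoly g k m := by
  have := D₃_D₃_angPoly k
  simp only [basPoly, Derivation.leibniz, D₃_radPoly, smul_eq_mul, mul_zero, zero_add]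
  linear_combination radPoly g k (m - k) * this

/-- For k ≥ 1 the constant coefficient of J_k^{-1,-1} in powers of (t - 1)/2 is zero, so the angular
factor is divisible by x. -/
theorem eval_basPoly_edge (g : ℝ) {k : ℕ} (hk : 1 ≤ k) (m : ℕ) (t : ℝ) :
    MvPolynomial.eval ![0, t] (basPoly g k m) = 0 := by
  have : MvPolynomial.eval ![0, t] (angPoly k) = 0 := by
    rw [angPoly, Finset.sum_range_succ', jacCoef_eq_zero (by omega) (by norm_num)]
    simp [map_sum]
  rw [basPoly, map_mul, this, zero_mul]

/-- At (-1, 1) the sum x + y vanishes and only the top term survives, with value 1/k!. -/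
theorem angPoly_ne_zero (k : ℕ) : angPoly k ≠ 0 := by
  intro h
  have := congrArg (MvPolynomial.eval ![-1, 1]) h
  rw [angPoly, Finset.sum_range_succ, map_add, map_sum, Finset.sum_eq_zero] at this
  · simp [jacCoef_self] at this
    exact (Nat.factorial_ne_zero k) this
  · intro i hi
    have hi : k - i ≠ 0 := by
      have : i < k := by simpa using hi
      omega
    simp [hi]

/-- On the line (-t, 0) it is a polynomial in t with leading coefficient 1/n!. -/
theorem radPoly_ne_zero (g : ℝ) (k n : ℕ) : radPoly g k n ≠ 0 := by
  intro h
  set d : ℕ → ℝ := jacCoef (2 * k + (-1) + (-1) + 1) g n with hd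
  have h1 : (∑ i ∈ Finset.range (n + 1), Polynomial.C (d i) * Polynomial.X ^ i) = 0 := by
    apply Polynomial.funext
    intro t
    have := congrArg (MvPolynomial.eval ![-t, 0]) h
    rw [radPoly] at this
    rw [← hd] at this
    simpa [map_sum, Polynomial.eval_finsetSum] using this
  have h2 := congrArg (fun p => Polynomial.coeff p n) h1
  simp [Polynomial.coeff_X_pow] at h2
  rw [hd, jacCoef_self] at h2
  simp [Nat.factorial_ne_zero] at h2

theorem basPoly_ne_zero (g : ℝ) (k m : ℕ) : basPoly g k m ≠ 0 :=
  mul_ne_zero (angPoly_ne_zero k) (radPoly_ne_zero g k _)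

theorem totalDegree_sum_px_py_le : (px + py).totalDegree ≤ 1 := by
  refine (MvPolynomial.totalDegree_add _ _).trans ?_
  simp

theorem totalDegree_basPoly_le (g : ℝ) {k m : ℕ} (hk : k ≤ m) :
    (basPoly g k m).totalDegree ≤ m := by
  have h1 : (angPoly k).totalDegree ≤ k := by
    refine MvPolynomial.totalDegree_finsetSum_le fun i hi => ?_
    have hi : i ≤ k := by simpa [Nat.lt_succ_iff] using hi
    refine (MvPolynomial.totalDegree_mul _ _).trans ?_
    rw [MvPolynomial.totalDegree_C, zero_add]
    refine (MvPolynomial.totalDegree_mul _ _).trans ?_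
    have a1 := MvPolynomial.totalDegree_pow (-px) i
    have a2 := MvPolynomial.totalDegree_pow (px + py) (k - i)
    have a3 := totalDegree_sum_px_py_le
    rw [MvPolynomial.totalDegree_neg, MvPolynomial.totalDegree_X, mul_one] at a1
    have a4 : (k - i) * (px + py).totalDegree ≤ (k - i) * 1 := Nat.mul_le_mul_left _ a3
    omega
  have h2 : (radPoly g k (m - k)).totalDegree ≤ m - k := by
    refine MvPolynomial.totalDegree_finsetSum_le fun i hi => ?_
    have hi : i ≤ m - k := by simpa [Nat.lt_succ_iff] using hi
    refine (MvPolynomial.totalDegree_mul _ _).trans ?_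
    rw [MvPolynomial.totalDegree_C, zero_add]
    have a2 := MvPolynomial.totalDegree_pow (-(px + py)) i
    have a3 := totalDegree_sum_px_py_le
    rw [MvPolynomial.totalDegree_neg] at a2
    have a4 : i * (px + py).totalDegree ≤ i * 1 := Nat.mul_le_mul_left _ a3
    omega
  refine (MvPolynomial.totalDegree_mul _ _).trans ?_
  omega

/-! ### Geometry and measure theory of the triangle -/

theorem isOpen_openTriangle : IsOpen openTriangle := by
  have : openTriangle = {q : ℝ × ℝ | 0 < q.1} ∩ ({q | 0 < q.2} ∩ {q | q.1 + q.2 < 1}) := rfl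
  rw [this]
  exact (isOpen_lt continuous_const continuous_fst).inter
    ((isOpen_lt continuous_const continuous_snd).inter
      (isOpen_lt (continuous_fst.add continuous_snd) continuous_const))

theorem measurableSet_openTriangle : MeasurableSet openTriangle := isOpen_openTriangle.measurableSet

theorem measurableSet_triangle : MeasurableSet triangle := by
  have : triangle = {q : ℝ × ℝ | 0 ≤ q.1} ∩ ({q | 0 ≤ q.2} ∩ {q | q.1 + q.2 ≤ 1}) := rfl
  rw [this]
  exact ((isClosed_le continuous_const continuous_fst).inter
    ((isClosed_le continuous_const continuous_snd).inter
      (isClosed_le (continuous_fst.add continuous_snd) continuous_const))).measurableSet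

theorem convex_openTriangle : Convex ℝ openTriangle := by
  rintro ⟨x, y⟩ ⟨h1, h2, h3⟩ ⟨x', y'⟩ ⟨h1', h2', h3'⟩ a b ha hb hab
  simp only at h1 h2 h3 h1' h2' h3'
  simp only [openTriangle, Prod.smul_mk, Prod.mk_add_mk, smul_eq_mul, Set.mem_ofPred_eq]
  rcases ha.eq_or_lt with rfl | ha
  · obtain rfl : b = 1 := by linarith
    simp only [zero_mul, one_mul, zero_add]
    exact ⟨h1', h2', h3'⟩
  · refine ⟨?_, ?_, ?_⟩
    · positivity
    · positivity
    · nlinarith [mul_lt_mul_of_pos_left h3 ha, mul_le_mul_of_nonneg_left h3'.le hb]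

theorem openTriangle_subset_triangle : openTriangle ⊆ triangle :=
  fun _ h => ⟨h.1.le, h.2.1.le, h.2.2.le⟩

theorem triangle_subset_closure : triangle ⊆ closure openTriangle := by
  rintro ⟨x, y⟩ ⟨h1, h2, h3⟩
  simp only at h1 h2 h3
  -- Points of the closed triangle are approached along the segment to the centroid.
  have ht : Tendsto (fun t : ℝ => (x + t * (1 / 3 - x), y + t * (1 / 3 - y))) (𝓝[>] 0)
      (𝓝 (x, y)) := by
    have : Tendsto (fun t : ℝ => (x + t * (1 / 3 - x), y + t * (1 / 3 - y))) (𝓝 0)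
        (𝓝 (x + 0 * (1 / 3 - x), y + 0 * (1 / 3 - y))) :=
      Continuous.tendsto (by fun_prop) 0
    simpa using this.mono_left nhdsWithin_le_nhds
  refine mem_closure_of_tendsto ht ?_
  filter_upwards [Ioo_mem_nhdsGT (show (0 : ℝ) < 1 by norm_num)] with t ht
  obtain ⟨ht0, ht1⟩ := ht
  refine ⟨?_, ?_, ?_⟩ <;> simp only <;> nlinarith

theorem volume_triangle_diff : volume (triangle \ openTriangle) = 0 := by
  refine measure_mono_null ?_ (convex_openTriangle.addHaar_frontier volume)
  rw [isOpen_openTriangle.frontier_eq]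
  exact Set.sdiff_subset_sdiff_left triangle_subset_closure

theorem restrict_triangle : volume.restrict triangle = volume.restrict openTriangle := by
  refine Measure.restrict_congr_set ?_
  refine (ae_eq_set).mpr ⟨volume_triangle_diff, ?_⟩
  rw [Set.sdiff_eq_empty.mpr openTriangle_subset_triangle, measure_empty]

theorem weight_zero_zero (g : ℝ) (q : ℝ × ℝ) : weight 0 0 g q = (1 - q.1 - q.2) ^ g := by
  simp [weight]

theorem triMeasure_zero_zero (g : ℝ) : triMeasure 0 0 g =
    (volume.restrict openTriangle).withDensity
      fun q => ENNReal.ofReal ((1 - q.1 - q.2) ^ g) := by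
  simp only [triMeasure, restrict_triangle, weight_zero_zero]

theorem measurable_rpow_z (g : ℝ) : Measurable fun q : ℝ × ℝ => (1 - q.1 - q.2) ^ g :=
  ((measurable_const.sub measurable_fst).sub measurable_snd).pow_const g

theorem rpow_z_nonneg (g : ℝ) {q : ℝ × ℝ} (hq : q ∈ openTriangle) : 0 ≤ (1 - q.1 - q.2) ^ g :=
  Real.rpow_nonneg (by linarith [hq.2.2]) g

theorem integral_triMeasure (g : ℝ) (F : ℝ × ℝ → ℝ) :
    ∫ q, F q ∂triMeasure 0 0 g = ∫ q in openTriangle, F q * (1 - q.1 - q.2) ^ g := by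
  rw [triMeasure_zero_zero, integral_withDensity_eq_integral_toReal_smul
    (measurable_rpow_z g).ennreal_ofReal (by simp)]
  refine setIntegral_congr_fun measurableSet_openTriangle fun q hq => ?_
  simp only [smul_eq_mul]
  rw [ENNReal.toReal_ofReal (rpow_z_nonneg g hq), mul_comm]

theorem integrable_triMeasure_iff (g : ℝ) (F : ℝ × ℝ → ℝ) :
    Integrable F (triMeasure 0 0 g) ↔
      IntegrableOn (fun q => F q * (1 - q.1 - q.2) ^ g) openTriangle := by
  rw [triMeasure_zero_zero, integrable_withDensity_iff (measurable_rpow_z g).ennreal_ofReal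
    (by simp)]
  refine integrableOn_congr_fun (fun q hq => ?_) measurableSet_openTriangle
  rw [ENNReal.toReal_ofReal (rpow_z_nonneg g hq)]

theorem ae_triMeasure_iff (g : ℝ) (p : ℝ × ℝ → Prop) :
    (∀ᵐ q ∂triMeasure 0 0 g, p q) ↔ ∀ᵐ q ∂volume.restrict openTriangle, p q := by
  rw [triMeasure_zero_zero]
  constructor
  · intro h
    refine (withDensity_absolutelyContinuous' (measurable_rpow_z g).ennreal_ofReal.aemeasurable
      ?_).ae_le h
    refine (ae_restrict_iff' measurableSet_openTriangle).mpr (Eventually.of_forall fun q hq => ?_)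
    simp only [ne_eq, ENNReal.ofReal_eq_zero, not_le]
    exact Real.rpow_pos_of_pos (by linarith [hq.2.2]) g
  · exact fun h => (withDensity_absolutelyContinuous _ _).ae_le h

theorem intervalIntegrable_one_sub_rpow {r : ℝ} (hr : -1 < r) :
    IntervalIntegrable (fun t : ℝ => (1 - t) ^ r) volume 0 1 := by
  have h := (intervalIntegral.intervalIntegrable_rpow' hr (a := 1) (b := 0)).comp_sub_left 1
  simpa using h

/-- The shear (x, y) ↦ (x, x + y) preserves area, puts the triangle inside the unit square and makes
the weight a function of one coordinate. -/
theorem integrableOn_rpow_z {g : ℝ} (hg : -1 < g) :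
    IntegrableOn (fun q : ℝ × ℝ => (1 - q.1 - q.2) ^ g) openTriangle := by
  have h1 : Integrable ((Set.Ioo (0 : ℝ) 1).indicator fun _ => (1 : ℝ)) := by
    rw [integrable_indicator_iff measurableSet_Ioo]
    simp
  have h2 : Integrable ((Set.Ioo (0 : ℝ) 1).indicator fun t => (1 - t) ^ g) := by
    rw [integrable_indicator_iff measurableSet_Ioo]
    exact (intervalIntegrable_iff_integrableOn_Ioo_of_le zero_le_one).mp
      (intervalIntegrable_one_sub_rpow hg)
  have h3 := h1.mul_prod h2
  have h4 := ((measurePreserving_prod_add (volume : Measure ℝ)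
    (volume : Measure ℝ)).integrable_comp h3.aestronglyMeasurable).mpr h3
  refine h4.integrableOn.congr_fun (fun q hq => ?_) measurableSet_openTriangle
  obtain ⟨hx, hy, hxy⟩ := hq
  have m1 : q.1 ∈ Set.Ioo (0 : ℝ) 1 := ⟨hx, by linarith⟩
  have m2 : q.1 + q.2 ∈ Set.Ioo (0 : ℝ) 1 := ⟨by linarith, hxy⟩
  simp only [Function.comp]
  rw [Set.indicator_of_mem m1, Set.indicator_of_mem m2, one_mul]
  congr 1
  ring

theorem isFiniteMeasure_triMeasure {g : ℝ} (hg : -1 < g) : IsFiniteMeasure (triMeasure 0 0 g) := by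
  have h : Integrable (fun _ => (1 : ℝ)) (triMeasure 0 0 g) := by
    rw [integrable_triMeasure_iff]
    simpa using integrableOn_rpow_z hg
  exact (integrable_const_iff_isFiniteMeasure one_ne_zero).mp h

/-- Fubini's theorem on the triangle, integrating over horizontal lines first. -/
theorem openTriangle_fubini {F : ℝ × ℝ → ℝ} (hF : IntegrableOn F openTriangle) :
    (∀ᵐ y : ℝ, y ∈ Set.Ioo (0 : ℝ) 1 →
      IntervalIntegrable (fun x => F (x, y)) volume 0 (1 - y)) ∧
    IntervalIntegrable (fun y => ∫ x in (0 : ℝ)..(1 - y), F (x, y)) volume 0 1 ∧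
    ∫ q in openTriangle, F q = ∫ y in (0 : ℝ)..1, ∫ x in (0 : ℝ)..(1 - y), F (x, y) := by
  set G := openTriangle.indicator F with hG
  have hGi : Integrable G (volume.prod volume) := by
    rw [← Measure.volume_eq_prod, hG, integrable_indicator_iff measurableSet_openTriangle]
    exact hF
  have hs : ∀ y ∈ Set.Ioo (0 : ℝ) 1, (fun x => G (x, y)) =
      (Set.Ioo 0 (1 - y)).indicator fun x => F (x, y) := by
    intro y hy
    ext x
    simp only [hG, Set.indicator, openTriangle, Set.mem_ofPred_eq, Set.mem_Ioo]
    by_cases h : 0 < x ∧ x < 1 - y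
    · rw [if_pos ⟨h.1, hy.1, by linarith [h.2]⟩, if_pos h]
    · rw [if_neg (fun h' => h ⟨h'.1, by linarith [h'.2.2]⟩), if_neg h]
  have hs' : ∀ y, y ∉ Set.Ioo (0 : ℝ) 1 → (fun x => G (x, y)) = fun _ => 0 := by
    intro y hy
    ext x
    simp only [hG, Set.indicator, openTriangle, Set.mem_ofPred_eq]
    rw [if_neg]
    rintro ⟨h1, h2, h3⟩
    exact hy ⟨h2, by linarith⟩
  have hint : (fun y => ∫ x, G (x, y)) =
      (Set.Ioo (0 : ℝ) 1).indicator fun y => ∫ x in (0 : ℝ)..(1 - y), F (x, y) := by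
    ext y
    by_cases hy : y ∈ Set.Ioo (0 : ℝ) 1
    · rw [Set.indicator_of_mem hy, hs y hy, integral_indicator measurableSet_Ioo,
        intervalIntegral.integral_of_le (by linarith [hy.2]), integral_Ioc_eq_integral_Ioo]
    · rw [Set.indicator_of_notMem hy, hs' y hy, integral_zero]
  refine ⟨?_, ?_, ?_⟩
  · filter_upwards [hGi.prod_left_ae] with y h hy
    rw [hs y hy, integrable_indicator_iff measurableSet_Ioo] at h
    exact (intervalIntegrable_iff_integrableOn_Ioo_of_le (by linarith [hy.2])).mpr h
  · have := hGi.integral_prod_right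
    rw [hint, integrable_indicator_iff measurableSet_Ioo] at this
    exact (intervalIntegrable_iff_integrableOn_Ioo_of_le zero_le_one).mpr this
  · rw [← integral_indicator measurableSet_openTriangle, ← hG, Measure.volume_eq_prod,
      integral_prod_symm _ hGi, hint, integral_indicator measurableSet_Ioo,
      intervalIntegral.integral_of_le zero_le_one, integral_Ioc_eq_integral_Ioo]

/-! ### The affine symmetries of the triangle -/

/-- The reflection `(x, y) ↦ (x, 1 - x - y)` of the triangle. -/
def refl₃ (q : ℝ × ℝ) : ℝ × ℝ := (q.1, 1 - q.1 - q.2)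

/-- An affine involution of the triangle that preserves area. -/
structure IsTriangleSymm (A : ℝ × ℝ → ℝ × ℝ) (L : (ℝ × ℝ) →L[ℝ] (ℝ × ℝ)) : Prop where
  invol : Function.Involutive A
  hasFDerivAt : ∀ q, HasFDerivAt A L q
  measurePreserving : MeasurePreserving A volume volume
  mem_iff : ∀ q, A q ∈ openTriangle ↔ q ∈ openTriangle
  contDiff : ContDiff ℝ ∞ A

theorem isTriangleSymm_swap : IsTriangleSymm Prod.swap
    ((ContinuousLinearMap.snd ℝ ℝ ℝ).prod (ContinuousLinearMap.fst ℝ ℝ ℝ)) where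
  invol := Prod.swap_swap
  hasFDerivAt q := hasFDerivAt_snd.prodMk hasFDerivAt_fst
  measurePreserving := Measure.measurePreserving_swap
  mem_iff q := by
    simp only [openTriangle, Set.mem_ofPred_eq, Prod.fst_swap, Prod.snd_swap]
    constructor <;> rintro ⟨h1, h2, h3⟩ <;> exact ⟨h2, h1, by linarith⟩
  contDiff := contDiff_snd.prodMk contDiff_fst

theorem isTriangleSymm_refl₃ : IsTriangleSymm refl₃
    ((ContinuousLinearMap.fst ℝ ℝ ℝ).prod
      (-ContinuousLinearMap.fst ℝ ℝ ℝ - ContinuousLinearMap.snd ℝ ℝ ℝ)) where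
  invol q := by simp [refl₃]
  hasFDerivAt q := by
    refine hasFDerivAt_fst.prodMk ?_
    have h := ((hasFDerivAt_const (1 : ℝ) q).sub
      (hasFDerivAt_fst (𝕜 := ℝ) (E := ℝ) (F := ℝ) (p := q))).sub
      (hasFDerivAt_snd (𝕜 := ℝ) (E := ℝ) (F := ℝ) (p := q))
    rwa [zero_sub] at h
  measurePreserving := by
    have h1 := measurePreserving_prod_add (volume : Measure ℝ) (volume : Measure ℝ)
    have h2 : MeasurePreserving (fun t : ℝ => 1 - t) := Measure.measurePreserving_sub_left volume 1
    have h3 := ((MeasurePreserving.id (volume : Measure ℝ)).prod h2).comp h1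
    have e : refl₃ = (Prod.map id fun t : ℝ => 1 - t) ∘ fun z : ℝ × ℝ => (z.1, z.1 + z.2) := by
      funext q
      simp [refl₃, sub_sub]
    rw [e, Measure.volume_eq_prod]
    exact h3
  mem_iff q := by
    simp only [openTriangle, Set.mem_ofPred_eq, refl₃]
    constructor <;> rintro ⟨h1, h2, h3⟩ <;> exact ⟨by linarith, by linarith, by linarith⟩
  contDiff := by unfold refl₃; fun_prop

namespace IsTriangleSymm

theorem continuous {A : ℝ × ℝ → ℝ × ℝ} {L : (ℝ × ℝ) →L[ℝ] (ℝ × ℝ)}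
    (hA : IsTriangleSymm A L) : Continuous A := hA.contDiff.continuous

theorem preimage_openTriangle {A : ℝ × ℝ → ℝ × ℝ} {L : (ℝ × ℝ) →L[ℝ] (ℝ × ℝ)}
    (hA : IsTriangleSymm A L) : A ⁻¹' openTriangle = openTriangle := Set.ext hA.mem_iff

theorem measurableEmbedding {A : ℝ × ℝ → ℝ × ℝ} {L : (ℝ × ℝ) →L[ℝ] (ℝ × ℝ)}
    (hA : IsTriangleSymm A L) : MeasurableEmbedding A :=
  (Homeomorph.mk ⟨A, A, hA.invol, hA.invol⟩ hA.continuous hA.continuous).measurableEmbedding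

theorem measurePreserving_restrict {A : ℝ × ℝ → ℝ × ℝ} {L : (ℝ × ℝ) →L[ℝ] (ℝ × ℝ)}
    (hA : IsTriangleSymm A L) :
    MeasurePreserving A (volume.restrict openTriangle) (volume.restrict openTriangle) := by
  have := hA.measurePreserving.restrict_preimage measurableSet_openTriangle
  rwa [hA.preimage_openTriangle] at this

theorem setIntegral_comp {A : ℝ × ℝ → ℝ × ℝ} {L : (ℝ × ℝ) →L[ℝ] (ℝ × ℝ)}
    (hA : IsTriangleSymm A L) (F : ℝ × ℝ → ℝ) :
    ∫ q in openTriangle, F (A q) = ∫ q in openTriangle, F q :=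
  hA.measurePreserving_restrict.integral_comp hA.measurableEmbedding F

theorem integrableOn_comp {A : ℝ × ℝ → ℝ × ℝ} {L : (ℝ × ℝ) →L[ℝ] (ℝ × ℝ)}
    (hA : IsTriangleSymm A L) {F : ℝ × ℝ → ℝ} (hF : IntegrableOn F openTriangle) :
    IntegrableOn (fun q => F (A q)) openTriangle :=
  (hA.measurePreserving_restrict.integrable_comp_emb hA.measurableEmbedding).mpr hF

theorem ae_comp {A : ℝ × ℝ → ℝ × ℝ} {L : (ℝ × ℝ) →L[ℝ] (ℝ × ℝ)}
    (hA : IsTriangleSymm A L) {p : ℝ × ℝ → Prop} (h : ∀ᵐ q ∂volume.restrict openTriangle, p q) :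
    ∀ᵐ q ∂volume.restrict openTriangle, p (A q) :=
  hA.measurePreserving_restrict.quasiMeasurePreserving.ae h

end IsTriangleSymm

/-! ### Integration of polynomials over the triangle -/

/-- The polynomial function attached to a polynomial. -/
def ev (p : MvPolynomial (Fin 2) ℝ) (q : ℝ × ℝ) : ℝ := MvPolynomial.eval ![q.1, q.2] p

@[simp] theorem ev_add (p r : MvPolynomial (Fin 2) ℝ) (q : ℝ × ℝ) :
    ev (p + r) q = ev p q + ev r q := map_add _ _ _

@[simp] theorem ev_sub (p r : MvPolynomial (Fin 2) ℝ) (q : ℝ × ℝ) :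
    ev (p - r) q = ev p q - ev r q := map_sub _ _ _

@[simp] theorem ev_neg (p : MvPolynomial (Fin 2) ℝ) (q : ℝ × ℝ) : ev (-p) q = -ev p q :=
  map_neg _ _

@[simp] theorem ev_mul (p r : MvPolynomial (Fin 2) ℝ) (q : ℝ × ℝ) :
    ev (p * r) q = ev p q * ev r q := map_mul _ _ _

@[simp] theorem ev_pow (p : MvPolynomial (Fin 2) ℝ) (n : ℕ) (q : ℝ × ℝ) :
    ev (p ^ n) q = ev p q ^ n := map_pow _ _ _

@[simp] theorem ev_C (a : ℝ) (q : ℝ × ℝ) : ev (MvPolynomial.C a) q = a := MvPolynomial.eval_C _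

@[simp] theorem ev_one (q : ℝ × ℝ) : ev 1 q = 1 := map_one _

@[simp] theorem ev_zero (q : ℝ × ℝ) : ev 0 q = 0 := map_zero _

@[simp] theorem ev_smul (a : ℝ) (p : MvPolynomial (Fin 2) ℝ) (q : ℝ × ℝ) :
    ev (a • p) q = a * ev p q := by simp [MvPolynomial.smul_eq_C_mul]

@[simp] theorem ev_px (q : ℝ × ℝ) : ev px q = q.1 := by simp [ev]

@[simp] theorem ev_py (q : ℝ × ℝ) : ev py q = q.2 := by simp [ev]

theorem ev_sum {ι : Type*} (s : Finset ι) (p : ι → MvPolynomial (Fin 2) ℝ) (q : ℝ × ℝ) :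
    ev (∑ i ∈ s, p i) q = ∑ i ∈ s, ev (p i) q := map_sum _ _ _

theorem hasFDerivAt_ev (p : MvPolynomial (Fin 2) ℝ) (q : ℝ × ℝ) :
    HasFDerivAt (ev p) (ev (D₁ p) q • ContinuousLinearMap.fst ℝ ℝ ℝ +
      ev (D₂ p) q • ContinuousLinearMap.snd ℝ ℝ ℝ) q := by
  induction p using MvPolynomial.induction_on with
  | C a =>
    have : ev (MvPolynomial.C a) = fun _ => a := funext fun q => ev_C a q
    rw [this]
    exact (hasFDerivAt_const a q).congr_fderiv (by simp)
  | add p r hp hr =>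
    have : ev (p + r) = fun q => ev p q + ev r q := funext fun q => ev_add p r q
    rw [this]
    refine (hp.add hr).congr_fderiv ?_
    ext <;> simp
  | mul_X p i hp =>
    have hX : HasFDerivAt (ev (MvPolynomial.X i)) (ev (D₁ (MvPolynomial.X i)) q •
        ContinuousLinearMap.fst ℝ ℝ ℝ + ev (D₂ (MvPolynomial.X i)) q •
        ContinuousLinearMap.snd ℝ ℝ ℝ) q := by
      fin_cases i
      · have : ev px = Prod.fst := funext ev_px
        change HasFDerivAt (ev px) (ev (D₁ px) q • _ + ev (D₂ px) q • _) q
        rw [this]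
        refine (hasFDerivAt_fst (𝕜 := ℝ) (p := q)).congr_fderiv ?_
        ext <;> simp
      · have : ev py = Prod.snd := funext ev_py
        change HasFDerivAt (ev py) (ev (D₁ py) q • _ + ev (D₂ py) q • _) q
        rw [this]
        refine (hasFDerivAt_snd (𝕜 := ℝ) (p := q)).congr_fderiv ?_
        ext <;> simp
    have : ev (p * MvPolynomial.X i) = fun q => ev p q * ev (MvPolynomial.X i) q :=
      funext fun q => ev_mul p _ q
    rw [this]
    refine (hp.mul hX).congr_fderiv ?_
    ext <;> simp [Derivation.leibniz]

theorem contDiff_ev (p : MvPolynomial (Fin 2) ℝ) : ContDiff ℝ ∞ (ev p) := by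
  induction p using MvPolynomial.induction_on with
  | C a =>
    have : ev (MvPolynomial.C a) = fun _ => a := funext fun q => ev_C a q
    rw [this]
    exact contDiff_const
  | add p r hp hr =>
    have : ev (p + r) = fun q => ev p q + ev r q := funext fun q => ev_add p r q
    rw [this]
    exact hp.add hr
  | mul_X p i hp =>
    have : ev (p * MvPolynomial.X i) = fun q => ev p q * ev (MvPolynomial.X i) q :=
      funext fun q => ev_mul p _ q
    rw [this]
    refine hp.mul ?_
    fin_cases i
    · exact (funext ev_px : ev px = Prod.fst) ▸ contDiff_fst
    · exact (funext ev_py : ev py = Prod.snd) ▸ contDiff_snd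

theorem continuous_ev (p : MvPolynomial (Fin 2) ℝ) : Continuous (ev p) := (contDiff_ev p).continuous

theorem hasDerivAt_ev_comp (p : MvPolynomial (Fin 2) ℝ) {a b : ℝ → ℝ} {a' b' t : ℝ}
    (ha : HasDerivAt a a' t) (hb : HasDerivAt b b' t) :
    HasDerivAt (fun t => ev p (a t, b t))
      (ev (D₁ p) (a t, b t) * a' + ev (D₂ p) (a t, b t) * b') t := by
  have := (hasFDerivAt_ev p (a t, b t)).comp_hasDerivAt t (ha.prodMk hb)
  exact this.congr_deriv (by simp)

theorem exists_abs_ev_le (p : MvPolynomial (Fin 2) ℝ) :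
    ∃ M : ℝ, 0 ≤ M ∧ ∀ q ∈ triangle, |ev p q| ≤ M := by
  obtain ⟨M, hM⟩ := (isCompact_Icc (a := ((0 : ℝ), (0 : ℝ))) (b := (1, 1))).exists_bound_of_continuousOn
    (continuous_ev p).continuousOn
  have hm : ∀ q ∈ triangle, |ev p q| ≤ M := by
    rintro ⟨x, y⟩ ⟨h1, h2, h3⟩
    simp only at h1 h2 h3
    refine hM _ ⟨⟨h1, h2⟩, ⟨?_, ?_⟩⟩ <;> simp only <;> linarith
  exact ⟨M, (abs_nonneg _).trans (hm (0, 0) ⟨le_rfl, le_rfl, by norm_num⟩), hm⟩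

theorem memLp_ev {g : ℝ} (hg : -1 < g) (p : MvPolynomial (Fin 2) ℝ) :
    MemLp (ev p) 2 (triMeasure 0 0 g) := by
  have := isFiniteMeasure_triMeasure hg
  obtain ⟨M, -, hM⟩ := exists_abs_ev_le p
  refine MemLp.of_bound (continuous_ev p).aestronglyMeasurable M ?_
  rw [ae_triMeasure_iff]
  exact (ae_restrict_iff' measurableSet_openTriangle).mpr
    (Eventually.of_forall fun q hq => hM q (openTriangle_subset_triangle hq))

theorem integrable_ev {g : ℝ} (hg : -1 < g) (p : MvPolynomial (Fin 2) ℝ) :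
    Integrable (ev p) (triMeasure 0 0 g) := by
  have := isFiniteMeasure_triMeasure hg
  exact (memLp_ev hg p).integrable (by norm_num)

/-- Integration of a polynomial over the triangle with the weight of parameters `0, 0, g`. -/
def triInt (g : ℝ) (p : MvPolynomial (Fin 2) ℝ) : ℝ := ∫ q, ev p q ∂triMeasure 0 0 g

/-- Integration of a polynomial over the edge `x = 0` with the weight `(1 - y) ^ (g + 1)`. -/
def edgeInt (g : ℝ) (p : MvPolynomial (Fin 2) ℝ) : ℝ :=
  ∫ t in (0 : ℝ)..1, ev p (0, t) * (1 - t) ^ (g + 1)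

theorem triInt_add {g : ℝ} (hg : -1 < g) (p r : MvPolynomial (Fin 2) ℝ) :
    triInt g (p + r) = triInt g p + triInt g r := by
  simp only [triInt, ev_add]
  exact integral_add (integrable_ev hg p) (integrable_ev hg r)

theorem triInt_sub {g : ℝ} (hg : -1 < g) (p r : MvPolynomial (Fin 2) ℝ) :
    triInt g (p - r) = triInt g p - triInt g r := by
  simp only [triInt, ev_sub]
  exact integral_sub (integrable_ev hg p) (integrable_ev hg r)

theorem triInt_neg (g : ℝ) (p : MvPolynomial (Fin 2) ℝ) : triInt g (-p) = -triInt g p := by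
  simp only [triInt, ev_neg]
  exact integral_neg _

theorem triInt_C_mul (g a : ℝ) (p : MvPolynomial (Fin 2) ℝ) :
    triInt g (MvPolynomial.C a * p) = a * triInt g p := by
  simp only [triInt, ev_mul, ev_C]
  exact integral_const_mul _ _

theorem triInt_zero (g : ℝ) : triInt g 0 = 0 := by simp [triInt]

theorem triInt_mono {g : ℝ} (hg : -1 < g) {p r : MvPolynomial (Fin 2) ℝ}
    (h : ∀ q ∈ openTriangle, ev p q ≤ ev r q) : triInt g p ≤ triInt g r := by
  refine integral_mono_ae (integrable_ev hg p) (integrable_ev hg r) ?_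
  change ∀ᵐ q ∂triMeasure 0 0 g, ev p q ≤ ev r q
  rw [ae_triMeasure_iff]
  exact (ae_restrict_iff' measurableSet_openTriangle).mpr (Eventually.of_forall h)

theorem triInt_eq_sub_of_add {g : ℝ} (p : MvPolynomial (Fin 2) ℝ) :
    triInt g (pz * p) = triInt (g + 1) p := by
  rw [triInt, triInt, integral_triMeasure, integral_triMeasure]
  refine setIntegral_congr_fun measurableSet_openTriangle fun q hq => ?_
  have hz : 0 < 1 - q.1 - q.2 := by linarith [hq.2.2]
  simp only [ev_mul, ev_sub, ev_one, ev_px, ev_py]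
  rw [Real.rpow_add_one hz.ne']
  ring

/-! ### Integration by parts on the triangle without boundary terms -/

/-- The fundamental theorem of calculus on horizontal lines. -/
theorem integral_eq_zero_of_hasDerivAt_lines {H H' : ℝ × ℝ → ℝ}
    (hH' : IntegrableOn H' openTriangle)
    (hc : ∀ y ∈ Set.Ioo (0 : ℝ) 1, ContinuousOn (fun x => H (x, y)) (Set.Icc 0 (1 - y)))
    (hd : ∀ q ∈ openTriangle, HasDerivAt (fun x => H (x, q.2)) (H' q) q.1)
    (h0 : ∀ y ∈ Set.Ioo (0 : ℝ) 1, H (0, y) = 0)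
    (h1 : ∀ y ∈ Set.Ioo (0 : ℝ) 1, H (1 - y, y) = 0) :
    ∫ q in openTriangle, H' q = 0 := by
  obtain ⟨f1, -, f3⟩ := openTriangle_fubini hH'
  rw [f3, intervalIntegral.integral_of_le zero_le_one, integral_Ioc_eq_integral_Ioo]
  refine integral_eq_zero_of_ae ?_
  refine (ae_restrict_iff' measurableSet_Ioo).mpr ?_
  filter_upwards [f1] with y hy hy01
  rw [intervalIntegral.integral_eq_sub_of_hasDerivAt_of_le (by linarith [hy01.2]) (hc y hy01)
    (fun x hx => hd (x, y) ⟨hx.1, hy01.1, by simp only; linarith [hx.2]⟩) (hy hy01),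
    h0 y hy01, h1 y hy01, sub_zero]
  rfl

/-- A symmetry `A` makes the direction of differentiation horizontal; the weighted integrand is then
the derivative of a function `H` that vanishes at both ends of each line. -/
theorem triInt_eq_zero_of_eq {g : ℝ} (hg : -1 < g) {p : MvPolynomial (Fin 2) ℝ} {H : ℝ × ℝ → ℝ}
    {A : ℝ × ℝ → ℝ × ℝ} {L : (ℝ × ℝ) →L[ℝ] (ℝ × ℝ)} (hA : IsTriangleSymm A L)
    (hc : ∀ y ∈ Set.Ioo (0 : ℝ) 1, ContinuousOn (fun x => H (x, y)) (Set.Icc 0 (1 - y)))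
    (hd : ∀ q ∈ openTriangle, HasDerivAt (fun x => H (x, q.2))
      (ev p (A q) * (1 - (A q).1 - (A q).2) ^ g) q.1)
    (h0 : ∀ y ∈ Set.Ioo (0 : ℝ) 1, H (0, y) = 0)
    (h1 : ∀ y ∈ Set.Ioo (0 : ℝ) 1, H (1 - y, y) = 0) :
    triInt g p = 0 := by
  have hi := (integrable_triMeasure_iff g (ev p)).mp (integrable_ev hg p)
  rw [triInt, integral_triMeasure, ← hA.setIntegral_comp]
  exact integral_eq_zero_of_hasDerivAt_lines (hA.integrableOn_comp hi) hc hd h0 h1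

theorem isTriangleSymm_id : IsTriangleSymm id (ContinuousLinearMap.id ℝ (ℝ × ℝ)) where
  invol := fun _ => rfl
  hasFDerivAt := hasFDerivAt_id
  measurePreserving := MeasurePreserving.id _
  mem_iff := fun _ => Iff.rfl
  contDiff := contDiff_id

/-- The weighted difference of the two integrands is ∂₁ of xF z^(g+1); x vanishes on one edge and
z^(g+1) on the other because g + 1 > 0. -/
theorem triInt_ibp₁ {g : ℝ} (hg : -1 < g) (F : MvPolynomial (Fin 2) ℝ) :
    triInt g (pz * (F + px * D₁ F)) = (g + 1) * triInt g (px * F) := by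
  rw [← triInt_C_mul, ← sub_eq_zero, ← triInt_sub hg]
  refine triInt_eq_zero_of_eq hg isTriangleSymm_id
    (H := fun q => ev (px * F) q * (1 - q.1 - q.2) ^ (g + 1)) ?_ ?_ ?_ ?_
  · intro y hy
    refine ContinuousOn.mul ((continuous_ev _).comp (by fun_prop)).continuousOn ?_
    exact ContinuousOn.rpow_const (by fun_prop) fun x hx => Or.inr (by linarith)
  · rintro ⟨x, y⟩ ⟨hx, hy, hxy⟩
    simp only at hx hy hxy
    have hz : 0 < 1 - x - y := by linarith
    have a1 := hasDerivAt_ev_comp (px * F) (hasDerivAt_id x) (hasDerivAt_const x y)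
    have a2 := (((hasDerivAt_const x (1 : ℝ)).sub (hasDerivAt_id x)).sub_const y).rpow_const
      (p := g + 1) (Or.inl hz.ne')
    refine (a1.mul a2).congr_deriv ?_
    simp only [id, Derivation.leibniz, D₁_px, smul_eq_mul, ev_sub, ev_mul, ev_add, ev_one, ev_px,
      ev_py, ev_C, add_sub_cancel_right, Pi.sub_apply]
    rw [Real.rpow_add_one hz.ne']
    ring
  · intro y hy; simp
  · intro y hy
    have : 1 - (1 - y) - y = 0 := by ring
    rw [this, Real.zero_rpow (by linarith), mul_zero]

theorem triInt_ibp₂ {g : ℝ} (hg : -1 < g) (F : MvPolynomial (Fin 2) ℝ) :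
    triInt g (pz * (F + py * D₂ F)) = (g + 1) * triInt g (py * F) := by
  rw [← triInt_C_mul, ← sub_eq_zero, ← triInt_sub hg]
  refine triInt_eq_zero_of_eq hg isTriangleSymm_swap
    (H := fun q => ev (py * F) (q.2, q.1) * (1 - q.2 - q.1) ^ (g + 1)) ?_ ?_ ?_ ?_
  · intro y hy
    refine ContinuousOn.mul ((continuous_ev _).comp (by fun_prop)).continuousOn ?_
    exact ContinuousOn.rpow_const (by fun_prop) fun x hx => Or.inr (by linarith)
  · rintro ⟨x, y⟩ ⟨hx, hy, hxy⟩
    simp only at hx hy hxy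
    have hz : 0 < 1 - y - x := by linarith
    have a1 := hasDerivAt_ev_comp (py * F) (hasDerivAt_const x y) (hasDerivAt_id x)
    have a2 := ((hasDerivAt_const x (1 - y : ℝ)).sub (hasDerivAt_id x)).rpow_const
      (p := g + 1) (Or.inl hz.ne')
    refine (a1.mul a2).congr_deriv ?_
    simp only [id, Derivation.leibniz, D₂_py, smul_eq_mul, ev_sub, ev_mul, ev_add, ev_one, ev_px,
      ev_py, ev_C, add_sub_cancel_right, Pi.sub_apply, Prod.swap]
    rw [Real.rpow_add_one hz.ne']
    ring
  · intro y hy; simp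
  · intro y hy
    have : 1 - y - (1 - y) = 0 := by ring
    rw [this, Real.zero_rpow (by linarith), mul_zero]

/-- The weight is constant in the direction of ∂₃, and xy vanishes at both ends of each line x + y =
const. -/
theorem triInt_ibp₃ {g : ℝ} (hg : -1 < g) (F : MvPolynomial (Fin 2) ℝ) :
    triInt g (D₃ (px * py * F)) = 0 := by
  -- Differentiating F(x, 1 - x - y) in x gives -∂₃F, hence the sign.
  rw [← neg_eq_zero, ← triInt_neg]
  refine triInt_eq_zero_of_eq hg isTriangleSymm_refl₃
    (H := fun q => ev (px * py * F) (q.1, 1 - q.1 - q.2) * q.2 ^ g) ?_ ?_ ?_ ?_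
  · intro y hy
    exact (((continuous_ev _).comp (by fun_prop : Continuous fun x : ℝ => (x, 1 - x - y))).mul_const
      (y ^ g)).continuousOn
  · rintro ⟨x, y⟩ ⟨hx, hy, hxy⟩
    simp only at hx hy hxy
    have a1 := hasDerivAt_ev_comp (px * py * F) (hasDerivAt_id x)
      (((hasDerivAt_const x (1 : ℝ)).sub (hasDerivAt_id x)).sub_const y)
    refine (a1.mul_const (y ^ g)).congr_deriv ?_
    simp only [id, refl₃, D₃_apply, ev_neg, ev_sub, Pi.sub_apply, sub_sub_cancel]
    ring_nf
  · intro y hy; simp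
  · intro y hy; simp

/-- The divergence theorem for the field F z^(g+1) (x, y). It trades the weight x + y for z at the
cost of one Euler derivative, and since (x + y) + z = 1 it serves as a Hardy inequality. -/
theorem triInt_ibp_eul {g : ℝ} (hg : -1 < g) (F : MvPolynomial (Fin 2) ℝ) :
    (g + 1) * triInt g ((px + py) * F) = triInt g (pz * (2 * F + eul F)) := by
  have h1 := triInt_ibp₁ hg F
  have h2 := triInt_ibp₂ hg F
  have e1 : (px + py) * F = px * F + py * F := by ring
  have e2 : pz * (2 * F + eul F) = pz * (F + px * D₁ F) + pz * (F + py * D₂ F) := by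
    rw [eul_apply]; ring
  rw [e1, e2, triInt_add hg, triInt_add hg, h1, h2]
  ring

/-- The energy form of `jacOp`. -/
theorem triInt_mul_jacOp {g : ℝ} (hg : -1 < g) (p q : MvPolynomial (Fin 2) ℝ) :
    triInt g (p * jacOp g q) = triInt g (px * py * (D₃ p * D₃ q)) +
      triInt g (px * pz * (D₁ p * D₁ q)) + triInt g (py * pz * (D₂ p * D₂ q)) := by
  have h1 := triInt_ibp₁ hg (p * D₁ q)
  have h2 := triInt_ibp₂ hg (p * D₂ q)
  have h3 := triInt_ibp₃ hg (p * D₃ q)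
  rw [← triInt_C_mul] at h1 h2
  rw [← triInt_add hg, ← triInt_add hg, ← sub_eq_zero, ← triInt_sub hg]
  have e : p * jacOp g q - (px * py * (D₃ p * D₃ q) + px * pz * (D₁ p * D₁ q) +
      py * pz * (D₂ p * D₂ q)) = -D₃ (px * py * (p * D₃ q))
      - (pz * (p * D₁ q + px * D₁ (p * D₁ q)) - MvPolynomial.C (g + 1) * (px * (p * D₁ q)))
      - (pz * (p * D₂ q + py * D₂ (p * D₂ q)) - MvPolynomial.C (g + 1) * (py * (p * D₂ q))) := by
    rw [jacOp_eq]
    simp only [Derivation.leibniz, smul_eq_mul]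
    ring
  rw [e, triInt_sub hg, triInt_sub hg, triInt_sub hg, triInt_sub hg, triInt_neg, h1, h2, h3]
  ring

theorem triInt_jacOp_comm {g : ℝ} (hg : -1 < g) (p q : MvPolynomial (Fin 2) ℝ) :
    triInt g (p * jacOp g q) = triInt g (jacOp g p * q) := by
  rw [mul_comm (jacOp g p), triInt_mul_jacOp hg, triInt_mul_jacOp hg]
  simp only [mul_comm (D₁ p), mul_comm (D₂ p), mul_comm (D₃ p)]

/-! ### Polynomials as elements of the weighted `L²` space -/

/-- Polynomials as elements of `L²` of the triangle with the weight of parameters `0, 0, g`. -/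
def toL2 {g : ℝ} (hg : -1 < g) :
    MvPolynomial (Fin 2) ℝ →ₗ[ℝ] Lp ℝ 2 (triMeasure 0 0 g) where
  toFun p := (memLp_ev hg p).toLp
  map_add' p r := by
    rw [← MemLp.toLp_add]
    exact MemLp.toLp_congr _ _ (Eventually.of_forall fun q => ev_add p r q)
  map_smul' a p := by
    rw [RingHom.id_apply, ← MemLp.toLp_const_smul]
    exact MemLp.toLp_congr _ _ (Eventually.of_forall fun q => ev_smul a p q)

theorem coeFn_toL2 {g : ℝ} (hg : -1 < g) (p : MvPolynomial (Fin 2) ℝ) :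
    toL2 hg p =ᵐ[triMeasure 0 0 g] ev p := (memLp_ev hg p).coeFn_toLp

theorem inner_toL2 {g : ℝ} (hg : -1 < g) (p r : MvPolynomial (Fin 2) ℝ) :
    inner ℝ (toL2 hg p) (toL2 hg r) = triInt g (p * r) := by
  rw [L2.inner_def, triInt]
  refine integral_congr_ae ?_
  filter_upwards [coeFn_toL2 hg p, coeFn_toL2 hg r] with q h1 h2
  simp [h1, h2, mul_comm]

theorem norm_toL2_sq {g : ℝ} (hg : -1 < g) (p : MvPolynomial (Fin 2) ℝ) :
    ‖toL2 hg p‖ ^ 2 = triInt g (p * p) := by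
  rw [← inner_toL2 hg, real_inner_self_eq_norm_sq]

theorem abs_triInt_mul_le {g : ℝ} (hg : -1 < g) (p r : MvPolynomial (Fin 2) ℝ) :
    |triInt g (p * r)| ≤ ‖toL2 hg p‖ * ‖toL2 hg r‖ := by
  rw [← inner_toL2 hg]
  exact abs_real_inner_le_norm _ _

theorem norm_toL2_le_of_sq_le {g : ℝ} (hg : -1 < g) {p r : MvPolynomial (Fin 2) ℝ} {c : ℝ}
    (hc : 0 ≤ c) (h : ∀ q ∈ openTriangle, ev p q ^ 2 ≤ ev r q) (hr : triInt g r ≤ c ^ 2) :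
    ‖toL2 hg p‖ ≤ c := by
  refine (sq_le_sq₀ (norm_nonneg _) hc).mp ?_
  rw [norm_toL2_sq]
  refine (triInt_mono hg fun q hq => ?_).trans hr
  rw [ev_mul, ← sq]
  exact h q hq

theorem norm_toL2_mul_le {g : ℝ} (hg : -1 < g) {p r : MvPolynomial (Fin 2) ℝ}
    (h : ∀ q ∈ openTriangle, |ev r q| ≤ 1) : ‖toL2 hg (r * p)‖ ≤ ‖toL2 hg p‖ := by
  refine norm_toL2_le_of_sq_le hg (r := p * p) (norm_nonneg _) (fun q hq => ?_)
    (norm_toL2_sq hg p).ge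
  rw [ev_mul, ev_mul, mul_pow, ← sq]
  exact mul_le_of_le_one_left (sq_nonneg _) ((sq_le_one_iff_abs_le_one _).mpr (h q hq))

/-- A factor z inside the norm raises the exponent of the weight by 2; this is where γ + 2 comes
from. -/
theorem norm_toL2_pz_mul {g : ℝ} (hg : -1 < g) (hg' : -1 < g + 2) (p : MvPolynomial (Fin 2) ℝ) :
    ‖toL2 hg (pz * p)‖ = ‖toL2 hg' p‖ := by
  refine (sq_eq_sq₀ (norm_nonneg _) (norm_nonneg _)).mp ?_
  rw [norm_toL2_sq, norm_toL2_sq]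
  have e : pz * p * (pz * p) = pz * (pz * (p * p)) := by ring
  rw [e, triInt_eq_sub_of_add, triInt_eq_sub_of_add, add_assoc]
  norm_num

/-! ### The inequality for eigenfunctions of `sobOp` -/

/-- Absorption: if a exceeded (c + 1)t, then a² > c·at + at ≥ c(at + t²) for t > 0, while for t = 0
the hypothesis forces a = 0. -/
theorem le_mul_of_sq_le {a c t : ℝ} (ha : 0 ≤ a) (ht : 0 ≤ t) (hc : 0 ≤ c)
    (h : a ^ 2 ≤ c * (t ^ 2 + a * t)) : a ≤ (c + 1) * t := by
  by_contra! hlt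
  nlinarith [mul_le_mul_of_nonneg_left hlt.le ha, mul_nonneg ha ht, mul_nonneg hc ht,
    mul_le_mul_of_nonneg_left hlt.le ht, mul_nonneg (mul_nonneg hc ht) ht,
    mul_nonneg (mul_nonneg hc hc) (mul_nonneg ht ht), sq_nonneg (a - (c + 1) * t)]

theorem ev_mem_Ioo {q : ℝ × ℝ} (hq : q ∈ openTriangle) : 0 < ev px q ∧ 0 < ev py q ∧ 0 < ev pz q ∧
    ev px q < 1 ∧ ev py q < 1 ∧ ev pz q < 1 := by
  obtain ⟨h1, h2, h3⟩ := hq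
  simp only [ev_px, ev_py, ev_sub, ev_one]
  refine ⟨?_, ?_, ?_, ?_, ?_, ?_⟩ <;> linarith

theorem triInt_mul_self_nonneg {g : ℝ} (hg : -1 < g) {p : MvPolynomial (Fin 2) ℝ}
    (hp : ∀ q ∈ openTriangle, 0 ≤ ev p q) (r : MvPolynomial (Fin 2) ℝ) :
    0 ≤ triInt g (p * (r * r)) := by
  rw [← triInt_zero g]
  refine triInt_mono hg fun q hq => ?_
  rw [ev_zero, ev_mul, ev_mul]
  exact mul_nonneg (hp q hq) (mul_self_nonneg _)

/-- From 0 ≤ a ≤ 1 follows (av)² ≤ av². -/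
theorem norm_toL2_mul_le_of_energy {g : ℝ} (hg : -1 < g) {a v : MvPolynomial (Fin 2) ℝ} {W : ℝ}
    (hW : 0 ≤ W) (ha : ∀ q ∈ openTriangle, 0 ≤ ev a q ∧ ev a q ≤ 1)
    (h : triInt g (a * (v * v)) ≤ W ^ 2) : ‖toL2 hg (a * v)‖ ≤ W := by
  refine norm_toL2_le_of_sq_le hg (r := a * (v * v)) hW (fun q hq => ?_) h
  obtain ⟨h1, h2⟩ := ha q hq
  simp only [ev_mul]
  nlinarith [mul_nonneg (mul_nonneg h1 (sub_nonneg.mpr h2)) (sq_nonneg (ev v q))]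

/-- The three parts of the energy of an eigenfunction of `jacOp`. -/
theorem norm_le_of_jacOp_eq {g : ℝ} (hg : -1 < g) {μ : ℝ} (hμ : 0 ≤ μ)
    {v : MvPolynomial (Fin 2) ℝ} (hv : jacOp g v = MvPolynomial.C μ * v) :
    ‖toL2 hg (px * py * D₃ v)‖ ≤ √μ * ‖toL2 hg v‖ ∧
    ‖toL2 hg (px * pz * D₁ v)‖ ≤ √μ * ‖toL2 hg v‖ ∧
    ‖toL2 hg (py * pz * D₂ v)‖ ≤ √μ * ‖toL2 hg v‖ := by
  have hen := triInt_mul_jacOp hg v v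
  set W : ℝ := √μ * ‖toL2 hg v‖ with hW
  have hW0 : 0 ≤ W := by positivity
  have hW2 : W ^ 2 = triInt g (v * jacOp g v) := by
    have e : v * (MvPolynomial.C μ * v) = MvPolynomial.C μ * (v * v) := by ring
    rw [hv, e, triInt_C_mul, hW, mul_pow, Real.sq_sqrt hμ, norm_toL2_sq]
  rw [← hW2] at hen
  have b3 : ∀ q ∈ openTriangle, 0 ≤ ev (px * py) q ∧ ev (px * py) q ≤ 1 := fun q hq => by
    obtain ⟨a1, a2, a3, a4, a5, a6⟩ := ev_mem_Ioo hq
    rw [ev_mul]; exact ⟨by positivity, by nlinarith⟩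
  have b1 : ∀ q ∈ openTriangle, 0 ≤ ev (px * pz) q ∧ ev (px * pz) q ≤ 1 := fun q hq => by
    obtain ⟨a1, a2, a3, a4, a5, a6⟩ := ev_mem_Ioo hq
    rw [ev_mul]; exact ⟨by positivity, by nlinarith⟩
  have b2 : ∀ q ∈ openTriangle, 0 ≤ ev (py * pz) q ∧ ev (py * pz) q ≤ 1 := fun q hq => by
    obtain ⟨a1, a2, a3, a4, a5, a6⟩ := ev_mem_Ioo hq
    rw [ev_mul]; exact ⟨by positivity, by nlinarith⟩
  have e3 := triInt_mul_self_nonneg hg (fun q hq => (b3 q hq).1) (D₃ v)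
  have e1 := triInt_mul_self_nonneg hg (fun q hq => (b1 q hq).1) (D₁ v)
  have e2 := triInt_mul_self_nonneg hg (fun q hq => (b2 q hq).1) (D₂ v)
  exact ⟨norm_toL2_mul_le_of_energy hg hW0 b3 (by linarith),
    norm_toL2_mul_le_of_energy hg hW0 b1 (by linarith),
    norm_toL2_mul_le_of_energy hg hW0 b2 (by linarith)⟩

theorem norm_toL2_px_mul_le {g : ℝ} (hg : -1 < g) (p : MvPolynomial (Fin 2) ℝ) :
    ‖toL2 hg (px * p)‖ ≤ ‖toL2 hg p‖ :=
  norm_toL2_mul_le hg fun q hq => by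
    obtain ⟨a1, a2, a3, a4, a5, a6⟩ := ev_mem_Ioo hq; rw [abs_of_pos a1]; exact a4.le

theorem norm_toL2_py_mul_le {g : ℝ} (hg : -1 < g) (p : MvPolynomial (Fin 2) ℝ) :
    ‖toL2 hg (py * p)‖ ≤ ‖toL2 hg p‖ :=
  norm_toL2_mul_le hg fun q hq => by
    obtain ⟨a1, a2, a3, a4, a5, a6⟩ := ev_mem_Ioo hq; rw [abs_of_pos a2]; exact a5.le

theorem norm_toL2_pz_mul_le {g : ℝ} (hg : -1 < g) (p : MvPolynomial (Fin 2) ℝ) :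
    ‖toL2 hg (pz * p)‖ ≤ ‖toL2 hg p‖ :=
  norm_toL2_mul_le hg fun q hq => by
    obtain ⟨a1, a2, a3, a4, a5, a6⟩ := ev_mem_Ioo hq; rw [abs_of_pos a3]; exact a6.le

theorem norm_toL2_add_mul_le {g : ℝ} (hg : -1 < g) (p : MvPolynomial (Fin 2) ℝ) :
    ‖toL2 hg ((px + py) * p)‖ ≤ ‖toL2 hg p‖ :=
  norm_toL2_mul_le hg fun q hq => by
    obtain ⟨a1, a2, a3⟩ := hq
    rw [ev_add, ev_px, ev_py, abs_of_pos (by linarith)]; linarith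

/-- An eigenfunction of `sobOp` satisfies first and second order equations for the Euler
derivation whose right-hand sides are controlled by its derivatives. -/
theorem exists_remainders {g : ℝ} (hg : -1 < g) {μ μ' : ℝ} (hμ' : μ' = μ - (g + 1)) (hμ0 : 0 ≤ μ')
    {Q : MvPolynomial (Fin 2) ℝ} (hQ : sobOp g Q = MvPolynomial.C μ * Q) :
    ∃ r1 r2 : MvPolynomial (Fin 2) ℝ,
      ‖toL2 hg r1‖ ≤ ‖toL2 hg (pz * D₁ (D₂ Q))‖ + 3 * (√μ' * ‖toL2 hg (D₃ Q)‖) ∧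
      ‖toL2 hg (pz * r2)‖ ≤ ‖toL2 hg (pz * D₁ (D₂ Q))‖ + 3 * (√μ' * ‖toL2 hg (D₃ Q)‖) ∧
      MvPolynomial.C μ * Q = MvPolynomial.C (g + 1) * eul Q + r1 ∧
      eul (eul Q) = eul Q + r2 ∧
      MvPolynomial.C μ' * eul Q = MvPolynomial.C (g + 1) * r2 + eul r1 := by
  -- The eigenvalue equation differentiated by ∂₃.
  have hjac : jacOp g (D₃ Q) = MvPolynomial.C μ' * D₃ Q := by
    have := congrArg D₃ hQ
    rw [D₃_sobOp, Derivation.leibniz, derivation_C, smul_zero, add_zero, smul_eq_mul] at this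
    rw [hμ', map_sub]
    linear_combination this
  obtain ⟨n3, n1, n2⟩ := norm_le_of_jacOp_eq hg hμ0 hjac
  set v := D₃ Q with hv
  set h := D₁ (D₂ Q) with hh
  set W : ℝ := √μ' * ‖toL2 hg v‖ with hW
  have hW0 : 0 ≤ W := by positivity
  have hQ1 : MvPolynomial.C μ * Q = MvPolynomial.C (g + 1) * eul Q +
      (-((px + py) * (pz * h)) - py * pz * D₂ v + px * pz * D₁ v - px * py * D₃ v) := by
    rw [← hQ, sobOp_eq]; ring
  have hQ2 : eul (eul Q) = eul Q + ((px + py) ^ 2 * h + (py ^ 2 * D₂ v - px ^ 2 * D₁ v)) := by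
    rw [eul_eul_eq]; ring
  refine ⟨_, _, ?_, ?_, hQ1, hQ2, ?_⟩
  · rw [map_sub, map_add, map_sub, map_neg]
    refine (norm_sub_le _ _).trans ?_
    refine (add_le_add_left (norm_add_le _ _) _).trans ?_
    have h1 := norm_sub_le (-toL2 hg ((px + py) * (pz * h))) (toL2 hg (py * pz * D₂ v))
    rw [norm_neg] at h1
    have h2 := norm_toL2_add_mul_le hg (pz * h)
    linarith
  -- The factor z is distributed so that each summand is one of the already bounded quantities times
  -- x, y or powers of x + y, all at most 1.
  · have e : pz * ((px + py) ^ 2 * h + (py ^ 2 * D₂ v - px ^ 2 * D₁ v)) =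
        (px + py) * ((px + py) * (pz * h)) + py * (py * pz * D₂ v) - px * (px * pz * D₁ v) := by
      ring
    rw [e, map_sub, map_add]
    refine (norm_sub_le _ _).trans ?_
    have h1 := norm_add_le (toL2 hg ((px + py) * ((px + py) * (pz * h))))
      (toL2 hg (py * (py * pz * D₂ v)))
    have h2 := (norm_toL2_add_mul_le hg ((px + py) * (pz * h))).trans (norm_toL2_add_mul_le hg _)
    have h3 := norm_toL2_py_mul_le hg (py * pz * D₂ v)
    have h4 := norm_toL2_px_mul_le hg (px * pz * D₁ v)
    linarith
  -- The Euler derivation of the first equation, with E²Q replaced by means of the second; moving (g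
  -- + 1)EQ to the left turns μ into μ'.
  · have h1 := congrArg eul hQ1
    rw [Derivation.leibniz, derivation_C, smul_zero, add_zero, smul_eq_mul, map_add,
      Derivation.leibniz, derivation_C, smul_zero, add_zero, smul_eq_mul] at h1
    rw [hμ', map_sub]
    linear_combination h1 + MvPolynomial.C (g + 1) * hQ2

/-- `triInt_ibp_eul` for F = e²: the full norm of e is controlled by quantities carrying a factor z,
which is a Hardy inequality. -/
theorem norm_eul_sq_le {g : ℝ} (hg : -1 < g) (e : MvPolynomial (Fin 2) ℝ) :
    (g + 1) * ‖toL2 hg e‖ ^ 2 ≤ (g + 3) * triInt g (pz * (e * e)) +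
      2 * (‖toL2 hg e‖ * ‖toL2 hg (pz * eul e)‖) := by
  have h1 := triInt_ibp_eul hg (e * e)
  have h2 : ‖toL2 hg e‖ ^ 2 = triInt g ((px + py) * (e * e)) + triInt g (pz * (e * e)) := by
    rw [norm_toL2_sq, ← triInt_add hg]
    congr 1; ring
  have h3 : pz * (2 * (e * e) + eul (e * e)) =
      MvPolynomial.C 2 * (pz * (e * e)) + MvPolynomial.C 2 * (e * (pz * eul e)) := by
    rw [Derivation.leibniz, smul_eq_mul, map_ofNat]; ring
  rw [h3, triInt_add hg, triInt_C_mul, triInt_C_mul] at h1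
  have h4 := (abs_le.mp (abs_triInt_mul_le hg e (pz * eul e))).2
  rw [h2, mul_add, h1]
  linarith

/-- The equation is paired with ze. No bound on E r1 is available, so `triInt_ibp_eul` with F = r1·e
moves the Euler derivation onto e. -/
theorem mul_triInt_eul_le {g : ℝ} (hg : -1 < g) {μ' K : ℝ} {e r1 r2 : MvPolynomial (Fin 2) ℝ}
    (hK0 : 0 ≤ K) (hr1K : ‖toL2 hg r1‖ ≤ K) (hr2K : ‖toL2 hg (pz * r2)‖ ≤ K)
    (hQ3 : MvPolynomial.C μ' * e = MvPolynomial.C (g + 1) * r2 + eul r1) :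
    μ' * triInt g (pz * (e * e)) ≤
      (2 * g + 4) * (K * ‖toL2 hg e‖) + K * ‖toL2 hg (pz * eul e)‖ := by
  have hG : 0 < g + 1 := by linarith
  have hA0 : 0 ≤ ‖toL2 hg e‖ := norm_nonneg _
  have h1 := triInt_ibp_eul hg (r1 * e)
  have h3 : pz * (2 * (r1 * e) + eul (r1 * e)) =
      MvPolynomial.C 2 * (r1 * (pz * e)) + pz * (e * eul r1) + r1 * (pz * eul e) := by
    rw [Derivation.leibniz, smul_eq_mul, smul_eq_mul, map_ofNat]; ring
  have h2 : (px + py) * (r1 * e) = r1 * ((px + py) * e) := by ring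
  rw [h3, triInt_add hg, triInt_add hg, triInt_C_mul, h2] at h1
  have h4 : μ' * triInt g (pz * (e * e)) = (g + 1) * triInt g (pz * r2 * e) + triInt g (pz * (e * eul r1)) := by
    rw [← triInt_C_mul, ← triInt_C_mul, ← triInt_add hg]
    congr 1
    linear_combination pz * e * hQ3
  have h5 := (abs_le.mp (abs_triInt_mul_le hg (pz * r2) e)).2
  have h6 := (abs_le.mp (abs_triInt_mul_le hg r1 ((px + py) * e))).2
  have h7 := (abs_le.mp (abs_triInt_mul_le hg r1 (pz * e))).1
  have h8 := (abs_le.mp (abs_triInt_mul_le hg r1 (pz * eul e))).1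
  have k5 : ‖toL2 hg (pz * r2)‖ * ‖toL2 hg e‖ ≤ K * ‖toL2 hg e‖ :=
    mul_le_mul hr2K le_rfl hA0 hK0
  have k6 : ‖toL2 hg r1‖ * ‖toL2 hg ((px + py) * e)‖ ≤ K * ‖toL2 hg e‖ :=
    mul_le_mul hr1K (norm_toL2_add_mul_le hg e) (norm_nonneg _) hK0
  have k7 : ‖toL2 hg r1‖ * ‖toL2 hg (pz * e)‖ ≤ K * ‖toL2 hg e‖ :=
    mul_le_mul hr1K (norm_toL2_pz_mul_le hg e) (norm_nonneg _) hK0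
  have k8 : ‖toL2 hg r1‖ * ‖toL2 hg (pz * eul e)‖ ≤ K * ‖toL2 hg (pz * eul e)‖ :=
    mul_le_mul hr1K le_rfl (norm_nonneg _) hK0
  have t5 := mul_le_mul_of_nonneg_left (h5.trans k5) hG.le
  have t6 := mul_le_mul_of_nonneg_left (h6.trans k6) hG.le
  linarith

/-- The estimate for the Euler derivation from the equations of `exists_remainders`. -/
theorem norm_eul_le {g : ℝ} (hg : -1 < g) :
    ∃ C : ℝ, 0 < C ∧ ∀ (μ' K : ℝ) (e r1 r2 : MvPolynomial (Fin 2) ℝ), 1 ≤ μ' → 0 ≤ K →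
      ‖toL2 hg r1‖ ≤ K → ‖toL2 hg (pz * r2)‖ ≤ K → eul e = e + r2 →
      MvPolynomial.C μ' * e = MvPolynomial.C (g + 1) * r2 + eul r1 → ‖toL2 hg e‖ ≤ C * K := by
  have hG : 0 < g + 1 := by linarith
  -- `c0` = (g + 3)/(g + 1) is the ratio of the constants in `norm_eul_sq_le`; `c1` collects those
  -- of `mul_triInt_eul_le` once A ≤ (c0 + 1)(b + K) is inserted.
  set c0 : ℝ := 1 + 2 / (g + 1) with hc0
  have hc0p : 0 < c0 := by positivity
  set c1 : ℝ := (2 * g + 4) * (c0 + 1) + 1 with hc1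
  have hc1p : 0 < c1 := by
    have : 0 < 2 * g + 4 := by linarith
    positivity
  refine ⟨(c0 + 1) * (c1 + 2), by positivity, ?_⟩
  intro μ' K e r1 r2 hμ1 hK0 hr1K hr2K hQ2 hQ3
  set A := ‖toL2 hg e‖ with hA
  have hA0 : 0 ≤ A := norm_nonneg _
  set M := ‖toL2 hg (pz * eul e)‖ with hM
  have hM0 : 0 ≤ M := norm_nonneg _
  have hb0 := triInt_mul_self_nonneg hg (fun q hq => (ev_mem_Ioo hq).2.2.1.le) e
  set b := √(triInt g (pz * (e * e))) with hb
  have hbn : 0 ≤ b := Real.sqrt_nonneg _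
  have hb2 : b ^ 2 = triInt g (pz * (e * e)) := Real.sq_sqrt hb0
  -- From Ee = e + r2, where ‖z r2‖ ≤ K and ‖ze‖² is at most the integral of ze².
  have hMb : M ≤ K + b := by
    have h1 : ‖toL2 hg (pz * e)‖ ≤ b := by
      refine norm_toL2_le_of_sq_le hg (r := pz * (e * e)) hbn (fun q hq => ?_) hb2.ge
      obtain ⟨a1, a2, a3, a4, a5, a6⟩ := ev_mem_Ioo hq
      simp only [ev_mul]
      nlinarith [mul_nonneg (mul_nonneg a3.le (sub_nonneg.mpr a6.le)) (sq_nonneg (ev e q))]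
    rw [hM, hQ2, mul_add, map_add]
    exact (norm_add_le _ _).trans (by linarith)
  have hAeq := norm_eul_sq_le hg e
  rw [← hb2] at hAeq
  have hbeq := mul_triInt_eul_le hg hK0 hr1K hr2K hQ3
  rw [← hb2] at hbeq
  have hAT : A ≤ (c0 + 1) * (b + K) := by
    refine le_mul_of_sq_le hA0 (by positivity) hc0p.le ?_
    have h1 : c0 * (g + 1) = g + 3 := by rw [hc0]; field_simp; ring
    refine le_of_mul_le_mul_left ?_ hG
    have h2 : (g + 1) * (c0 * ((b + K) ^ 2 + A * (b + K))) =
      (g + 3) * ((b + K) ^ 2 + A * (b + K)) := by rw [← h1]; ring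
    rw [h2]
    have h3 := mul_le_mul_of_nonneg_left hMb hA0
    have h4 : 0 ≤ A * (b + K) := by positivity
    have h5 : b ^ 2 ≤ (b + K) ^ 2 := by nlinarith
    have h6 := mul_le_mul_of_nonneg_left h5 (by linarith : 0 ≤ g + 3)
    have h7 := mul_nonneg hG.le h4
    nlinarith
  -- Only μ' ≥ 1 is needed: the right-hand side is K times quantities of size b + K, so b is
  -- absorbed.
  have hbK : b ≤ (c1 + 1) * K := by
    refine le_mul_of_sq_le hbn hK0 hc1p.le ?_
    have h1 : b ^ 2 ≤ μ' * b ^ 2 := le_mul_of_one_le_left (sq_nonneg _) hμ1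
    have h2 := mul_le_mul_of_nonneg_left hAT hK0
    have h3 := mul_le_mul_of_nonneg_left hMb hK0
    have h4 := mul_le_mul_of_nonneg_left h2 (by linarith : 0 ≤ 2 * g + 4)
    have h5 : c1 * (K ^ 2 + b * K) =
      (2 * g + 4) * (K * ((c0 + 1) * (b + K))) + K * (K + b) := by rw [hc1]; ring
    linarith
  have : (c0 + 1) * (b + K) ≤ (c0 + 1) * ((c1 + 1) * K + K) :=
    mul_le_mul_of_nonneg_left (by linarith) (by positivity)
  linarith

/-- μQ = (g + 1)EQ + r1, and both terms on the right are at most a constant times the controlled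
quantity K. -/
theorem norm_le_of_sobOp_eq {g : ℝ} (hg : -1 < g) :
    ∃ C : ℝ, 0 < C ∧ ∀ μ μ' : ℝ, μ' = μ - (g + 1) → 1 ≤ μ' →
      ∀ Q : MvPolynomial (Fin 2) ℝ, sobOp g Q = MvPolynomial.C μ * Q →
        μ * ‖toL2 hg Q‖ ≤
          C * (‖toL2 hg (pz * D₁ (D₂ Q))‖ + 3 * (√μ' * ‖toL2 hg (D₃ Q)‖)) := by
  have hG : 0 < g + 1 := by linarith
  obtain ⟨C, hC, hCle⟩ := norm_eul_le hg
  refine ⟨1 + (g + 1) * C, by positivity, ?_⟩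
  intro μ μ' hμ' hμ1 Q hQ
  obtain ⟨r1, r2, hr1, hr2, hQ1, hQ2, hQ3⟩ := exists_remainders hg hμ' (by linarith) hQ
  set K := ‖toL2 hg (pz * D₁ (D₂ Q))‖ + 3 * (√μ' * ‖toL2 hg (D₃ Q)‖) with hK
  have hAK := hCle μ' K (eul Q) r1 r2 hμ1 (by positivity) hr1 hr2 hQ2 hQ3
  have h1 : ‖toL2 hg (MvPolynomial.C μ * Q)‖ = μ * ‖toL2 hg Q‖ := by
    rw [← MvPolynomial.smul_eq_C_mul, map_smul, norm_smul, Real.norm_eq_abs,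
      abs_of_nonneg (by linarith)]
  rw [← h1, hQ1, map_add, ← MvPolynomial.smul_eq_C_mul, map_smul]
  refine (norm_add_le _ _).trans ?_
  rw [norm_smul, Real.norm_eq_abs, abs_of_pos hG]
  have := mul_le_mul_of_nonneg_left hAK hG.le
  linarith

/-- The inequality between the norms of a Sobolev orthogonal polynomial of degree `m` and of its
derivatives. -/
theorem norm_le_of_degree {g : ℝ} (hg : -1 < g) (hg' : -1 < g + 2) :
    ∃ C : ℝ, 0 < C ∧ ∀ m : ℕ, 2 ≤ m → ∀ Q : MvPolynomial (Fin 2) ℝ,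
      sobOp g Q = MvPolynomial.C ((m : ℝ) * (m + g)) * Q →
        ‖toL2 hg Q‖ ≤ C * (‖toL2 hg (D₃ Q)‖ / m + ‖toL2 hg' (D₁ (D₂ Q))‖ / m ^ 2) := by
  obtain ⟨C, hC, h⟩ := norm_le_of_sobOp_eq hg
  refine ⟨6 * C * (1 + |g|), by positivity, ?_⟩
  intro m hm Q hQ
  have hm2 : (2 : ℝ) ≤ m := by exact_mod_cast hm
  -- Here μ' = (m - 1)(m + g + 1), which is at least 1 because m ≥ 2 and g > -1.
  have := h (m * (m + g)) _ rfl (by nlinarith) Q hQ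
  rw [norm_toL2_pz_mul hg hg'] at this
  have hs : √((m : ℝ) * (m + g) - (g + 1)) ≤ m * (1 + |g|) := by
    refine Real.sqrt_le_iff.mpr ⟨by positivity, ?_⟩
    have h1 := le_abs_self g
    have h2 := abs_nonneg g
    nlinarith [mul_le_mul_of_nonneg_left h1 (by linarith : (0 : ℝ) ≤ m),
      mul_nonneg (mul_nonneg h2 h2) (sq_nonneg (m : ℝ)), mul_nonneg h2 (sq_nonneg (m : ℝ))]
  set V := ‖toL2 hg (D₃ Q)‖
  set H := ‖toL2 hg' (D₁ (D₂ Q))‖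
  have hV : 0 ≤ V := norm_nonneg _
  have hH : 0 ≤ H := norm_nonneg _
  -- m + g ≥ m/2, because g > -1 ≥ -m/2.
  have h1 : (m : ℝ) ^ 2 / 2 * ‖toL2 hg Q‖ ≤ m * (m + g) * ‖toL2 hg Q‖ :=
    mul_le_mul_of_nonneg_right (by nlinarith) (norm_nonneg _)
  have h2 : √((m : ℝ) * (m + g) - (g + 1)) * V ≤ m * (1 + |g|) * V :=
    mul_le_mul_of_nonneg_right hs hV
  have h3 : H ≤ (1 + |g|) * H := le_mul_of_one_le_left hH (by linarith [abs_nonneg g])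
  have h4 : C * (H + 3 * (√((m : ℝ) * (m + g) - (g + 1)) * V)) ≤
      C * (3 * ((1 + |g|) * H) + 3 * (m * (1 + |g|) * V)) :=
    mul_le_mul_of_nonneg_left (by nlinarith) hC.le
  have h5 : ‖toL2 hg Q‖ * (m : ℝ) ^ 2 ≤ 6 * C * (1 + |g|) * (V * m + H) := by nlinarith
  have hm0 : (0 : ℝ) < m := by linarith
  have e : 6 * C * (1 + |g|) * (V / m + H / (m : ℝ) ^ 2) =
      6 * C * (1 + |g|) * (V * m + H) / (m : ℝ) ^ 2 := by field_simp
  rw [e, le_div_iff₀ (by positivity)]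
  exact h5

/-! ### Degrees -/

theorem totalDegree_pderiv_le (i : Fin 2) (p : MvPolynomial (Fin 2) ℝ) :
    (MvPolynomial.pderiv i p).totalDegree ≤ p.totalDegree - 1 := by
  classical
  rw [MvPolynomial.as_sum p, map_sum, ← MvPolynomial.as_sum p]
  refine MvPolynomial.totalDegree_finsetSum_le fun s hs => ?_
  rw [MvPolynomial.pderiv_monomial]
  by_cases h : s i = 0
  · simp [h]
  · refine (MvPolynomial.totalDegree_monomial_le _ _).trans ?_
    have h1 := MvPolynomial.le_totalDegree hs
    have h2 : s - Finsupp.single i 1 + Finsupp.single i 1 = s :=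
      tsub_add_cancel_of_le (by simpa using Nat.one_le_iff_ne_zero.mpr h)
    have h3 : (s.sum fun _ e => e) = ((s - Finsupp.single i 1).sum fun _ e => e) + 1 := by
      conv_lhs => rw [← h2]
      rw [Finsupp.sum_add_index' (by simp) (by simp), Finsupp.sum_single_index rfl]
    have h4 : ((s - Finsupp.single i 1).sum fun _ => id) =
      ((s - Finsupp.single i 1).sum fun _ e => e) := rfl
    omega

theorem totalDegree_D₁_le {n : ℕ} {p : MvPolynomial (Fin 2) ℝ} (h : p.totalDegree ≤ n) :
    (D₁ p).totalDegree ≤ n - 1 :=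
  (totalDegree_pderiv_le 0 p).trans (by omega)

theorem totalDegree_D₂_le {n : ℕ} {p : MvPolynomial (Fin 2) ℝ} (h : p.totalDegree ≤ n) :
    (D₂ p).totalDegree ≤ n - 1 :=
  (totalDegree_pderiv_le 1 p).trans (by omega)

theorem totalDegree_sub_le {n : ℕ} {p q : MvPolynomial (Fin 2) ℝ} (hp : p.totalDegree ≤ n)
    (hq : q.totalDegree ≤ n) : (p - q).totalDegree ≤ n :=
  (MvPolynomial.totalDegree_sub _ _).trans (max_le hp hq)

theorem totalDegree_add_le {n : ℕ} {p q : MvPolynomial (Fin 2) ℝ} (hp : p.totalDegree ≤ n)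
    (hq : q.totalDegree ≤ n) : (p + q).totalDegree ≤ n :=
  (MvPolynomial.totalDegree_add _ _).trans (max_le hp hq)

theorem totalDegree_C_mul_le {n : ℕ} (a : ℝ) {p : MvPolynomial (Fin 2) ℝ}
    (hp : p.totalDegree ≤ n) : (MvPolynomial.C a * p).totalDegree ≤ n :=
  (MvPolynomial.totalDegree_mul _ _).trans (by rw [MvPolynomial.totalDegree_C, zero_add]; exact hp)

theorem totalDegree_mul_le {n m k : ℕ} (h : n + m ≤ k) {p q : MvPolynomial (Fin 2) ℝ}
    (hp : p.totalDegree ≤ n) (hq : q.totalDegree ≤ m) : (p * q).totalDegree ≤ k :=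
  (MvPolynomial.totalDegree_mul _ _).trans (by omega)

theorem totalDegree_pz_le : (pz : MvPolynomial (Fin 2) ℝ).totalDegree ≤ 1 :=
  totalDegree_sub_le (totalDegree_sub_le (by simp) (by simp)) (by simp)

theorem totalDegree_D₃_le {n : ℕ} {p : MvPolynomial (Fin 2) ℝ} (h : p.totalDegree ≤ n) :
    (D₃ p).totalDegree ≤ n - 1 :=
  totalDegree_sub_le (totalDegree_D₂_le h) (totalDegree_D₁_le h)

/-! ### Integration over the edge -/

theorem intervalIntegrable_ev_edge {r : ℝ} (hr : -1 < r) (p : MvPolynomial (Fin 2) ℝ) :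
    IntervalIntegrable (fun t => ev p (0, t) * (1 - t) ^ r) volume 0 1 :=
  (intervalIntegrable_one_sub_rpow hr).continuousOn_mul
    ((continuous_ev p).comp (by fun_prop : Continuous fun t : ℝ => ((0 : ℝ), t))).continuousOn

theorem edgeInt_add {g : ℝ} (hg : -1 < g) (p r : MvPolynomial (Fin 2) ℝ) :
    edgeInt g (p + r) = edgeInt g p + edgeInt g r := by
  rw [edgeInt, edgeInt, edgeInt, ← intervalIntegral.integral_add
    (intervalIntegrable_ev_edge (by linarith) p) (intervalIntegrable_ev_edge (by linarith) r)]
  simp only [ev_add, add_mul]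

theorem edgeInt_C_mul (g a : ℝ) (p : MvPolynomial (Fin 2) ℝ) :
    edgeInt g (MvPolynomial.C a * p) = a * edgeInt g p := by
  rw [edgeInt, edgeInt, ← intervalIntegral.integral_const_mul]
  simp only [ev_mul, ev_C, mul_assoc]

theorem edgeInt_congr (g : ℝ) {p r : MvPolynomial (Fin 2) ℝ} (h : ∀ t, ev p (0, t) = ev r (0, t)) :
    edgeInt g p = edgeInt g r := by
  simp only [edgeInt, h]

theorem edgeInt_zero (g : ℝ) : edgeInt g 0 = 0 := by simp [edgeInt]

theorem edgeInt_neg (g : ℝ) (p : MvPolynomial (Fin 2) ℝ) : edgeInt g (-p) = -edgeInt g p := by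
  rw [edgeInt, edgeInt, ← intervalIntegral.integral_neg]
  simp only [ev_neg, neg_mul]

/-- The weighted integrand is the derivative of tF(0, t)(1 - t)^(g+2), which vanishes at 0 and at 1.
-/
theorem edgeInt_ibp {g : ℝ} (hg : -1 < g) (F : MvPolynomial (Fin 2) ℝ) :
    edgeInt g (pz * (F + py * D₂ F) - MvPolynomial.C (g + 2) * (py * F)) = 0 := by
  have hd : ∀ t ∈ Set.Ioo (0 : ℝ) 1,
      HasDerivAt (fun t => ev (py * F) (0, t) * (1 - t) ^ (g + 2))
        (ev (pz * (F + py * D₂ F) - MvPolynomial.C (g + 2) * (py * F)) (0, t) *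
          (1 - t) ^ (g + 1)) t := by
    intro t ht
    have hz : 0 < 1 - t := by linarith [ht.2]
    have a1 := hasDerivAt_ev_comp (py * F) (hasDerivAt_const t (0 : ℝ)) (hasDerivAt_id t)
    have a2 := ((hasDerivAt_const t (1 : ℝ)).sub (hasDerivAt_id t)).rpow_const
      (p := g + 2) (Or.inl hz.ne')
    refine (a1.mul a2).congr_deriv ?_
    have e1 : g + 2 - 1 = g + 1 := by ring
    have e2 : g + 2 = g + 1 + 1 := by ring
    simp only [id, Derivation.leibniz, D₂_py, smul_eq_mul, ev_sub, ev_mul, ev_add, ev_one, ev_px,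
      ev_py, ev_C, Pi.sub_apply, e1]
    rw [e2, Real.rpow_add_one hz.ne']
    ring
  rw [edgeInt, intervalIntegral.integral_eq_sub_of_hasDerivAt_of_le zero_le_one ?_ hd
    (intervalIntegrable_ev_edge (by linarith) _)]
  · rw [ev_mul, ev_mul, sub_self, Real.zero_rpow (by linarith)]
    simp
  · refine ContinuousOn.mul ((continuous_ev _).comp
      (by fun_prop : Continuous fun t : ℝ => ((0 : ℝ), t))).continuousOn ?_
    exact ContinuousOn.rpow_const (by fun_prop) fun x hx => Or.inr (by linarith)

/-- On x = 0 the operator involves derivatives in y alone, and `edgeInt_ibp` puts the result in a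
form symmetric in p and q. -/
theorem edgeInt_D₂_sobOp {g : ℝ} (hg : -1 < g) (p q : MvPolynomial (Fin 2) ℝ) :
    edgeInt g (D₂ (sobOp g p) * D₂ q) =
      edgeInt g (py * pz * (D₂ (D₂ p) * D₂ (D₂ q))) + (g + 1) * edgeInt g (D₂ p * D₂ q) := by
  have h1 := edgeInt_ibp hg (D₂ q * D₂ (D₂ p))
  rw [← edgeInt_C_mul, ← edgeInt_add hg, ← sub_eq_zero, sub_eq_add_neg, ← edgeInt_neg,
    ← edgeInt_add hg, ← neg_eq_zero, ← edgeInt_neg, ← h1]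
  refine edgeInt_congr g fun t => ?_
  simp only [sobOp, eul_apply, map_add, map_sub, Derivation.leibniz, smul_eq_mul, ev_add, ev_sub,
    ev_mul, ev_neg, ev_C, D₂_D₁, D₂_px, D₂_py, D₁_px, D₁_py, D₂_C, ev_px, ev_py, ev_one, ev_zero,
    map_zero, Derivation.map_one_eq_zero]
  ring

/-! ### The Sobolev form on polynomials -/

/-- The Sobolev inner product of two polynomials. -/
def sobForm (l l₀ g : ℝ) (p q : MvPolynomial (Fin 2) ℝ) : ℝ :=
  triInt g (D₃ p * D₃ q) + l * (edgeInt g (D₂ p * D₂ q) + l₀ * (ev p (0, 0) * ev q (0, 0)))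

theorem sobForm_comm (l l₀ g : ℝ) (p q : MvPolynomial (Fin 2) ℝ) :
    sobForm l l₀ g p q = sobForm l l₀ g q p := by
  simp only [sobForm, mul_comm]

theorem sobForm_add_left {g : ℝ} (hg : -1 < g) (l l₀ : ℝ) (p p' q : MvPolynomial (Fin 2) ℝ) :
    sobForm l l₀ g (p + p') q = sobForm l l₀ g p q + sobForm l l₀ g p' q := by
  simp only [sobForm, map_add, add_mul, triInt_add hg, edgeInt_add hg, ev_add]
  ring

theorem sobForm_smul_left (l l₀ g a : ℝ) (p q : MvPolynomial (Fin 2) ℝ) :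
    sobForm l l₀ g (a • p) q = a * sobForm l l₀ g p q := by
  rw [sobForm, Derivation.map_smul, Derivation.map_smul, smul_mul_assoc, smul_mul_assoc,
    MvPolynomial.smul_eq_C_mul, MvPolynomial.smul_eq_C_mul, MvPolynomial.smul_eq_C_mul,
    triInt_C_mul, edgeInt_C_mul, ev_mul, ev_C, sobForm]
  ring

/-- The Sobolev inner product of polynomials as a bilinear form. -/
def sobBilin {g : ℝ} (hg : -1 < g) (l l₀ : ℝ) : LinearMap.BilinForm ℝ (MvPolynomial (Fin 2) ℝ) :=
  LinearMap.mk₂ ℝ (sobForm l l₀ g) (sobForm_add_left hg l l₀)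
    (fun a p q => sobForm_smul_left l l₀ g a p q)
    (fun p q r => by
      rw [sobForm_comm, sobForm_add_left hg, sobForm_comm, sobForm_comm _ _ _ r])
    (fun a p q => by rw [sobForm_comm, sobForm_smul_left, sobForm_comm, smul_eq_mul])

theorem ev_sobOp_zero (g : ℝ) (p : MvPolynomial (Fin 2) ℝ) : ev (sobOp g p) (0, 0) = 0 := by
  simp [sobOp, eul_apply, Derivation.leibniz]

/-- Each part of the form is symmetric: the triangle part by `D₃_sobOp` and the energy form of
`jacOp`, the edge part by `edgeInt_D₂_sobOp`, and the point part is zero because `sobOp` p vanishes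
at the origin. -/
theorem sobForm_sobOp_comm {g : ℝ} (hg : -1 < g) (l l₀ : ℝ) (p q : MvPolynomial (Fin 2) ℝ) :
    sobForm l l₀ g (sobOp g p) q = sobForm l l₀ g p (sobOp g q) := by
  have key : ∀ p q, sobForm l l₀ g (sobOp g p) q =
      triInt g (D₃ q * jacOp g (D₃ p)) + (g + 1) * triInt g (D₃ p * D₃ q) +
      l * (edgeInt g (py * pz * (D₂ (D₂ p) * D₂ (D₂ q))) + (g + 1) * edgeInt g (D₂ p * D₂ q)) := by
    intro p q
    rw [sobForm, D₃_sobOp, edgeInt_D₂_sobOp hg, ev_sobOp_zero, ← triInt_C_mul, add_mul,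
      triInt_add hg, mul_comm (jacOp g (D₃ p)), mul_assoc]
    ring
  rw [key, sobForm_comm l l₀ g p, key, triInt_jacOp_comm hg (D₃ q), mul_comm (D₃ p) (D₃ q),
    mul_comm (jacOp g (D₃ q)), mul_comm (D₂ p), mul_comm (D₂ (D₂ p))]

/-- The factor xy removes the edge and point terms, and `triInt_ibp₃` makes the triangle part
symmetric. -/
theorem sobForm_angular_comm {g : ℝ} (hg : -1 < g) (l l₀ : ℝ) (p q : MvPolynomial (Fin 2) ℝ) :
    sobForm l l₀ g (px * py * D₃ (D₃ p)) q = sobForm l l₀ g p (px * py * D₃ (D₃ q)) := by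
  have key : ∀ p q, sobForm l l₀ g (px * py * D₃ (D₃ p)) q =
      -triInt g (px * py * (D₃ (D₃ p) * D₃ (D₃ q))) := by
    intro p q
    have h1 := triInt_ibp₃ hg (D₃ (D₃ p) * D₃ q)
    have h2 : edgeInt g (D₂ (px * py * D₃ (D₃ p)) * D₂ q) = 0 := by
      rw [← edgeInt_zero g]
      refine edgeInt_congr g fun t => ?_
      simp [Derivation.leibniz]
    have h3 : ev (px * py * D₃ (D₃ p)) (0, 0) = 0 := by simp
    rw [sobForm, h2, h3]
    have h4 : D₃ (px * py * (D₃ (D₃ p) * D₃ q)) = D₃ (px * py * D₃ (D₃ p)) * D₃ q +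
        px * py * (D₃ (D₃ p) * D₃ (D₃ q)) := by
      simp only [Derivation.leibniz, smul_eq_mul]; ring
    rw [h4, triInt_add hg] at h1
    linarith
  rw [key, sobForm_comm l l₀ g p, key, mul_comm (D₃ (D₃ p))]

theorem sobForm_eq_zero_of_sobOp {g : ℝ} (hg : -1 < g) (l l₀ : ℝ) {p q : MvPolynomial (Fin 2) ℝ}
    {μ ν : ℝ} (hp : sobOp g p = MvPolynomial.C μ * p) (hq : sobOp g q = MvPolynomial.C ν * q)
    (h : μ ≠ ν) : sobForm l l₀ g p q = 0 := by
  have := sobForm_sobOp_comm hg l l₀ p q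
  rw [hp, hq, sobForm_comm l l₀ g p, ← MvPolynomial.smul_eq_C_mul, ← MvPolynomial.smul_eq_C_mul,
    sobForm_smul_left, sobForm_smul_left, sobForm_comm l l₀ g q] at this
  have h2 : (μ - ν) * sobForm l l₀ g p q = 0 := by linarith
  exact (mul_eq_zero.mp h2).resolve_left (sub_ne_zero.mpr h)

theorem sobForm_eq_zero_of_angular {g : ℝ} (hg : -1 < g) (l l₀ : ℝ)
    {p q : MvPolynomial (Fin 2) ℝ} {μ ν : ℝ}
    (hp : px * py * D₃ (D₃ p) = MvPolynomial.C μ * p)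
    (hq : px * py * D₃ (D₃ q) = MvPolynomial.C ν * q)
    (h : μ ≠ ν) : sobForm l l₀ g p q = 0 := by
  have := sobForm_angular_comm hg l l₀ p q
  rw [hp, hq, sobForm_comm l l₀ g p, ← MvPolynomial.smul_eq_C_mul, ← MvPolynomial.smul_eq_C_mul,
    sobForm_smul_left, sobForm_smul_left, sobForm_comm l l₀ g q] at this
  have h2 : (μ - ν) * sobForm l l₀ g p q = 0 := by linarith
  exact (mul_eq_zero.mp h2).resolve_left (sub_ne_zero.mpr h)

theorem ev_D₂_eq_zero_of_edge {p : MvPolynomial (Fin 2) ℝ} (h : ∀ t, ev p (0, t) = 0) (t : ℝ) :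
    ev (D₂ p) (0, t) = 0 := by
  have h1 := hasDerivAt_ev_comp p (hasDerivAt_const t (0 : ℝ)) (hasDerivAt_id t)
  have h2 : (fun t => ev p (0, id t)) = fun _ => 0 := funext h
  rw [h2] at h1
  have := h1.unique (hasDerivAt_const t 0)
  simpa using this

/-- The basis polynomials are orthogonal for the Sobolev form. -/
theorem sobForm_basPoly {g : ℝ} (hg : -1 < g) (l l₀ : ℝ) {k m k' m' : ℕ} (hk : k ≤ m)
    (hk' : k' ≤ m') (h : (k, m) ≠ (k', m')) :
    sobForm l l₀ g (basPoly g k m) (basPoly g k' m') = 0 := by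
  by_cases hm : m = m'
  · subst hm
    have hkk : k ≠ k' := fun h' => h (by rw [h'])
    -- The indices 0 and 1 share the angular eigenvalue 0, so k = 0 is treated directly: ∂₃ kills
    -- that polynomial and the others vanish on the edge.
    have hz : ∀ k', 1 ≤ k' → sobForm l l₀ g (basPoly g 0 m) (basPoly g k' m) = 0 := by
      intro k' hk'
      have h1 := fun t : ℝ => eval_basPoly_edge g hk' m t
      have h2 : ev (basPoly g k' m) (0, 0) = 0 := h1 0
      have h3 : edgeInt g (D₂ (basPoly g 0 m) * D₂ (basPoly g k' m)) = 0 := by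
        rw [← edgeInt_zero g]
        refine edgeInt_congr g fun t => ?_
        rw [ev_mul, ev_D₂_eq_zero_of_edge h1, mul_zero, ev_zero]
      rw [sobForm, D₃_basPoly_zero, zero_mul, triInt_zero, h2, h3]
      ring
    rcases Nat.eq_zero_or_pos k with rfl | h0
    · exact hz k' (by omega)
    · rcases Nat.eq_zero_or_pos k' with rfl | h0'
      · rw [sobForm_comm]; exact hz k h0
      · refine sobForm_eq_zero_of_angular hg l l₀ (D₃_D₃_basPoly g k m) (D₃_D₃_basPoly g k' m) ?_
        intro heq
        have h1 : (1 : ℝ) ≤ k := by exact_mod_cast h0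
        have h2 : (1 : ℝ) ≤ k' := by exact_mod_cast h0'
        have h3 : ((k : ℝ) - k') * (k + k' - 1) = 0 := by linarith
        rcases mul_eq_zero.mp h3 with h4 | h4
        · exact hkk (by exact_mod_cast sub_eq_zero.mp h4)
        · linarith
  · refine sobForm_eq_zero_of_sobOp hg l l₀ (sobOp_basPoly hg hk) (sobOp_basPoly hg hk') ?_
    intro heq
    -- The eigenvalues m(m + g) separate the degrees, since m + m' ≥ 1 and g > -1 exclude the second
    -- factor.
    have h3 : ((m : ℝ) - m') * (m + m' + g) = 0 := by linarith
    rcases mul_eq_zero.mp h3 with h4 | h4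
    · exact hm (by exact_mod_cast sub_eq_zero.mp h4)
    · have : (1 : ℝ) ≤ m + m' := by
        have : 1 ≤ m + m' := by omega
        exact_mod_cast this
      linarith

theorem eq_zero_of_ev_openTriangle {p : MvPolynomial (Fin 2) ℝ}
    (h : ∀ q ∈ openTriangle, ev p q = 0) : p = 0 := by
  refine MvPolynomial.funext_set (fun _ => Set.Ioo (0 : ℝ) (1 / 2))
    (fun _ => Set.Ioo_infinite (by norm_num)) fun v hv => ?_
  have e : v = ![v 0, v 1] := by ext i; fin_cases i <;> rfl
  have h0 := hv 0 (Set.mem_univ _)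
  have h1 := hv 1 (Set.mem_univ _)
  rw [e, map_zero]
  exact h (v 0, v 1) ⟨h0.1, h1.1, by simp only; linarith [h0.2, h1.2]⟩

theorem eq_zero_of_triInt_mul_self {g : ℝ} (hg : -1 < g) {p : MvPolynomial (Fin 2) ℝ}
    (h : triInt g (p * p) = 0) : p = 0 := by
  have h1 : (fun q => ev (p * p) q) =ᵐ[triMeasure 0 0 g] 0 := by
    refine (integral_eq_zero_iff_of_nonneg (fun q => ?_) (integrable_ev hg (p * p))).mp h
    rw [ev_mul]; exact mul_self_nonneg _
  have h2 : ∀ᵐ q ∂volume.restrict openTriangle, ev (p * p) q = 0 :=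
    (ae_triMeasure_iff g _).mp h1
  refine eq_zero_of_ev_openTriangle fun q hq => ?_
  have h3 : Set.EqOn (ev (p * p)) (fun _ => 0) openTriangle :=
    Measure.eqOn_open_of_ae_eq h2 isOpen_openTriangle (continuous_ev _).continuousOn
      continuousOn_const
  have := h3 hq
  simpa using this

theorem edgeInt_mul_self_nonneg (g : ℝ) (p : MvPolynomial (Fin 2) ℝ) : 0 ≤ edgeInt g (p * p) := by
  refine intervalIntegral.integral_nonneg zero_le_one fun t ht => ?_
  rw [ev_mul]
  exact mul_nonneg (mul_self_nonneg _) (Real.rpow_nonneg (by linarith [ht.2]) _)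

theorem ev_edge_eq_zero_of_edgeInt {g : ℝ} (hg : -1 < g) {p : MvPolynomial (Fin 2) ℝ}
    (h : edgeInt g (p * p) = 0) {t : ℝ} (ht : t ∈ Set.Ioo (0 : ℝ) 1) : ev p (0, t) = 0 := by
  rw [edgeInt, intervalIntegral.integral_of_le zero_le_one, integral_Ioc_eq_integral_Ioo,
    setIntegral_eq_zero_iff_of_nonneg_ae] at h
  · have hc : ContinuousOn (fun t => ev (p * p) (0, t) * (1 - t) ^ (g + 1)) (Set.Ioo 0 1) := by
      refine ContinuousOn.mul ((continuous_ev _).comp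
        (by fun_prop : Continuous fun t : ℝ => ((0 : ℝ), t))).continuousOn ?_
      exact ContinuousOn.rpow_const (by fun_prop) fun x hx => Or.inr (by linarith)
    have h3 := Measure.eqOn_open_of_ae_eq h isOpen_Ioo hc continuousOn_const
    have h4 := h3 ht
    have h5 : (1 - t) ^ (g + 1) ≠ 0 := (Real.rpow_pos_of_pos (by linarith [ht.2]) _).ne'
    simpa [h5] using h4
  · refine (ae_restrict_iff' measurableSet_Ioo).mpr (Eventually.of_forall fun t ht => ?_)
    change 0 ≤ ev (p * p) (0, t) * (1 - t) ^ (g + 1)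
    rw [ev_mul]
    exact mul_nonneg (mul_self_nonneg _) (Real.rpow_nonneg (by linarith [ht.2]) _)
  · exact (intervalIntegrable_iff_integrableOn_Ioo_of_le zero_le_one).mp
      (intervalIntegrable_ev_edge (by linarith) _)

/-- If the form vanishes, p is constant on the lines x + y = const and zero on the edge x = 0, which
meets all those lines inside the triangle. -/
theorem sobForm_self_ne_zero {g l l₀ : ℝ} (hg : -1 < g) (hl : 0 < l) (hl₀ : 0 < l₀)
    {p : MvPolynomial (Fin 2) ℝ} (hp : p ≠ 0) : sobForm l l₀ g p p ≠ 0 := by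
  intro h
  have h1 : 0 ≤ triInt g (D₃ p * D₃ p) := by rw [← norm_toL2_sq hg]; positivity
  have h2 := edgeInt_mul_self_nonneg g (D₂ p)
  have h3 : 0 ≤ l₀ * (ev p (0, 0) * ev p (0, 0)) := mul_nonneg hl₀.le (mul_self_nonneg _)
  have h4 : 0 ≤ l * (edgeInt g (D₂ p * D₂ p) + l₀ * (ev p (0, 0) * ev p (0, 0))) := by positivity
  rw [sobForm] at h
  have h5 : D₃ p = 0 := eq_zero_of_triInt_mul_self hg (by linarith)
  have h6 : edgeInt g (D₂ p * D₂ p) + l₀ * (ev p (0, 0) * ev p (0, 0)) = 0 := by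
    have : l * (edgeInt g (D₂ p * D₂ p) + l₀ * (ev p (0, 0) * ev p (0, 0))) = 0 := by linarith
    exact (mul_eq_zero.mp this).resolve_left hl.ne'
  have h7 : ∀ t ∈ Set.Ioo (0 : ℝ) 1, ev (D₂ p) (0, t) = 0 := fun t ht =>
    ev_edge_eq_zero_of_edgeInt hg (by linarith) ht
  have h8 : ev p (0, 0) = 0 := by
    have : l₀ * (ev p (0, 0) * ev p (0, 0)) = 0 := by linarith
    simpa [hl₀.ne'] using this
  have h9 : ∀ t ∈ Set.Ioo (0 : ℝ) 1, ev p (0, t) = 0 := by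
    intro t ht
    have := intervalIntegral.integral_eq_sub_of_hasDerivAt_of_le (a := 0) (b := t)
      (f := fun t => ev p (0, t)) (f' := fun _ => 0) ht.1.le
      ((continuous_ev p).comp (by fun_prop : Continuous fun t : ℝ => ((0 : ℝ), t))).continuousOn
      (fun x hx => by
        have h := hasDerivAt_ev_comp p (hasDerivAt_const x (0 : ℝ)) (hasDerivAt_id x)
        refine h.congr_deriv ?_
        simp [h7 x ⟨hx.1, hx.2.trans ht.2⟩]) (by simp)
    simp only [intervalIntegral.integral_zero, h8, sub_zero] at this
    exact this.symm
  apply hp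
  refine eq_zero_of_ev_openTriangle fun q hq => ?_
  have h10 : ∀ x : ℝ, HasDerivAt (fun x => ev p (x, q.1 + q.2 - x)) 0 x := by
    intro x
    have h := hasDerivAt_ev_comp p (hasDerivAt_id x)
      ((hasDerivAt_const x (q.1 + q.2)).sub (hasDerivAt_id x))
    refine h.congr_deriv ?_
    have h11 := congrArg (fun r => ev r (x, q.1 + q.2 - x)) h5
    simp only [D₃_apply, ev_sub, ev_zero] at h11
    simp only [id, Pi.sub_apply]
    linarith
  have h12 := is_const_of_deriv_eq_zero (fun x => (h10 x).differentiableAt)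
    (fun x => (h10 x).deriv) q.1 0
  simp only [add_sub_cancel_left, sub_zero] at h12
  exact h12.trans (h9 _ ⟨by linarith [hq.1, hq.2.1], hq.2.2⟩)

/-! ### The basis spans the polynomials of bounded degree -/

/-- The pairs `(m, k)` with `k ≤ m ≤ n`. -/
def basIndex (n : ℕ) : Finset (Σ _ : ℕ, ℕ) :=
  (Finset.range (n + 1)).sigma fun m => Finset.range (m + 1)

theorem mem_basIndex {n : ℕ} {i : Σ _ : ℕ, ℕ} : i ∈ basIndex n ↔ i.1 ≤ n ∧ i.2 ≤ i.1 := by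
  simp [basIndex]

theorem finrank_restrictTotalDegree_le (n : ℕ) :
    Module.finrank ℝ (MvPolynomial.restrictTotalDegree (Fin 2) ℝ n) ≤ (basIndex n).card := by
  rw [MvPolynomial.restrictTotalDegree,
    Module.finrank_eq_nat_card_basis (MvPolynomial.basisRestrictSupport ℝ _),
    ← Fintype.card_coe, ← Nat.card_eq_fintype_card]
  have hs : ∀ s : Fin 2 →₀ ℕ, (s.sum fun _ e => e) = s 0 + s 1 := fun s => by
    rw [Finsupp.sum_fintype _ _ fun _ => rfl, Fin.sum_univ_two]
  -- The monomial x^a y^b is sent to the pair (a + b, a).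
  refine Nat.card_le_card_of_injective
    (fun s => ⟨⟨s.1 0 + s.1 1, s.1 0⟩, mem_basIndex.mpr ⟨?_, by simp⟩⟩) ?_
  · have := s.2
    rw [Set.mem_ofPred_eq, hs] at this
    exact this
  · intro s r h
    simp only [Subtype.mk.injEq, Sigma.mk.injEq, heq_eq_eq] at h
    refine Subtype.ext (Finsupp.ext fun i => ?_)
    fin_cases i
    · exact h.2
    · have := h.1; have := h.2; simp only [Fin.mk_one]; omega

/-- The basis polynomials of degree at most `n` span the polynomials of degree at most `n`. -/
theorem span_basPoly {g : ℝ} (hg : -1 < g) (n : ℕ) :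
    Submodule.span ℝ (Set.range fun i : basIndex n => basPoly g i.1.2 i.1.1) =
      MvPolynomial.restrictTotalDegree (Fin 2) ℝ n := by
  have hli : LinearIndependent ℝ fun i : basIndex n => basPoly g i.1.2 i.1.1 := by
    -- The basis does not depend on the two constants of the form, so both may be taken to be 1.
    refine LinearMap.BilinForm.linearIndependent_of_iIsOrtho (B := sobBilin hg 1 1) ?_ ?_
    · intro i j hij
      refine sobForm_basPoly hg 1 1 (mem_basIndex.mp i.2).2 (mem_basIndex.mp j.2).2 ?_
      intro h
      simp only [Prod.mk.injEq] at h
      exact hij (Subtype.ext (Sigma.ext h.2 (heq_of_eq h.1)))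
    · intro i
      exact sobForm_self_ne_zero hg one_pos one_pos (basPoly_ne_zero g _ _)
  refine Submodule.eq_of_le_of_finrank_le ?_ ?_
  · rw [Submodule.span_le]
    rintro _ ⟨i, rfl⟩
    have h := mem_basIndex.mp i.2
    exact (MvPolynomial.mem_restrictTotalDegree _ _ _).mpr
      ((totalDegree_basPoly_le g h.2).trans h.1)
  · rw [finrank_span_eq_card hli, Fintype.card_coe]
    exact finrank_restrictTotalDegree_le n

/-! ### Weak derivatives and translations -/

theorem IsWeakDeriv.smul {e : ℝ × ℝ} {f k : ℝ × ℝ → ℝ} (h : IsWeakDeriv e f k) (a : ℝ) :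
    IsWeakDeriv (a • e) f (fun q => a * k q) := by
  refine ⟨h.1, ?_, fun ψ h1 h2 h3 => ?_⟩
  · intro x hx
    exact (h.2.1 x hx).smul a
  · have := h.2.2 ψ h1 h2 h3
    simp only [map_smul, smul_eq_mul, mul_left_comm _ a, mul_assoc a]
    rw [integral_const_mul, integral_const_mul, this]
    ring

/-- For fixed s the map is a translation, so the skew map (s, q) ↦ (s, q + se) preserves the product
measure. -/
theorem integrable_comp_add_smul {k : ℝ × ℝ → ℝ} (hk : Integrable k) (e : ℝ × ℝ) :
    Integrable (fun p : ℝ × (ℝ × ℝ) => k (p.2 + p.1 • e))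
      ((volume.restrict (Set.Ioc (0 : ℝ) 1)).prod volume) := by
  have hm : MeasurePreserving (fun p : ℝ × (ℝ × ℝ) => (p.1, p.2 + p.1 • e))
      ((volume.restrict (Set.Ioc (0 : ℝ) 1)).prod volume)
      ((volume.restrict (Set.Ioc (0 : ℝ) 1)).prod volume) := by
    refine (MeasurePreserving.id _).skew_product (g := fun s q => q + s • e) ?_ ?_
    · exact (by fun_prop : Continuous fun p : ℝ × (ℝ × ℝ) => p.2 + p.1 • e).measurable
    · exact Eventually.of_forall fun s => (measurePreserving_add_right volume (s • e)).map_eq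
  exact hm.integrable_comp_of_integrable (hk.comp_snd _)

/-- The parameter enters only through the test function, whose derivative is bounded, so |f| times a
constant dominates. -/
theorem hasDerivAt_integral_mul_translate {f : ℝ × ℝ → ℝ} (hf : Integrable f) {ψ : ℝ × ℝ → ℝ}
    (h1 : ContDiff ℝ ∞ ψ) (h2 : HasCompactSupport ψ) (e : ℝ × ℝ) (s : ℝ) :
    HasDerivAt (fun s : ℝ => ∫ q, f q * ψ (q - s • e))
      (-∫ q, f q * fderiv ℝ ψ (q - s • e) e) s := by
  obtain ⟨C, hC⟩ := (h2.fderiv ℝ).exists_bound_of_continuous (h1.continuous_fderiv (by simp))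
  obtain ⟨C', hC'⟩ := h2.exists_bound_of_continuous h1.continuous
  have hc : ∀ s : ℝ, Continuous fun q : ℝ × ℝ => ψ (q - s • e) := fun s =>
    h1.continuous.comp (by fun_prop)
  have hc' : ∀ s : ℝ, Continuous fun q : ℝ × ℝ => fderiv ℝ ψ (q - s • e) e := fun s =>
    ((h1.continuous_fderiv (by simp)).comp
      (by fun_prop : Continuous fun q : ℝ × ℝ => q - s • e)).clm_apply continuous_const
  rw [← integral_neg]
  refine (hasDerivAt_integral_of_dominated_loc_of_deriv_le (s := Set.univ)
    (F := fun s q => f q * ψ (q - s • e))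
    (F' := fun s q => -(f q * fderiv ℝ ψ (q - s • e) e)) (bound := fun q => ‖f q‖ * (C * ‖e‖)) univ_mem
    (Eventually.of_forall fun s => hf.aestronglyMeasurable.mul (hc s).aestronglyMeasurable)
    ?_ ?_ ?_ (hf.norm.mul_const _) ?_).2
  · exact hf.mul_bdd (hc s).aestronglyMeasurable (Eventually.of_forall fun q => hC' _)
  · exact (hf.aestronglyMeasurable.mul (hc' s).aestronglyMeasurable).neg
  · refine Eventually.of_forall fun q s _ => ?_
    rw [norm_neg, norm_mul]
    exact mul_le_mul_of_nonneg_left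
      ((ContinuousLinearMap.le_opNorm _ _).trans
        (mul_le_mul_of_nonneg_right (hC _) (norm_nonneg _))) (norm_nonneg _)
  · refine Eventually.of_forall fun q s _ => ?_
    have a1 : HasDerivAt (fun s : ℝ => q - s • e) (-e) s := by
      have := ((hasDerivAt_id s).smul_const e).const_sub q
      simpa using this
    have a2 := ((h1.differentiable (by simp)) (q - s • e)).hasFDerivAt.comp_hasDerivAt s a1
    refine (a2.const_mul (f q)).congr_deriv ?_
    rw [map_neg]; ring

/-- Cutting f off outside a compact set allows integrals over the plane, where translation
invariance is available. -/
theorem integral_test {U K : Set (ℝ × ℝ)} (hKU : K ⊆ U) (f X : ℝ × ℝ → ℝ)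
    (hX : ∀ q, q ∉ K → X q = 0) :
    ∫ q in U, f q * X q = ∫ q, K.indicator f q * X q := by
  rw [setIntegral_eq_integral_of_forall_compl_eq_zero]
  · refine integral_congr_ae (Eventually.of_forall fun q => ?_)
    by_cases hq : q ∈ K
    · simp [hq]
    · simp [hX q hq]
  · intro q hq
    rw [hX q fun h => hq (hKU h), mul_zero]

/-- A function with a weak derivative in the direction `e` is the integral of that derivative along
almost every segment in the direction `e`. -/
theorem IsWeakDeriv.translate {e : ℝ × ℝ} {f k : ℝ × ℝ → ℝ} (h : IsWeakDeriv e f k) :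
    ∀ᵐ q, q ∈ openTriangle → q + e ∈ openTriangle →
      f (q + e) - f q = ∫ s in (0 : ℝ)..1, k (q + s • e) := by
  set U : Set (ℝ × ℝ) := openTriangle ∩ (fun q => q + e) ⁻¹' openTriangle with hU
  have hUo : IsOpen U := isOpen_openTriangle.inter
    (isOpen_openTriangle.preimage (by fun_prop))
  have hseg : ∀ q ∈ U, ∀ s ∈ Set.Icc (0 : ℝ) 1, q + s • e ∈ openTriangle := by
    intro q hq s hs
    have := convex_openTriangle.add_smul_sub_mem hq.1 hq.2 hs
    simpa using this
  -- compact neighbourhood data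
  have hK' : ∀ K ⊆ U, IsCompact K → ∃ K', IsCompact K' ∧ K' ⊆ openTriangle ∧
      ∀ q ∈ K, ∀ s ∈ Set.Icc (0 : ℝ) 1, q + s • e ∈ K' := by
    intro K hKU hK
    refine ⟨(fun p : ℝ × (ℝ × ℝ) => p.2 + p.1 • e) '' (Set.Icc (0 : ℝ) 1 ×ˢ K),
      (isCompact_Icc.prod hK).image (by fun_prop), ?_, ?_⟩
    · rintro _ ⟨p, ⟨hp1, hp2⟩, rfl⟩
      exact hseg _ (hKU hp2) _ hp1
    · intro q hq s hs
      exact ⟨(s, q), ⟨hs, hq⟩, rfl⟩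
  have hint : ∀ K' ⊆ openTriangle, IsCompact K' → ∀ g : ℝ × ℝ → ℝ, LocallyIntegrableOn g openTriangle →
      Integrable (K'.indicator g) := by
    intro K' hK'T hK'c g hg
    rw [integrable_indicator_iff hK'c.measurableSet]
    exact hg.integrableOn_compact_subset hK'T hK'c
  have hI : ∀ K ⊆ U, ∀ K' : Set (ℝ × ℝ), (∀ q ∈ K, ∀ s ∈ Set.Icc (0 : ℝ) 1, q + s • e ∈ K') → ∀ q ∈ K,
      ∫ s in (0 : ℝ)..1, k (q + s • e) = ∫ s in Set.Ioc (0 : ℝ) 1, K'.indicator k (q + s • e) := by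
    intro K hKU K' hKK' q hq
    rw [intervalIntegral.integral_of_le zero_le_one]
    refine setIntegral_congr_fun measurableSet_Ioc fun s hs => ?_
    simp only [Set.indicator_of_mem (hKK' q hq s (Set.Ioc_subset_Icc_self hs))]
  have key : ∀ᵐ q, q ∈ U → f (q + e) - f q - ∫ s in (0 : ℝ)..1, k (q + s • e) = 0 := by
    refine hUo.ae_eq_zero_of_integral_contDiff_smul_eq_zero ?_ ?_
    · rw [locallyIntegrableOn_iff hUo.isLocallyClosed]
      intro K hKU hK
      obtain ⟨K', hc, hT, hm⟩ := hK' K hKU hK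
      have hf' := hint K' hT hc f h.1
      have hk' := hint K' hT hc k h.2.1
      have b1 : Integrable fun q => K'.indicator f (q + e) := hf'.comp_add_right e
      have b2 : Integrable fun q => ∫ s in Set.Ioc (0 : ℝ) 1, K'.indicator k (q + s • e) :=
        (integrable_comp_add_smul hk' e).integral_prod_right
      refine (((b1.sub hf').sub b2).integrableOn (s := K)).congr_fun (fun q hq => ?_)
        hK.measurableSet
      have m0 := hm q hq 0 (by simp)
      have m1 := hm q hq 1 (by simp)
      rw [zero_smul, add_zero] at m0
      rw [one_smul] at m1
      simp only [Pi.sub_apply, Set.indicator_of_mem m0, Set.indicator_of_mem m1,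
        hI K hKU K' hm q hq]
    · intro ψ h1 h2 h3
      set K := tsupport ψ with hKdef
      obtain ⟨K', hc, hT, hm⟩ := hK' K h3 h2
      have hf' := hint K' hT hc f h.1
      have hk' := hint K' hT hc k h.2.1
      have b1 : Integrable fun q => K'.indicator f (q + e) := hf'.comp_add_right e
      have b2 := integrable_comp_add_smul hk' e
      obtain ⟨C', hC'⟩ := h2.exists_bound_of_continuous h1.continuous
      have hψb : ∀ {G : ℝ × ℝ → ℝ}, Integrable G → Integrable fun q => ψ q * G q := fun hG =>
        hG.bdd_mul h1.continuous.aestronglyMeasurable (Eventually.of_forall hC')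
      -- the derivative in `s`
      have hder : ∀ s ∈ Set.uIcc (0 : ℝ) 1,
          HasDerivAt (fun s : ℝ => ∫ q, K'.indicator f q * ψ (q - s • e))
            (∫ q, ψ q * K'.indicator k (q + s • e)) s := by
        intro s hs
        rw [Set.uIcc_of_le zero_le_one] at hs
        refine (hasDerivAt_integral_mul_translate hf' h1 h2 e s).congr_deriv ?_
        have hφ : ContDiff ℝ ∞ fun q => ψ (q - s • e) := h1.comp (contDiff_id.sub contDiff_const)
        have hsub : ∀ q, q ∉ K' → q - s • e ∉ K := by
          intro q hq h'
          exact hq (by simpa using hm _ h' s hs)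
        -- The translated test function is supported in the compact set swept out by the segments,
        -- hence is admissible for the weak derivative.
        have hts : tsupport (fun q => ψ (q - s • e)) ⊆ K' := by
          refine closure_minimal (fun q hq => ?_) hc.isClosed
          by_contra hq'
          exact hq (image_eq_zero_of_notMem_tsupport (hsub q hq'))
        have hcs : HasCompactSupport fun q => ψ (q - s • e) :=
          hc.of_isClosed_subset (isClosed_tsupport _) hts
        have hw := h.2.2 _ hφ hcs (hts.trans hT)
        have hfd : ∀ q, fderiv ℝ (fun q => ψ (q - s • e)) q = fderiv ℝ ψ (q - s • e) := fun q =>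
          fderiv_comp_sub (s • e)
        simp only [hfd] at hw
        rw [integral_test hT f (fun q => fderiv ℝ ψ (q - s • e) e) ?_,
          integral_test hT k (fun q => ψ (q - s • e)) ?_] at hw
        · rw [hw, neg_neg]
          have := integral_add_right_eq_self (μ := (volume : Measure (ℝ × ℝ)))
            (fun q => K'.indicator k q * ψ (q - s • e)) (s • e)
          rw [← this]
          simp only [add_sub_cancel_right, mul_comm]
        · intro q hq
          exact image_eq_zero_of_notMem_tsupport (hsub q hq)
        · intro q hq
          have : fderiv ℝ ψ (q - s • e) = 0 := by
            refine image_eq_zero_of_notMem_tsupport fun h' => hsub q hq ?_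
            exact tsupport_fderiv_subset ℝ h'
          rw [this]; rfl
      have b3 : Integrable (fun p : ℝ × (ℝ × ℝ) => ψ p.2 * K'.indicator k (p.2 + p.1 • e))
          ((volume.restrict (Set.Ioc (0 : ℝ) 1)).prod volume) :=
        b2.bdd_mul (h1.continuous.comp continuous_snd).aestronglyMeasurable
          (Eventually.of_forall fun p => hC' p.2)
      have b4 : IntervalIntegrable (fun s : ℝ => ∫ q, ψ q * K'.indicator k (q + s • e))
          volume 0 1 := by
        rw [intervalIntegrable_iff_integrableOn_Ioc_of_le zero_le_one]
        exact b3.integral_prod_left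
      have b5 := intervalIntegral.integral_eq_sub_of_hasDerivAt hder b4
      -- The fundamental theorem in s, followed by Fubini: this is the claim tested against ψ.
      rw [intervalIntegral.integral_of_le zero_le_one, integral_integral_swap b3] at b5
      simp only [one_smul, zero_smul, sub_zero] at b5
      have b6 : ∀ q, ψ q • (f (q + e) - f q - ∫ s in (0 : ℝ)..1, k (q + s • e)) =
          ψ q * K'.indicator f (q + e) - ψ q * K'.indicator f q -
            ψ q * ∫ s in Set.Ioc (0 : ℝ) 1, K'.indicator k (q + s • e) := by
        intro q
        by_cases hq : q ∈ K
        · have m0 := hm q hq 0 (by simp)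
          have m1 := hm q hq 1 (by simp)
          rw [zero_smul, add_zero] at m0
          rw [one_smul] at m1
          rw [Set.indicator_of_mem m0, Set.indicator_of_mem m1, hI K h3 K' hm q hq, smul_eq_mul]
          ring
        · rw [image_eq_zero_of_notMem_tsupport hq]; simp
      have b7 := integral_add_right_eq_self (μ := (volume : Measure (ℝ × ℝ)))
        (fun q => K'.indicator f q * ψ (q - e)) e
      simp only [add_sub_cancel_right] at b7
      simp only [b6]
      have c1 := hψb b1
      have c2 := hψb hf'
      have c3 : Integrable fun q => ψ q * ∫ s in Set.Ioc (0 : ℝ) 1, K'.indicator k (q + s • e) :=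
        hψb b2.integral_prod_right
      have c4 : Integrable fun q => ψ q * K'.indicator f (q + e) - ψ q * K'.indicator f q :=
        c1.sub c2
      rw [integral_sub c4 c3, integral_sub c1 c2]
      simp only [integral_const_mul] at b5
      rw [b5, ← b7]
      simp only [mul_comm]
      ring
  filter_upwards [key] with q hq h1 h2
  have := hq ⟨h1, h2⟩
  linarith

/-! ### Calculus of weak derivatives -/

theorem LocallyIntegrableOn.congr_openTriangle {f f' : ℝ × ℝ → ℝ}
    (h : LocallyIntegrableOn f openTriangle) (hf : f =ᵐ[volume.restrict openTriangle] f') :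
    LocallyIntegrableOn f' openTriangle := by
  rw [locallyIntegrableOn_iff isOpen_openTriangle.isLocallyClosed] at h ⊢
  intro K hK hc
  exact (h K hK hc).congr (ae_restrict_of_ae_restrict_of_subset hK hf)

theorem IsWeakDeriv.congr {e : ℝ × ℝ} {f f' k k' : ℝ × ℝ → ℝ} (h : IsWeakDeriv e f k)
    (hf : f =ᵐ[volume.restrict openTriangle] f') (hk : k =ᵐ[volume.restrict openTriangle] k') :
    IsWeakDeriv e f' k' := by
  refine ⟨LocallyIntegrableOn.congr_openTriangle h.1 hf,
    LocallyIntegrableOn.congr_openTriangle h.2.1 hk, fun ψ h1 h2 h3 => ?_⟩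
  have := h.2.2 ψ h1 h2 h3
  have e1 : ∫ q in openTriangle, f q * fderiv ℝ ψ q e = ∫ q in openTriangle, f' q * fderiv ℝ ψ q e :=
    integral_congr_ae (hf.mono fun q hq => by simp only [hq])
  have e2 : ∫ q in openTriangle, k q * ψ q = ∫ q in openTriangle, k' q * ψ q :=
    integral_congr_ae (hk.mono fun q hq => by simp only [hq])
  rw [← e1, ← e2, this]

theorem integrableOn_mul_test {f X : ℝ × ℝ → ℝ} (hf : LocallyIntegrableOn f openTriangle)
    (hX : Continuous X) (hc : HasCompactSupport X) (hs : tsupport X ⊆ openTriangle) :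
    IntegrableOn (fun q => f q * X q) openTriangle := by
  obtain ⟨C, hC⟩ := hc.exists_bound_of_continuous hX
  have h1 : IntegrableOn (fun q => f q * X q) (tsupport X) :=
    (hf.integrableOn_compact_subset hs hc).mul_bdd hX.aestronglyMeasurable
      (Eventually.of_forall hC)
  refine h1.of_forall_sdiff_eq_zero measurableSet_openTriangle fun q hq => ?_
  rw [image_eq_zero_of_notMem_tsupport hq.2, mul_zero]

theorem IsWeakDeriv.unique {e : ℝ × ℝ} {f k k' : ℝ × ℝ → ℝ} (h : IsWeakDeriv e f k)
    (h' : IsWeakDeriv e f k') : k =ᵐ[volume.restrict openTriangle] k' := by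
  have : ∀ᵐ q, q ∈ openTriangle → k q - k' q = 0 := by
    refine isOpen_openTriangle.ae_eq_zero_of_integral_contDiff_smul_eq_zero
      (h.2.1.sub h'.2.1) fun ψ h1 h2 h3 => ?_
    rw [← setIntegral_eq_integral_of_forall_compl_eq_zero (s := openTriangle)]
    · have e1 := h.2.2 ψ h1 h2 h3
      rw [h'.2.2 ψ h1 h2 h3] at e1
      simp only [smul_eq_mul, mul_comm (ψ _), sub_mul]
      rw [integral_sub (integrableOn_mul_test h.2.1 h1.continuous h2 h3)
        (integrableOn_mul_test h'.2.1 h1.continuous h2 h3)]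
      linarith
    · intro q hq
      rw [image_eq_zero_of_notMem_tsupport fun h' => hq (h3 h'), zero_smul]
  refine (ae_restrict_iff' measurableSet_openTriangle).mpr ?_
  filter_upwards [this] with q hq hqT
  linarith [hq hqT]

theorem IsWeakDeriv.add_dir {e e' : ℝ × ℝ} {f k k' : ℝ × ℝ → ℝ} (h : IsWeakDeriv e f k)
    (h' : IsWeakDeriv e' f k') : IsWeakDeriv (e + e') f (fun q => k q + k' q) := by
  refine ⟨h.1, h.2.1.add h'.2.1, fun ψ h1 h2 h3 => ?_⟩
  have hd : ∀ v : ℝ × ℝ, IntegrableOn (fun q => f q * fderiv ℝ ψ q v) openTriangle := fun v => by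
    have hs : tsupport (fun q => fderiv ℝ ψ q v) ⊆ tsupport ψ :=
      (closure_minimal (fun q hq => by
        refine subset_tsupport _ (Function.mem_support.mpr fun h0 => ?_)
        exact (Function.mem_support.mp hq) (by rw [h0]; rfl))
        (isClosed_tsupport _)).trans (tsupport_fderiv_subset ℝ)
    exact integrableOn_mul_test h.1 ((h1.continuous_fderiv (by simp)).clm_apply continuous_const)
      (h2.of_isClosed_subset (isClosed_tsupport _) hs) (hs.trans h3)
  simp only [map_add, mul_add, add_mul]
  rw [integral_add (hd e) (hd e'), integral_add (integrableOn_mul_test h.2.1 h1.continuous h2 h3)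
        (integrableOn_mul_test h'.2.1 h1.continuous h2 h3), h.2.2 ψ h1 h2 h3, h'.2.2 ψ h1 h2 h3]
  ring

/-- The test function ψ ∘ A is used in the weak equation; its derivative along w is that of ψ along
Lw, and A preserves area. -/
theorem IsWeakDeriv.comp_symm {A : ℝ × ℝ → ℝ × ℝ} {L : (ℝ × ℝ) →L[ℝ] (ℝ × ℝ)}
    (hA : IsTriangleSymm A L) {v w : ℝ × ℝ} (hv : L w = v) {f k : ℝ × ℝ → ℝ}
    (h : IsWeakDeriv w f k) : IsWeakDeriv v (fun q => f (A q)) (fun q => k (A q)) := by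
  have hloc : ∀ g : ℝ × ℝ → ℝ, LocallyIntegrableOn g openTriangle →
      LocallyIntegrableOn (fun q => g (A q)) openTriangle := by
    intro g hg
    rw [locallyIntegrableOn_iff isOpen_openTriangle.isLocallyClosed]
    intro K hK hc
    have e2 : A ⁻¹' (A '' K) = K := Set.preimage_image_eq K hA.invol.injective
    have := (hA.measurePreserving.integrableOn_comp_preimage hA.measurableEmbedding
      (f := g) (s := A '' K)).mpr (hg.integrableOn_compact_subset ?_ (hc.image hA.continuous))
    · rw [e2] at this; exact this
    · rintro _ ⟨q, hq, rfl⟩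
      exact (hA.mem_iff q).mpr (hK hq)
  refine ⟨hloc f h.1, hloc k h.2.1, fun ψ h1 h2 h3 => ?_⟩
  have hφ : ContDiff ℝ ∞ fun q => ψ (A q) := h1.comp hA.contDiff
  have e1 : A '' tsupport ψ = A ⁻¹' tsupport ψ :=
    congrFun (Set.image_eq_preimage_of_inverse hA.invol hA.invol) _
  have hts : tsupport (fun q => ψ (A q)) ⊆ A ⁻¹' tsupport ψ :=
    closure_minimal (fun q hq => subset_tsupport _ hq)
      ((isClosed_tsupport ψ).preimage hA.continuous)
  have hcs : HasCompactSupport fun q => ψ (A q) :=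
    (e1 ▸ h2.image hA.continuous : IsCompact (A ⁻¹' tsupport ψ)).of_isClosed_subset
      (isClosed_tsupport _) hts
  have hw := h.2.2 _ hφ hcs (hts.trans fun q hq => (hA.mem_iff q).mp (h3 hq))
  have hfd : ∀ q, fderiv ℝ (fun q => ψ (A q)) q w = fderiv ℝ ψ (A q) v := by
    intro q
    have := ((h1.differentiable (by simp)) (A q)).hasFDerivAt.comp q (hA.hasFDerivAt q)
    have e2 := this.fderiv
    simp only [Function.comp_def] at e2
    rw [e2, ContinuousLinearMap.comp_apply, hv]
  simp only [hfd] at hw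
  rw [← hA.setIntegral_comp, ← hA.setIntegral_comp (fun q => k q * ψ (A q))] at hw
  simp only [hA.invol _] at hw
  exact hw

theorem exists_measurable_ae_eq {f : ℝ × ℝ → ℝ} (h : LocallyIntegrableOn f openTriangle) :
    ∃ f', Measurable f' ∧ f =ᵐ[volume.restrict openTriangle] f' :=
  ⟨_, h.aestronglyMeasurable.stronglyMeasurable_mk.measurable, h.aestronglyMeasurable.ae_eq_mk⟩

/-- A function with a weak derivative in `x` is the integral of that derivative on almost every
horizontal line. -/
theorem IsWeakDeriv.horizontal {f k : ℝ × ℝ → ℝ} (h : IsWeakDeriv (1, 0) f k)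
    (hf : Measurable f) (hk : Measurable k) :
    ∀ᵐ q : ℝ × ℝ, ∀ᵐ x' : ℝ, q ∈ openTriangle → (x', q.2) ∈ openTriangle →
      f (x', q.2) - f q = ∫ ξ in q.1..x', k (ξ, q.2) := by
  have h1 : ∀ᵐ τ : ℝ, ∀ᵐ q : ℝ × ℝ, q ∈ openTriangle → (q.1 + τ, q.2) ∈ openTriangle →
      f (q.1 + τ, q.2) - f q = ∫ s in Set.Ioc (0 : ℝ) 1, τ * k (q.1 + τ * s, q.2) := by
    refine Eventually.of_forall fun τ => ?_
    have := (h.smul τ).translate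
    filter_upwards [this] with q hq h1 h2
    have e1 : q + τ • ((1 : ℝ), (0 : ℝ)) = (q.1 + τ, q.2) := by ext <;> simp
    have e2 : ∀ s : ℝ, q + s • τ • ((1 : ℝ), (0 : ℝ)) = (q.1 + τ * s, q.2) := fun s => by
      ext <;> simp [mul_comm]
    simp only [e1, e2] at hq
    rw [hq h1 h2, intervalIntegral.integral_of_le zero_le_one]
  -- Measurability of this set allows the quantifiers over the step τ and the point q to be
  -- exchanged; it is the reason for asking f and k to be measurable.
  have hm : MeasurableSet {p : ℝ × (ℝ × ℝ) | p.2 ∈ openTriangle →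
      (p.2.1 + p.1, p.2.2) ∈ openTriangle → f (p.2.1 + p.1, p.2.2) - f p.2 =
        ∫ s in Set.Ioc (0 : ℝ) 1, p.1 * k (p.2.1 + p.1 * s, p.2.2)} := by
    have m1 : Measurable fun p : ℝ × (ℝ × ℝ) => (p.2.1 + p.1, p.2.2) := by fun_prop
    have m2 : StronglyMeasurable fun p : ℝ × (ℝ × ℝ) =>
        ∫ s in Set.Ioc (0 : ℝ) 1, p.1 * k (p.2.1 + p.1 * s, p.2.2) := by
      refine StronglyMeasurable.integral_prod_right (f := fun (p : ℝ × (ℝ × ℝ)) (s : ℝ) =>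
        p.1 * k (p.2.1 + p.1 * s, p.2.2)) ?_
      refine Measurable.stronglyMeasurable ?_
      refine Measurable.mul (by fun_prop) (hk.comp ?_)
      fun_prop
    refine MeasurableSet.imp (measurable_snd measurableSet_openTriangle)
      (MeasurableSet.imp (m1 measurableSet_openTriangle) ?_)
    exact measurableSet_eq_fun ((hf.comp m1).sub (hf.comp measurable_snd)) m2.measurable
  have h2 := (Measure.ae_ae_comm hm).mp h1
  filter_upwards [h2] with q hq
  have := (measurePreserving_sub_right (volume : Measure ℝ) q.1).quasiMeasurePreserving.ae hq
  filter_upwards [this] with x' hx' h1 h2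
  rw [add_sub_cancel] at hx'
  rw [hx' h1 h2, integral_const_mul, ← intervalIntegral.integral_of_le zero_le_one,
    intervalIntegral.mul_integral_comp_add_mul (f := fun ξ => k (ξ, q.2))]
  simp

/-! ### Integration by parts on an interval with an endpoint weight -/

theorem intervalIntegrable_sub_rpow {L r : ℝ} (hr : -1 < r) (a b : ℝ) :
    IntervalIntegrable (fun x : ℝ => (L - x) ^ r) volume a b := by
  have h := (intervalIntegral.intervalIntegrable_rpow' hr (a := L - a) (b := L - b)).comp_sub_left L
  simpa using h

/-- The integrand is the derivative of p(x)(L - x)^a with the power (L - x)^(a-1) factored out. -/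
theorem integral_deriv_mul_sub_rpow {L a : ℝ} (ha : 0 < a) {p p' : ℝ → ℝ}
    (hp : ∀ x, HasDerivAt p (p' x) x) (hp' : Continuous p') {ξ : ℝ} (hξ : ξ ≤ L) :
    ∫ x in ξ..L, ((L - x) * p' x - a * p x) * (L - x) ^ (a - 1) = -(p ξ * (L - ξ) ^ a) := by
  have hpc : Continuous p := continuous_iff_continuousAt.mpr fun x => (hp x).continuousAt
  have hd : ∀ x ∈ Set.Ioo ξ L, HasDerivAt (fun x => p x * (L - x) ^ a)
      (((L - x) * p' x - a * p x) * (L - x) ^ (a - 1)) x := by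
    intro x hx
    have hz : 0 < L - x := by linarith [hx.2]
    have a2 := ((hasDerivAt_const x L).sub (hasDerivAt_id x)).rpow_const
      (p := a) (Or.inl hz.ne')
    refine ((hp x).mul a2).congr_deriv ?_
    have e : (L - x) ^ a = (L - x) ^ (a - 1) * (L - x) := by
      rw [← Real.rpow_add_one hz.ne']; ring_nf
    simp only [id, Pi.sub_apply]
    rw [e]; ring
  rw [intervalIntegral.integral_eq_sub_of_hasDerivAt_of_le hξ ?_ hd]
  · rw [sub_self, Real.zero_rpow ha.ne']; ring
  · exact (intervalIntegrable_sub_rpow (by linarith) _ _).continuousOn_mul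
      (by fun_prop : Continuous fun x => (L - x) * p' x - a * p x).continuousOn
  · exact hpc.continuousOn.mul (ContinuousOn.rpow_const (by fun_prop) fun x _ => Or.inr ha.le)

/-- Integration by parts against a weight which vanishes at the right endpoint. -/
theorem integral_primitive_mul {L a : ℝ} (hL : 0 < L) (ha : 0 < a) {k : ℝ → ℝ}
    (hkm : Measurable k) (hk : IntegrableOn (fun x => k x * (L - x) ^ a) (Set.Ioo 0 L))
    {p p' : ℝ → ℝ} (hp : ∀ x, HasDerivAt p (p' x) x) (hp' : Continuous p') (b : ℝ) :
    IntervalIntegrable (fun x => (b + ∫ ξ in (0 : ℝ)..x, k ξ) *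
        (((L - x) * p' x - a * p x) * (L - x) ^ (a - 1))) volume 0 L ∧
    (∫ x in (0 : ℝ)..L, k x * (p x * (L - x) ^ a)) +
      (∫ x in (0 : ℝ)..L, (b + ∫ ξ in (0 : ℝ)..x, k ξ) *
        (((L - x) * p' x - a * p x) * (L - x) ^ (a - 1))) + b * (p 0 * L ^ a) = 0 := by
  have hpc : Continuous p := continuous_iff_continuousAt.mpr fun x => (hp x).continuousAt
  set V : ℝ → ℝ := fun x => ((L - x) * p' x - a * p x) * (L - x) ^ (a - 1) with hV
  have hwc : Continuous fun x => (L - x) * p' x - a * p x := by fun_prop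
  have hVm : Measurable V := hwc.measurable.mul ((measurable_const.sub measurable_id).pow_const _)
  have hVi : ∀ c d, IntervalIntegrable V volume c d := fun c d =>
    (intervalIntegrable_sub_rpow (by linarith) _ _).continuousOn_mul hwc.continuousOn
  have hFTC : ∀ ξ ≤ L, ∫ x in ξ..L, V x = -(p ξ * (L - ξ) ^ a) := fun ξ hξ =>
    integral_deriv_mul_sub_rpow ha hp hp' hξ
  obtain ⟨C, hC⟩ := isCompact_Icc.exists_bound_of_continuousOn (s := Set.Icc 0 L) hwc.continuousOn
  set μ := volume.restrict (Set.Ioo (0 : ℝ) L) with hμ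
  have hS : MeasurableSet {p : ℝ × ℝ | p.1 < p.2} := measurableSet_lt measurable_fst measurable_snd
  have hVμ : Integrable V μ :=
    (intervalIntegrable_iff_integrableOn_Ioo_of_le hL.le).mp (hVi 0 L)
  -- The product of the primitive of k with V is a double integral over ξ < x, to which Fubini is
  -- applied.
  set Φ : ℝ × ℝ → ℝ := {p : ℝ × ℝ | p.1 < p.2}.indicator fun p => k p.1 * V p.2 with hΦ
  have hΦm : Measurable Φ :=
    ((hkm.comp measurable_fst).mul (hVm.comp measurable_snd)).indicator hS
  have hinner : ∀ ξ ∈ Set.Ioo 0 L, ∀ X : ℝ → ℝ,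
      ∫ x, (Set.Ioi ξ).indicator X x ∂μ = ∫ x in ξ..L, X x := by
    intro ξ hξ X
    rw [integral_indicator measurableSet_Ioi, hμ, Measure.restrict_restrict measurableSet_Ioi,
      intervalIntegral.integral_of_le hξ.2.le, integral_Ioc_eq_integral_Ioo]
    congr 2
    ext x; simp only [Set.mem_inter_iff, Set.mem_Ioi, Set.mem_Ioo]
    constructor
    · rintro ⟨h1, -, h2⟩; exact ⟨h1, h2⟩
    · rintro ⟨h1, h2⟩; exact ⟨h1, hξ.1.trans h1, h2⟩
  -- Integrating |V| over x > ξ first leaves at most (C/a)(L - ξ)^a, exactly the weight against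
  -- which k is integrable.
  have hΦi : Integrable Φ (μ.prod μ) := by
    rw [integrable_prod_iff hΦm.aestronglyMeasurable]
    constructor
    · refine Eventually.of_forall fun ξ => ?_
      exact (hVμ.const_mul (k ξ)).indicator (measurableSet_Ioi (a := ξ))
    · refine Integrable.mono' (hk.norm.const_mul (C / a))
        hΦm.norm.aestronglyMeasurable.integral_prod_right' ?_
      refine (ae_restrict_iff' measurableSet_Ioo).mpr (Eventually.of_forall fun ξ hξ => ?_)
      have e1 : ∀ x, ‖Φ (ξ, x)‖ = (Set.Ioi ξ).indicator (fun x => ‖k ξ * V x‖) x := fun x => by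
        by_cases hx : ξ < x <;> simp [hΦ, hx, Set.indicator]
      rw [Real.norm_of_nonneg (integral_nonneg fun x => norm_nonneg _)]
      simp only [e1]
      rw [hinner ξ hξ]
      have hz : 0 < L - ξ := by linarith [hξ.2]
      have e2 : ∫ x in ξ..L, ‖k ξ * V x‖ ≤ ∫ x in ξ..L, ‖k ξ‖ * (C * (L - x) ^ (a - 1)) := by
        refine intervalIntegral.integral_mono_on hξ.2.le ((hVi ξ L).const_mul _).norm
          (((intervalIntegrable_sub_rpow (by linarith) _ _).const_mul _).const_mul _)
          fun x hx => ?_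
        have hx' : 0 ≤ L - x := by linarith [hx.2]
        rw [norm_mul, hV, norm_mul, Real.norm_of_nonneg (Real.rpow_nonneg hx' _)]
        refine mul_le_mul_of_nonneg_left ?_ (norm_nonneg _)
        exact mul_le_mul_of_nonneg_right (hC x ⟨hξ.1.le.trans hx.1, hx.2⟩) (Real.rpow_nonneg hx' _)
      have e3 := integral_deriv_mul_sub_rpow (L := L) ha (fun x => hasDerivAt_const x (1 : ℝ))
        continuous_const hξ.2.le
      simp only [mul_zero, mul_one, zero_sub, one_mul, intervalIntegral.integral_const_mul] at e3
      refine e2.trans (le_of_eq ?_)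
      rw [intervalIntegral.integral_const_mul, intervalIntegral.integral_const_mul, norm_mul,
        Real.norm_of_nonneg (Real.rpow_nonneg hz.le a)]
      have e4 : ∫ x in ξ..L, (L - x) ^ (a - 1) = (L - ξ) ^ a / a := by
        field_simp; linarith
      rw [e4]; ring
  have hlow : ∀ x ∈ Set.Ioo 0 L, ∫ ξ, Φ (ξ, x) ∂μ = (∫ ξ in (0 : ℝ)..x, k ξ) * V x := by
    intro x hx
    have e1 : ∀ ξ, Φ (ξ, x) = (Set.Iio x).indicator (fun ξ => k ξ * V x) ξ := fun ξ => by
      by_cases h : ξ < x <;> simp [hΦ, h, Set.indicator]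
    simp only [e1]
    rw [integral_indicator measurableSet_Iio, hμ, Measure.restrict_restrict measurableSet_Iio,
      integral_mul_const, intervalIntegral.integral_of_le hx.1.le, integral_Ioc_eq_integral_Ioo]
    congr 3
    ext ξ; simp only [Set.mem_inter_iff, Set.mem_Iio, Set.mem_Ioo]
    constructor
    · rintro ⟨h1, h2, -⟩; exact ⟨h2, h1⟩
    · rintro ⟨h1, h2⟩; exact ⟨h2, h1, h2.trans hx.2⟩
  have hI : Integrable (fun x => (∫ ξ in (0 : ℝ)..x, k ξ) * V x) μ :=
    hΦi.integral_prod_right.congr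
      ((ae_restrict_iff' measurableSet_Ioo).mpr (Eventually.of_forall hlow))
  have hI' : IntervalIntegrable (fun x => (∫ ξ in (0 : ℝ)..x, k ξ) * V x) volume 0 L :=
    (intervalIntegrable_iff_integrableOn_Ioo_of_le hL.le).mpr hI
  have hbV : IntervalIntegrable (fun x => b * V x) volume 0 L := (hVi 0 L).const_mul b
  have hsplit : (fun x => (b + ∫ ξ in (0 : ℝ)..x, k ξ) * V x) =
      fun x => b * V x + (∫ ξ in (0 : ℝ)..x, k ξ) * V x := funext fun x => add_mul _ _ _
  refine ⟨by rw [hsplit]; exact hbV.add hI', ?_⟩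
  have hswap : ∫ x, (∫ ξ in (0 : ℝ)..x, k ξ) * V x ∂μ = -∫ ξ, k ξ * (p ξ * (L - ξ) ^ a) ∂μ := by
    rw [← integral_congr_ae ((ae_restrict_iff' measurableSet_Ioo).mpr
      (Eventually.of_forall hlow)),
      integral_integral_swap (f := fun x ξ => Φ (ξ, x)) hΦi.swap, ← integral_neg]
    refine integral_congr_ae ((ae_restrict_iff' measurableSet_Ioo).mpr
      (Eventually.of_forall fun ξ hξ => ?_))
    have e1 : ∀ x, Φ (ξ, x) = (Set.Ioi ξ).indicator (fun x => k ξ * V x) x := fun x => by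
      by_cases hx : ξ < x <;> simp [hΦ, hx, Set.indicator]
    simp only [e1]
    rw [hinner ξ hξ, intervalIntegral.integral_const_mul, hFTC ξ hξ.2.le]
    ring
  rw [hsplit, intervalIntegral.integral_add hbV hI', intervalIntegral.integral_const_mul,
    hFTC 0 hL.le, intervalIntegral.integral_of_le hL.le, intervalIntegral.integral_of_le hL.le,
    integral_Ioc_eq_integral_Ioo, integral_Ioc_eq_integral_Ioo, hswap, sub_zero]
  ring

/-! ### Traces of functions with a weak derivative in `x` -/

/-- Away from L the weight is continuous and nonzero, so it can be divided out. -/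
theorem intervalIntegrable_of_mul_sub_rpow {L a : ℝ} {k : ℝ → ℝ}
    (hk : IntegrableOn (fun x => k x * (L - x) ^ a) (Set.Ioo 0 L)) {x x' : ℝ}
    (hx : x ∈ Set.Ico 0 L) (hx' : x' ∈ Set.Ico 0 L) : IntervalIntegrable k volume x x' := by
  have hsub : Set.uIcc x x' ⊆ Set.Ico 0 L := Set.ordConnected_Ico.uIcc_subset hx hx'
  have h0 : IntervalIntegrable (fun x => k x * (L - x) ^ a) volume 0 L :=
    (intervalIntegrable_iff_integrableOn_Ioo_of_le (hx.1.trans hx.2.le)).mpr hk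
  have h1 : IntervalIntegrable (fun x => k x * (L - x) ^ a) volume x x' := by
    refine h0.mono_set ?_
    rw [Set.uIcc_of_le (hx.1.trans hx.2.le)]
    exact hsub.trans Set.Ico_subset_Icc_self
  have hc : ContinuousOn (fun x => (L - x) ^ (-a)) (Set.uIcc x x') :=
    ContinuousOn.rpow_const (by fun_prop) fun y hy => Or.inl (by linarith [(hsub hy).2])
  refine (h1.mul_continuousOn hc).congr fun y hy => ?_
  have hz : 0 < L - y := by linarith [(hsub (Set.uIoc_subset_uIcc hy)).2]
  rw [mul_assoc, ← Real.rpow_add hz, add_neg_cancel, Real.rpow_zero, mul_one]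

theorem tendsto_intervalIntegral_zero {k : ℝ → ℝ} {r : ℝ} (hr : 0 < r)
    (hk : IntervalIntegrable k volume 0 r) :
    Tendsto (fun x => ∫ ξ in (0 : ℝ)..x, k ξ) (𝓝[>] 0) (𝓝 0) := by
  have h := intervalIntegral.continuousOn_primitive_interval' hk (by simp : (0 : ℝ) ∈ Set.uIcc 0 r)
  have h0 := h 0 (by simp)
  rw [ContinuousWithinAt, intervalIntegral.integral_same] at h0
  refine h0.mono_left ?_
  rw [Set.uIcc_of_le hr.le]
  exact nhdsWithin_le_of_mem (mem_of_superset (Ioo_mem_nhdsGT hr) Set.Ioo_subset_Icc_self)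

theorem eq_of_tendsto_of_ae_eq {f₁ f₂ : ℝ → ℝ} {a b r : ℝ} (hr : 0 < r)
    (h₁ : Tendsto f₁ (𝓝[>] 0) (𝓝 a)) (h₂ : Tendsto f₂ (𝓝[>] 0) (𝓝 b))
    (h : ∀ᵐ x : ℝ, x ∈ Set.Ioo 0 r → f₁ x = f₂ x) : a = b := by
  by_contra hab
  have h3 : ∀ᶠ x in 𝓝[>] (0 : ℝ), f₁ x - f₂ x ≠ 0 :=
    (h₁.sub h₂).eventually_ne (sub_ne_zero.mpr hab)
  obtain ⟨ε, hε, h4⟩ := mem_nhdsGT_iff_exists_Ioo_subset.mp h3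
  have hε' : (0 : ℝ) < ε := hε
  have h5 : volume (Set.Ioo 0 (min r ε)) = 0 := by
    refine measure_mono_null ?_ (ae_iff.mp h)
    intro x hx hx'
    have h6 := h4 ⟨hx.1, hx.2.trans_le (min_le_right _ _)⟩
    exact h6 (sub_eq_zero.mpr (hx' ⟨hx.1, hx.2.trans_le (min_le_left _ _)⟩))
  rw [Real.volume_Ioo, ENNReal.ofReal_eq_zero] at h5
  have : 0 < min r ε := lt_min hr hε'
  linarith

theorem ae_ae_swap {p : ℝ × ℝ → Prop} (h : ∀ᵐ q : ℝ × ℝ, p q) :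
    ∀ᵐ y : ℝ, ∀ᵐ x : ℝ, p (x, y) := by
  have h' : ∀ᵐ q : ℝ × ℝ ∂((volume : Measure ℝ).prod (volume : Measure ℝ)), p q.swap :=
    (Measure.measurePreserving_swap (μ := (volume : Measure ℝ))
      (ν := (volume : Measure ℝ))).quasiMeasurePreserving.ae h
  exact Measure.ae_ae_of_ae_prod h'

theorem exists_mem_Ioo_of_ae {p : ℝ → Prop} {a b : ℝ} (hab : a < b) (h : ∀ᵐ x : ℝ, p x) :
    ∃ x ∈ Set.Ioo a b, p x := by
  by_contra! hc
  have h5 : volume (Set.Ioo a b) = 0 := measure_mono_null (fun x hx => hc x hx) (ae_iff.mp h)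
  rw [Real.volume_Ioo, ENNReal.ofReal_eq_zero] at h5
  linarith

theorem mem_openTriangle_iff {x y : ℝ} (hy : y ∈ Set.Ioo (0 : ℝ) 1) :
    (x, y) ∈ openTriangle ↔ x ∈ Set.Ioo 0 (1 - y) := by
  simp only [openTriangle, Set.mem_ofPred_eq, Set.mem_Ioo]
  constructor
  · rintro ⟨h1, -, h3⟩; exact ⟨h1, by linarith⟩
  · rintro ⟨h1, h3⟩; exact ⟨h1, hy.1, by linarith⟩

/-- A function with an integrable weak derivative in `x` has a trace on the edge `x = 0`. -/
theorem IsWeakDeriv.exists_trace {f k : ℝ × ℝ → ℝ} (h : IsWeakDeriv (1, 0) f k)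
    (hf : Measurable f) (hk : Measurable k) {a : ℝ}
    (hint : ∀ᵐ y : ℝ, y ∈ Set.Ioo (0 : ℝ) 1 →
      IntegrableOn (fun x => k (x, y) * (1 - y - x) ^ a) (Set.Ioo 0 (1 - y))) :
    ∃ b : ℝ → ℝ, ∀ᵐ y : ℝ, y ∈ Set.Ioo (0 : ℝ) 1 →
      ∀ᵐ x : ℝ, x ∈ Set.Ioo 0 (1 - y) → f (x, y) = b y + ∫ ξ in (0 : ℝ)..x, k (ξ, y) := by
  have key : ∀ᵐ y : ℝ, ∃ b : ℝ, y ∈ Set.Ioo (0 : ℝ) 1 →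
      ∀ᵐ x : ℝ, x ∈ Set.Ioo 0 (1 - y) → f (x, y) = b + ∫ ξ in (0 : ℝ)..x, k (ξ, y) := by
    filter_upwards [ae_ae_swap (h.horizontal hf hk), hint] with y h1 h2
    by_cases hy : y ∈ Set.Ioo (0 : ℝ) 1
    · have hL : 0 < 1 - y := by linarith [hy.2]
      -- A single good abscissa on the line determines the constant of integration.
      obtain ⟨x, hx, h3⟩ := exists_mem_Ioo_of_ae hL h1
      refine ⟨f (x, y) - ∫ ξ in (0 : ℝ)..x, k (ξ, y), fun _ => ?_⟩
      filter_upwards [h3] with x' h4 hx'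
      have h5 := h4 ((mem_openTriangle_iff hy).mpr hx) ((mem_openTriangle_iff hy).mpr hx')
      have i1 := intervalIntegrable_of_mul_sub_rpow (h2 hy) ⟨le_rfl, hL⟩ ⟨hx.1.le, hx.2⟩
      have i2 := intervalIntegrable_of_mul_sub_rpow (h2 hy) ⟨hx.1.le, hx.2⟩ ⟨hx'.1.le, hx'.2⟩
      rw [← intervalIntegral.integral_add_adjacent_intervals i1 i2, ← h5]
      ring
    · exact ⟨0, fun h => absurd h hy⟩
  choose! b hb using fun y (hy : ∃ b : ℝ, y ∈ Set.Ioo (0 : ℝ) 1 →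
      ∀ᵐ x : ℝ, x ∈ Set.Ioo 0 (1 - y) → f (x, y) = b + ∫ ξ in (0 : ℝ)..x, k (ξ, y)) => hy
  exact ⟨b, key.mono fun y hy => hb y hy⟩

/-- Integration by parts on the triangle for a function which is a primitive on horizontal
lines. -/
theorem horizontal_ibp {f k : ℝ × ℝ → ℝ} {b : ℝ → ℝ} (hk : Measurable k) {a : ℝ} (ha : 0 < a)
    (hint : ∀ᵐ y : ℝ, y ∈ Set.Ioo (0 : ℝ) 1 →
      IntegrableOn (fun x => k (x, y) * (1 - y - x) ^ a) (Set.Ioo 0 (1 - y)))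
    (hb : ∀ᵐ y : ℝ, y ∈ Set.Ioo (0 : ℝ) 1 →
      ∀ᵐ x : ℝ, x ∈ Set.Ioo 0 (1 - y) → f (x, y) = b y + ∫ ξ in (0 : ℝ)..x, k (ξ, y))
    {P P' : ℝ × ℝ → ℝ} (hP : ∀ x y, HasDerivAt (fun x => P (x, y)) (P' (x, y)) x)
    (hP' : Continuous P') (wt : ℝ → ℝ)
    (h1 : IntegrableOn (fun q => k q * (P q * (1 - q.2 - q.1) ^ a) * wt q.2) openTriangle)
    (h2 : IntegrableOn (fun q => f q * (((1 - q.2 - q.1) * P' q - a * P q) *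
      (1 - q.2 - q.1) ^ (a - 1)) * wt q.2) openTriangle) :
    IntervalIntegrable (fun y => b y * (P (0, y) * (1 - y) ^ a) * wt y) volume 0 1 ∧
    (∫ q in openTriangle, k q * (P q * (1 - q.2 - q.1) ^ a) * wt q.2) +
      (∫ q in openTriangle, f q * (((1 - q.2 - q.1) * P' q - a * P q) *
        (1 - q.2 - q.1) ^ (a - 1)) * wt q.2) +
      (∫ y in (0 : ℝ)..1, b y * (P (0, y) * (1 - y) ^ a) * wt y) = 0 := by
  obtain ⟨-, a2, a3⟩ := openTriangle_fubini h1
  obtain ⟨-, b2, b3⟩ := openTriangle_fubini h2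
  -- `integral_primitive_mul` on almost every line, multiplied by the weight `wt`, which is constant
  -- along it.
  have key : ∀ᵐ y : ℝ, y ∈ Set.Ioo (0 : ℝ) 1 → b y * (P (0, y) * (1 - y) ^ a) * wt y =
      -(∫ x in (0 : ℝ)..(1 - y), k (x, y) * (P (x, y) * (1 - y - x) ^ a) * wt y) -
      (∫ x in (0 : ℝ)..(1 - y), f (x, y) * (((1 - y - x) * P' (x, y) - a * P (x, y)) *
        (1 - y - x) ^ (a - 1)) * wt y) := by
    filter_upwards [hint, hb] with y c1 c2 hy
    have hL : 0 < 1 - y := by linarith [hy.2]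
    have c3 := (integral_primitive_mul hL ha (hk.comp (by fun_prop : Measurable fun x : ℝ => (x, y)))
      (c1 hy) (fun x => hP x y) (hP'.comp (by fun_prop)) (b y)).2
    have c4 : ∫ x in (0 : ℝ)..(1 - y), f (x, y) * (((1 - y - x) * P' (x, y) - a * P (x, y)) *
        (1 - y - x) ^ (a - 1)) = ∫ x in (0 : ℝ)..(1 - y), (b y + ∫ ξ in (0 : ℝ)..x, k (ξ, y)) *
        (((1 - y - x) * P' (x, y) - a * P (x, y)) * (1 - y - x) ^ (a - 1)) := by
      rw [intervalIntegral.integral_of_le hL.le, intervalIntegral.integral_of_le hL.le,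
        integral_Ioc_eq_integral_Ioo, integral_Ioc_eq_integral_Ioo]
      refine integral_congr_ae ((ae_restrict_iff' measurableSet_Ioo).mpr ?_)
      filter_upwards [c2 hy] with x hx hx'
      simp only [hx hx']
    rw [intervalIntegral.integral_mul_const, intervalIntegral.integral_mul_const, c4]
    simp only [Function.comp_def] at c3
    linear_combination wt y * c3
  -- Nothing is known about the measurability of b; the boundary integrand is integrable because it
  -- agrees almost everywhere with two Fubini integrals.
  have key' : ∀ᵐ y : ℝ, y ∈ Set.uIoc (0 : ℝ) 1 →
      -(∫ x in (0 : ℝ)..(1 - y), k (x, y) * (P (x, y) * (1 - y - x) ^ a) * wt y) -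
      (∫ x in (0 : ℝ)..(1 - y), f (x, y) * (((1 - y - x) * P' (x, y) - a * P (x, y)) *
        (1 - y - x) ^ (a - 1)) * wt y) = b y * (P (0, y) * (1 - y) ^ a) * wt y := by
    have hne : ∀ᵐ y : ℝ, y ≠ 1 := by simp [ae_iff, measure_singleton]
    filter_upwards [key, hne] with y hy h1 hy'
    rw [Set.uIoc_of_le zero_le_one] at hy'
    exact (hy ⟨hy'.1, lt_of_le_of_ne hy'.2 h1⟩).symm
  refine ⟨(a2.neg.sub b2).congr_ae ((ae_restrict_iff' measurableSet_uIoc).mpr key'), ?_⟩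
  have e := intervalIntegral.integral_sub a2.neg b2
  simp only [Pi.neg_apply, intervalIntegral.integral_neg] at e
  rw [a3, b3, ← intervalIntegral.integral_congr_ae key', e]
  ring

/-- The trace is the limit at the edge, if there is one. -/
theorem trace_eq_of_tendsto {f k f' : ℝ × ℝ → ℝ} {b u : ℝ → ℝ} {a r : ℝ} (hr : 0 < r)
    (hint : ∀ᵐ y : ℝ, y ∈ Set.Ioo (0 : ℝ) 1 →
      IntegrableOn (fun x => k (x, y) * (1 - y - x) ^ a) (Set.Ioo 0 (1 - y)))
    (hb : ∀ᵐ y : ℝ, y ∈ Set.Ioo (0 : ℝ) 1 →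
      ∀ᵐ x : ℝ, x ∈ Set.Ioo 0 (1 - y) → f (x, y) = b y + ∫ ξ in (0 : ℝ)..x, k (ξ, y))
    (hf : ∀ᵐ q : ℝ × ℝ, q ∈ openTriangle → q.1 < r → f q = f' q)
    (hu : ∀ y ∈ Set.Ioo (0 : ℝ) 1, Tendsto (fun x => f' (x, y)) (𝓝[>] 0) (𝓝 (u y))) :
    ∀ᵐ y : ℝ, y ∈ Set.Ioo (0 : ℝ) 1 → b y = u y := by
  filter_upwards [hint, hb, ae_ae_swap hf] with y h1 h2 h3 hy
  have hL : 0 < 1 - y := by linarith [hy.2]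
  have i1 := intervalIntegrable_of_mul_sub_rpow (h1 hy) ⟨le_rfl, hL⟩
    (⟨by linarith, by linarith⟩ : (1 - y) / 2 ∈ Set.Ico 0 (1 - y))
  have t1 := (tendsto_intervalIntegral_zero (by linarith) i1).const_add (b y)
  rw [add_zero] at t1
  refine eq_of_tendsto_of_ae_eq (r := min r (1 - y)) (lt_min hr hL) t1 (hu y hy) ?_
  filter_upwards [h2 hy, h3] with x h4 h5 hx
  have hx' : x ∈ Set.Ioo 0 (1 - y) := ⟨hx.1, hx.2.trans_le (min_le_right _ _)⟩
  rw [← h4 hx', h5 ((mem_openTriangle_iff hy).mpr hx') (hx.2.trans_le (min_le_left _ _))]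

/-! ### The precise representative -/

/-- `f` agrees near the point `p` of the triangle with a function that tends to `a` at `p`. -/
def HasTrace (f : ℝ × ℝ → ℝ) (p : ℝ × ℝ) (a : ℝ) : Prop :=
  ∃ (f' : ℝ × ℝ → ℝ) (U : Set (ℝ × ℝ)), U ∈ 𝓝 p ∧
    (∀ᵐ q ∂volume.restrict openTriangle, q ∈ U → f q = f' q) ∧
      Tendsto f' (𝓝[openTriangle] p) (𝓝 a)

theorem HasTrace.congr {f k : ℝ × ℝ → ℝ} {p : ℝ × ℝ} {a : ℝ} (h : HasTrace f p a)
    (hk : f =ᵐ[volume.restrict openTriangle] k) : HasTrace k p a := by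
  obtain ⟨f', U, hU, hf, ht⟩ := h
  refine ⟨f', U, hU, ?_, ht⟩
  filter_upwards [hf, hk] with q h1 h2
  rw [← h2]; exact h1

theorem HasTrace.comp_symm {A : ℝ × ℝ → ℝ × ℝ} {L : (ℝ × ℝ) →L[ℝ] (ℝ × ℝ)}
    (hA : IsTriangleSymm A L) {f : ℝ × ℝ → ℝ} {p : ℝ × ℝ} {a : ℝ} (h : HasTrace f (A p) a) :
    HasTrace (fun q => f (A q)) p a := by
  obtain ⟨f', U, hU, hf, ht⟩ := h
  refine ⟨fun q => f' (A q), A ⁻¹' U, hA.continuous.continuousAt hU, hA.ae_comp hf, ?_⟩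
  refine ht.comp (tendsto_nhdsWithin_iff.mpr ⟨hA.continuous.continuousAt.mono_left
    nhdsWithin_le_nhds, ?_⟩)
  filter_upwards [self_mem_nhdsWithin] with q hq
  exact (hA.mem_iff q).mpr hq

theorem hasTrace_of_continuous {f : ℝ × ℝ → ℝ} (h : Continuous f) (p : ℝ × ℝ) :
    HasTrace f p (f p) :=
  ⟨f, Set.univ, univ_mem, Eventually.of_forall fun _ _ => rfl,
    (h.tendsto p).mono_left nhdsWithin_le_nhds⟩

/-- On a small ball f lies almost everywhere in a closed interval around a, and an average stays in
a closed convex set. -/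
theorem HasTrace.pval_eq {f : ℝ × ℝ → ℝ} {p : ℝ × ℝ} {a : ℝ} (h : HasTrace f p a)
    (hp : p ∈ triangle) (hfm : AEStronglyMeasurable f (volume.restrict openTriangle)) :
    pval f p = a := by
  obtain ⟨f', U, hU, hf, h⟩ := h
  rw [ae_restrict_iff' measurableSet_openTriangle] at hf
  refine Tendsto.limUnder_eq ?_
  rw [Metric.tendsto_nhds]
  intro ε hε
  have h1 : ∀ᶠ q in 𝓝[openTriangle] p, dist (f' q) a < ε / 2 :=
    (Metric.tendsto_nhds.mp h) _ (by linarith)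
  rw [eventually_nhdsWithin_iff] at h1
  obtain ⟨δ, hδ, h2⟩ := Metric.eventually_nhds_iff_ball.mp (h1.and hU)
  filter_upwards [Ioo_mem_nhdsGT hδ] with r hr
  set S := Metric.ball p r ∩ triangle with hS
  have hSm : MeasurableSet S := measurableSet_ball.inter measurableSet_triangle
  have hfin : volume S ≠ (⊤ : ℝ≥0∞) :=
    ((measure_mono Set.inter_subset_left).trans_lt measure_ball_lt_top).ne
  have : IsFiniteMeasure (volume.restrict S) := ⟨by
    rw [Measure.restrict_apply_univ]; exact hfin.lt_top⟩
  have hpos : volume S ≠ 0 := by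
    obtain ⟨q, hq1, hq2⟩ := mem_closure_iff.mp (triangle_subset_closure hp) _
      Metric.isOpen_ball (Metric.mem_ball_self hr.1)
    have ho : IsOpen (Metric.ball p r ∩ openTriangle) := Metric.isOpen_ball.inter isOpen_openTriangle
    have := ho.measure_pos volume ⟨q, hq1, hq2⟩
    exact (this.trans_le (measure_mono (Set.inter_subset_inter_right _
      openTriangle_subset_triangle))).ne'
  have hae : ∀ᵐ q ∂volume.restrict S, f q ∈ Metric.closedBall a (ε / 2) := by
    have h3 : ∀ᵐ q ∂volume.restrict triangle, q ∈ openTriangle ∧ (q ∈ U → f q = f' q) := by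
      rw [restrict_triangle, ae_restrict_iff' measurableSet_openTriangle]
      filter_upwards [hf] with q hq hqT
      exact ⟨hqT, hq hqT⟩
    have h4 := ae_restrict_of_ae_restrict_of_subset (Set.inter_subset_right : S ⊆ triangle) h3
    filter_upwards [h4, ae_restrict_mem hSm] with q hq hqS
    have h5 := h2 q (Metric.ball_subset_ball hr.2.le hqS.1)
    rw [Metric.mem_closedBall, hq.2 h5.2]
    exact (h5.1 hq.1).le
  have hfi : IntegrableOn f S := by
    rw [← restrict_triangle] at hfm
    have hfS : AEStronglyMeasurable f (volume.restrict S) :=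
      hfm.mono_measure (Measure.restrict_mono_set _ Set.inter_subset_right)
    refine (integrable_const (μ := volume.restrict S) (|a| + ε / 2)).mono' hfS ?_
    filter_upwards [hae] with q hq
    rw [Metric.mem_closedBall, Real.dist_eq] at hq
    have := abs_add_le a (f q - a)
    rw [add_sub_cancel] at this
    rw [Real.norm_eq_abs]; linarith
  have := (convex_closedBall a (ε / 2)).set_average_mem Metric.isClosed_closedBall hpos hfin hae hfi
  rw [Metric.mem_closedBall] at this
  linarith

/-! ### Integrability with powers of the distance to the oblique edge -/

theorem integrable_mul_ev_of_memLp {g : ℝ} (hg : -1 < g) {f : ℝ × ℝ → ℝ}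
    (hf : MemLp f 2 (triMeasure 0 0 g)) (p : MvPolynomial (Fin 2) ℝ) :
    Integrable (fun q => f q * ev p q) (triMeasure 0 0 g) :=
  hf.integrable_mul (memLp_ev hg p)

theorem integrableOn_mul_rpow_of_memLp {g : ℝ} (hg : -1 < g) {f : ℝ × ℝ → ℝ}
    (hf : MemLp f 2 (triMeasure 0 0 g)) :
    IntegrableOn (fun q => f q * (1 - q.1 - q.2) ^ g) openTriangle := by
  have := integrable_mul_ev_of_memLp hg hf 1
  rw [integrable_triMeasure_iff] at this
  simpa using this

theorem integrableOn_mul_ev {a : ℝ} {f : ℝ × ℝ → ℝ}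
    (hf : IntegrableOn (fun q => f q * (1 - q.1 - q.2) ^ a) openTriangle)
    (p : MvPolynomial (Fin 2) ℝ) :
    IntegrableOn (fun q => f q * ev p q * (1 - q.1 - q.2) ^ a) openTriangle := by
  obtain ⟨M, -, hM⟩ := exists_abs_ev_le p
  have : IntegrableOn (fun q => f q * (1 - q.1 - q.2) ^ a * ev p q) openTriangle := by
    refine Integrable.mul_bdd (c := M) hf (continuous_ev p).aestronglyMeasurable ?_
    refine (ae_restrict_iff' measurableSet_openTriangle).mpr (Eventually.of_forall fun q hq => ?_)
    exact hM q (openTriangle_subset_triangle hq)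
  refine this.congr_fun (fun q _ => ?_) measurableSet_openTriangle
  simp only; ring

theorem integrableOn_rpow_add_one {a : ℝ} {f : ℝ × ℝ → ℝ}
    (hf : IntegrableOn (fun q => f q * (1 - q.1 - q.2) ^ a) openTriangle) :
    IntegrableOn (fun q => f q * (1 - q.1 - q.2) ^ (a + 1)) openTriangle := by
  refine (integrableOn_mul_ev hf pz).congr_fun (fun q hq => ?_) measurableSet_openTriangle
  have hz : 0 < 1 - q.1 - q.2 := by linarith [hq.2.2]
  simp only [pz, ev_sub, ev_one, ev_px, ev_py]
  rw [Real.rpow_add_one hz.ne']; ring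

/-- By 2st ≤ s² + t², the function |h|z^(g+1) is dominated by h²z^(g+2) + z^g, and both are
integrable. -/
theorem integrableOn_rpow_of_memLp_add_two {g : ℝ} (hg : -1 < g) {h : ℝ × ℝ → ℝ}
    (hh : MemLp h 2 (triMeasure 0 0 (g + 2))) (hm : Measurable h) :
    IntegrableOn (fun q => h q * (1 - q.1 - q.2) ^ (g + 1)) openTriangle := by
  have h1 := hh.integrable_sq
  rw [integrable_triMeasure_iff] at h1
  refine Integrable.mono' (h1.add (integrableOn_rpow_z hg))
    (hm.mul (measurable_rpow_z _)).aestronglyMeasurable ?_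
  refine (ae_restrict_iff' measurableSet_openTriangle).mpr (Eventually.of_forall fun q hq => ?_)
  have hz : 0 < 1 - q.1 - q.2 := by linarith [hq.2.2]
  have e1 : (1 - q.1 - q.2) ^ (g + 1) = (1 - q.1 - q.2) ^ g * (1 - q.1 - q.2) :=
    Real.rpow_add_one hz.ne' _
  have e2 : (1 - q.1 - q.2) ^ (g + 2) = (1 - q.1 - q.2) ^ g * (1 - q.1 - q.2) ^ 2 := by
    rw [Real.rpow_add hz, Real.rpow_two]
  have hp := Real.rpow_nonneg hz.le g
  rw [Real.norm_eq_abs, abs_mul, Pi.add_apply, e1, e2, abs_mul, abs_of_nonneg hp,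
    abs_of_pos hz, ← sq_abs (h q)]
  nlinarith [mul_nonneg hp (sq_nonneg (|h q| * (1 - q.1 - q.2) - 1)), mul_nonneg hp
    (sq_nonneg (|h q| * (1 - q.1 - q.2)))]

theorem ae_integrableOn_line {a : ℝ} {k : ℝ × ℝ → ℝ}
    (hk : IntegrableOn (fun q => k q * (1 - q.1 - q.2) ^ a) openTriangle) :
    ∀ᵐ y : ℝ, y ∈ Set.Ioo (0 : ℝ) 1 →
      IntegrableOn (fun x => k (x, y) * (1 - y - x) ^ a) (Set.Ioo 0 (1 - y)) := by
  filter_upwards [(openTriangle_fubini hk).1] with y h hy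
  have := (intervalIntegrable_iff_integrableOn_Ioo_of_le (by linarith [hy.2])).mp (h hy)
  simpa only [sub_right_comm] using this

/-- Integration by parts with a boundary term on the edge `x = 0`. -/
theorem trace_ibp {g : ℝ} (hg : -1 < g) {f k : ℝ × ℝ → ℝ} {b : ℝ → ℝ} (hkm : Measurable k)
    (hk : IntegrableOn (fun q => k q * (1 - q.1 - q.2) ^ (g + 1)) openTriangle)
    (hf : IntegrableOn (fun q => f q * (1 - q.1 - q.2) ^ g) openTriangle)
    (hb : ∀ᵐ y : ℝ, y ∈ Set.Ioo (0 : ℝ) 1 →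
      ∀ᵐ x : ℝ, x ∈ Set.Ioo 0 (1 - y) → f (x, y) = b y + ∫ ξ in (0 : ℝ)..x, k (ξ, y))
    (p : MvPolynomial (Fin 2) ℝ) :
    IntervalIntegrable (fun y => b y * ev p (0, y) * (1 - y) ^ (g + 1)) volume 0 1 ∧
    (∫ q in openTriangle, k q * ev p q * (1 - q.1 - q.2) ^ (g + 1)) +
      (∫ q in openTriangle, f q * ev (pz * D₁ p - MvPolynomial.C (g + 1) * p) q *
        (1 - q.1 - q.2) ^ g) +
      (∫ y in (0 : ℝ)..1, b y * ev p (0, y) * (1 - y) ^ (g + 1)) = 0 := by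
  have e1 : ∀ q : ℝ × ℝ, k q * (ev p q * (1 - q.2 - q.1) ^ (g + 1)) * 1 =
      k q * ev p q * (1 - q.1 - q.2) ^ (g + 1) := fun q => by
    rw [sub_right_comm]; ring
  have e2 : ∀ q : ℝ × ℝ, f q * (((1 - q.2 - q.1) * ev (D₁ p) q - (g + 1) * ev p q) *
      (1 - q.2 - q.1) ^ (g + 1 - 1)) * 1 =
      f q * ev (pz * D₁ p - MvPolynomial.C (g + 1) * p) q * (1 - q.1 - q.2) ^ g := fun q => by
    simp only [ev_sub, ev_mul, ev_C, pz, ev_one, ev_px, ev_py, add_sub_cancel_right]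
    rw [sub_right_comm]; ring
  have e3 : ∀ y, b y * (ev p (0, y) * (1 - y) ^ (g + 1)) * 1 =
      b y * ev p (0, y) * (1 - y) ^ (g + 1) := fun y => by ring
  have := horizontal_ibp (f := f) (b := b) hkm (a := g + 1) (by linarith) (ae_integrableOn_line hk)
    hb (P := ev p) (P' := ev (D₁ p)) (fun x y => ?_) (continuous_ev _) (fun _ => 1) ?_ ?_
  · simp only [e1, e2, e3] at this
    exact this
  · refine (hasDerivAt_ev_comp p (hasDerivAt_id x) (hasDerivAt_const x y)).congr_deriv ?_
    simp
  · simp only [e1]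
    exact integrableOn_mul_ev hk p
  · simp only [e2]
    exact integrableOn_mul_ev hf _

/-! ### The continuous representative near the edge -/

/-- Rescaling to a fixed interval of integration turns the primitive into a parameter integral. -/
theorem measurable_primitive {k : ℝ × ℝ → ℝ} (hk : Measurable k) (c : ℝ) :
    Measurable fun q : ℝ × ℝ => ∫ ξ in c..q.1, k (ξ, q.2) := by
  have e : (fun q : ℝ × ℝ => ∫ ξ in c..q.1, k (ξ, q.2)) = fun q : ℝ × ℝ =>
      (q.1 - c) * ∫ s in Set.Ioc (0 : ℝ) 1, k (c + (q.1 - c) * s, q.2) := by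
    ext q
    rw [← intervalIntegral.integral_of_le zero_le_one,
      intervalIntegral.mul_integral_comp_add_mul (f := fun ξ => k (ξ, q.2))]
    simp
  rw [e]
  refine Measurable.mul (by fun_prop) ?_
  refine (StronglyMeasurable.integral_prod_right (f := fun (q : ℝ × ℝ) (s : ℝ) =>
    k (c + (q.1 - c) * s, q.2)) (Measurable.stronglyMeasurable ?_)).measurable
  exact hk.comp (by fun_prop)

/-- On the rectangle z ≥ 1 - x - y > 0, so the weight is bounded below. -/
theorem integrable_rectangle {a : ℝ} (ha : 0 ≤ a) {h : ℝ × ℝ → ℝ} (hm : Measurable h)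
    (hh : IntegrableOn (fun q => h q * (1 - q.1 - q.2) ^ a) openTriangle) {x y : ℝ}
    (hxy : x + y < 1) :
    Integrable h ((volume.restrict (Set.Ioc 0 x)).prod (volume.restrict (Set.Ioc 0 y))) := by
  rw [Measure.prod_restrict, ← Measure.volume_eq_prod]
  have hS : MeasurableSet (Set.Ioc 0 x ×ˢ Set.Ioc 0 y) := measurableSet_Ioc.prod measurableSet_Ioc
  have hsub : Set.Ioc 0 x ×ˢ Set.Ioc 0 y ⊆ openTriangle := fun q hq =>
    ⟨hq.1.1, hq.2.1, by linarith [hq.1.2, hq.2.2]⟩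
  refine Integrable.mono' ((hh.mono_set hsub).norm.const_mul ((1 - x - y) ^ (-a)))
    hm.aestronglyMeasurable ?_
  refine (ae_restrict_iff' hS).mpr (Eventually.of_forall fun q hq => ?_)
  have hz0 : 0 < 1 - x - y := by linarith
  have hzz : 1 - x - y ≤ 1 - q.1 - q.2 := by linarith [hq.1.2, hq.2.2]
  have hz : 0 < 1 - q.1 - q.2 := by linarith
  rw [norm_mul, Real.norm_of_nonneg (Real.rpow_nonneg hz.le a)]
  have h1 : (1 - q.1 - q.2) ^ (-a) ≤ (1 - x - y) ^ (-a) :=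
    Real.rpow_le_rpow_of_nonpos hz0 hzz (by linarith)
  have h2 : (1 - q.1 - q.2) ^ (-a) * (1 - q.1 - q.2) ^ a = 1 := by
    rw [← Real.rpow_add hz, neg_add_cancel, Real.rpow_zero]
  calc ‖h q‖ = ‖h q‖ * ((1 - q.1 - q.2) ^ (-a) * (1 - q.1 - q.2) ^ a) := by rw [h2, mul_one]
    _ ≤ ‖h q‖ * ((1 - x - y) ^ (-a) * (1 - q.1 - q.2) ^ a) := by
      gcongr
    _ = _ := by ring

/-- A double integral over a thin rectangle at the edge is small. -/
theorem abs_integral_rectangle_le {h : ℝ × ℝ → ℝ} {x y₀ y Y : ℝ} (hx : 0 ≤ x)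
    (hy₀ : y₀ ∈ Set.Icc 0 Y) (hy : y ∈ Set.Icc 0 Y)
    (hi : Integrable h ((volume.restrict (Set.Ioc 0 x)).prod (volume.restrict (Set.Ioc 0 Y)))) :
    |∫ η in y₀..y, ∫ ξ in (0 : ℝ)..x, h (ξ, η)| ≤
      ∫ ξ in (0 : ℝ)..x, ∫ η in Set.Ioc 0 Y, ‖h (ξ, η)‖ := by
  have hsub : Set.uIoc y₀ y ⊆ Set.Ioc 0 Y := by
    intro t ht
    rw [Set.mem_uIoc] at ht
    rcases ht with ht | ht
    · exact ⟨hy₀.1.trans_lt ht.1, ht.2.trans hy.2⟩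
    · exact ⟨hy.1.trans_lt ht.1, ht.2.trans hy₀.2⟩
  have e1 : ∀ η, ∫ ξ in (0 : ℝ)..x, h (ξ, η) = ∫ ξ in Set.Ioc 0 x, h (ξ, η) := fun η =>
    intervalIntegral.integral_of_le hx
  have hi2 : IntegrableOn (fun η => ∫ ξ in Set.Ioc 0 x, ‖h (ξ, η)‖) (Set.Ioc 0 Y) :=
    hi.norm.integral_prod_right
  simp only [e1]
  calc |∫ η in y₀..y, ∫ ξ in Set.Ioc 0 x, h (ξ, η)|
      ≤ ∫ η in Set.uIoc y₀ y, ‖∫ ξ in Set.Ioc 0 x, h (ξ, η)‖ := by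
        rw [← Real.norm_eq_abs]
        exact intervalIntegral.norm_integral_le_integral_norm_uIoc
    _ ≤ ∫ η in Set.uIoc y₀ y, ∫ ξ in Set.Ioc 0 x, ‖h (ξ, η)‖ := by
        refine integral_mono_of_nonneg (Eventually.of_forall fun η => norm_nonneg _)
          (hi2.mono_set hsub) (Eventually.of_forall fun η => norm_integral_le_integral_norm _)
    _ ≤ ∫ η in Set.Ioc 0 Y, ∫ ξ in Set.Ioc 0 x, ‖h (ξ, η)‖ :=
        setIntegral_mono_set hi2 (Eventually.of_forall fun η =>
          integral_nonneg fun ξ => norm_nonneg _) (LE.le.eventuallyLE hsub)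
    _ = _ := by
        rw [intervalIntegral.integral_of_le hx]
        exact integral_integral_swap (f := fun η ξ => ‖h (ξ, η)‖) hi.norm.swap

/-- A function of Sobolev class is continuous up to the edge `x = 0`, off the vertex `(0, 1)`. -/
theorem exists_edge_rep {a : ℝ} (ha : 0 ≤ a) {F g₁ g₂ h : ℝ × ℝ → ℝ} {β : ℝ → ℝ}
    (mF : Measurable F) (m₁ : Measurable g₁) (m₂ : Measurable g₂) (mh : Measurable h)
    (mβ : Measurable β) (w₁ : IsWeakDeriv (1, 0) F g₁) (w₂ : IsWeakDeriv (0, 1) F g₂)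
    (i₁ : IntegrableOn (fun q => g₁ q * (1 - q.1 - q.2) ^ a) openTriangle)
    (ih : IntegrableOn (fun q => h q * (1 - q.1 - q.2) ^ a) openTriangle)
    (iβ : ∀ t ∈ Set.Ico (0 : ℝ) 1, IntervalIntegrable β volume 0 t)
    (hb : ∀ᵐ y : ℝ, y ∈ Set.Ioo (0 : ℝ) 1 →
      ∀ᵐ x : ℝ, x ∈ Set.Ioo 0 (1 - y) → g₂ (x, y) = β y + ∫ ξ in (0 : ℝ)..x, h (ξ, y)) :
    ∃ r > 0, ∃ c : ℝ, ∃ F' : ℝ × ℝ → ℝ,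
      (∀ᵐ q : ℝ × ℝ, q ∈ openTriangle → q.1 < r → F q = F' q) ∧
      ∀ t ∈ Set.Ico (0 : ℝ) 1,
        Tendsto F' (𝓝[openTriangle] (0, t)) (𝓝 (c + ∫ s in (0 : ℝ)..t, β s)) := by
  obtain ⟨b₂, hb₂⟩ := w₁.exists_trace mF m₁ (ae_integrableOn_line i₁)
  have hv := ((w₂.comp_symm isTriangleSymm_swap (v := (1, 0)) rfl).horizontal
    (mF.comp measurable_swap) (m₂.comp measurable_swap))
  have hv' : ∀ᵐ y : ℝ, ∀ᵐ x : ℝ, ∀ᵐ y' : ℝ, (x, y) ∈ openTriangle → (x, y') ∈ openTriangle →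
      F (x, y') - F (x, y) = ∫ η in y..y', g₂ (x, η) := by
    filter_upwards [Measure.ae_ae_of_ae_prod hv] with y h1
    filter_upwards [h1] with x h2
    filter_upwards [h2] with y' h3 h4 h5
    exact h3 ⟨h4.2.1, h4.1, by simp only; linarith [h4.2.2]⟩
      ⟨h5.2.1, h5.1, by simp only; linarith [h5.2.2]⟩
  have hprim := measurable_primitive mh 0
  -- The trace formula for g₂ with the quantifiers exchanged, so that it can be used on vertical
  -- lines.
  have hB : ∀ᵐ x : ℝ, ∀ᵐ y : ℝ, (x, y) ∈ openTriangle →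
      g₂ (x, y) = β y + ∫ ξ in (0 : ℝ)..x, h (ξ, y) := by
    have hS : MeasurableSet {q : ℝ × ℝ | (q.2, q.1) ∈ openTriangle →
        g₂ (q.2, q.1) = β q.1 + ∫ ξ in (0 : ℝ)..q.2, h (ξ, q.1)} := by
      have ms : Measurable fun q : ℝ × ℝ => (q.2, q.1) := measurable_swap
      refine MeasurableSet.imp (ms measurableSet_openTriangle)
        (measurableSet_eq_fun (m₂.comp ms) ((mβ.comp measurable_fst).add ?_))
      exact hprim.comp ms
    refine (Measure.ae_ae_comm hS).mp ?_
    filter_upwards [hb] with y h1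
    by_cases hy : y ∈ Set.Ioo (0 : ℝ) 1
    · filter_upwards [h1 hy] with x h2 hx
      exact h2 ((mem_openTriangle_iff hy).mp hx)
    · exact Eventually.of_forall fun x hx => absurd ⟨hx.2.1, by linarith [hx.1, hx.2.2]⟩ hy
  obtain ⟨y₀, hy₀, hA, hb₀, hi₀⟩ := exists_mem_Ioo_of_ae zero_lt_one
    (hv'.and (hb₂.and (ae_integrableOn_line i₁)))
  replace hb₀ := hb₀ hy₀
  replace hi₀ := hi₀ hy₀
  have hr : 0 < 1 - y₀ := by linarith [hy₀.2]
  -- F is recovered along a path: from the edge horizontally at one good height y₀, then vertically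
  -- to the point, with g₂ replaced by β + ∫h.
  set F' : ℝ × ℝ → ℝ := fun q => b₂ y₀ + (∫ ξ in (0 : ℝ)..q.1, g₁ (ξ, y₀)) +
    (∫ η in y₀..q.2, β η) + ∫ η in y₀..q.2, ∫ ξ in (0 : ℝ)..q.1, h (ξ, η) with hF'
  have mF' : Measurable F' := by
    have c1 : Measurable fun q : ℝ × ℝ => ∫ ξ in (0 : ℝ)..q.1, g₁ (ξ, y₀) :=
      (measurable_primitive m₁ 0).comp (by fun_prop : Measurable fun q : ℝ × ℝ => (q.1, y₀))
    have c2 : Measurable fun q : ℝ × ℝ => ∫ η in y₀..q.2, β η :=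
      (measurable_primitive (mβ.comp measurable_fst) y₀).comp measurable_swap
    have c3 : Measurable fun q : ℝ × ℝ => ∫ η in y₀..q.2, ∫ ξ in (0 : ℝ)..q.1, h (ξ, η) :=
      (measurable_primitive (hprim.comp measurable_swap) y₀).comp measurable_swap
    exact ((measurable_const.add c1).add c2).add c3
  refine ⟨1 - y₀, hr, b₂ y₀ + ∫ η in y₀..0, β η, F', ?_, ?_⟩
  · have hS : MeasurableSet {q : ℝ × ℝ | q ∈ openTriangle → q.1 < 1 - y₀ → F q = F' q} :=
      MeasurableSet.imp measurableSet_openTriangle (MeasurableSet.imp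
        (measurableSet_lt measurable_fst measurable_const) (measurableSet_eq_fun mF mF'))
    refine (Measure.ae_prod_iff_ae_ae hS).mpr ?_
    filter_upwards [hA, hb₀, hB] with x h1 h2 h3
    filter_upwards [h1] with y h4 h5 h6
    have hx0 : 0 < x := h5.1
    have e1 := h4 ⟨hx0, hy₀.1, by simp only; linarith⟩ h5
    have hmax : x + max y₀ y < 1 := by
      rcases max_choice y₀ y with h | h <;> rw [h]
      · linarith
      · exact h5.2.2
    have hsub : Set.uIoc y₀ y ⊆ Set.Ioc 0 (max y₀ y) := fun t ht =>
      ⟨(lt_min hy₀.1 h5.2.1).trans ht.1, ht.2⟩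
    have j1 : IntervalIntegrable β volume y₀ y :=
      (iβ y₀ ⟨hy₀.1.le, hy₀.2⟩).symm.trans (iβ y ⟨h5.2.1.le, by linarith [h5.2.2]⟩)
    have j2 : IntervalIntegrable (fun η => ∫ ξ in (0 : ℝ)..x, h (ξ, η)) volume y₀ y := by
      rw [intervalIntegrable_iff]
      have := (integrable_rectangle ha mh ih hmax).integral_prod_right
      simp only [intervalIntegral.integral_of_le hx0.le]
      exact IntegrableOn.mono_set this hsub
    have e2 : ∫ η in y₀..y, g₂ (x, η) = ∫ η in y₀..y, (β η + ∫ ξ in (0 : ℝ)..x, h (ξ, η)) := by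
      refine intervalIntegral.integral_congr_ae ?_
      filter_upwards [h3] with η h7 h8
      have := hsub h8
      exact h7 ⟨hx0, this.1, by simp only; linarith [this.2]⟩
    rw [e2, intervalIntegral.integral_add j1 j2] at e1
    have e3 := h2 ⟨hx0, h6⟩
    simp only [hF']
    linarith
  · intro t ht
    obtain ⟨Y, hY1, hY2⟩ := exists_between (max_lt ht.2 hy₀.2)
    have htY : t < Y := (le_max_left _ _).trans_lt hY1
    have hyY : y₀ < Y := (le_max_right _ _).trans_lt hY1
    have hY0 : 0 < Y := hy₀.1.trans hyY
    obtain ⟨x₁, hx₁, hx₁'⟩ := exists_between (sub_pos.mpr hY2)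
    have hfst : Tendsto (fun q : ℝ × ℝ => q.1) (𝓝[openTriangle] (0, t)) (𝓝[>] 0) := by
      refine tendsto_nhdsWithin_iff.mpr ⟨?_, eventually_mem_nhdsWithin.mono fun q hq => hq.1⟩
      exact (continuous_fst.tendsto (0, t)).mono_left nhdsWithin_le_nhds
    have hsnd : Tendsto (fun q : ℝ × ℝ => q.2) (𝓝[openTriangle] (0, t)) (𝓝 t) :=
      (continuous_snd.tendsto ((0 : ℝ), t)).mono_left nhdsWithin_le_nhds
    have hsndY : ∀ᶠ q in 𝓝[openTriangle] ((0 : ℝ), t), q.2 ∈ Set.Icc 0 Y := by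
      filter_upwards [hsnd.eventually_lt_const htY, self_mem_nhdsWithin] with q h1 h2
      exact ⟨h2.2.1.le, h1.le⟩
    have t1 : Tendsto (fun q : ℝ × ℝ => ∫ ξ in (0 : ℝ)..q.1, g₁ (ξ, y₀))
        (𝓝[openTriangle] (0, t)) (𝓝 0) := by
      refine (tendsto_intervalIntegral_zero (r := (1 - y₀) / 2) (by linarith) ?_).comp hfst
      exact intervalIntegrable_of_mul_sub_rpow hi₀ ⟨le_rfl, hr⟩ ⟨by linarith, by linarith⟩
    have t2 : Tendsto (fun q : ℝ × ℝ => ∫ η in y₀..q.2, β η)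
        (𝓝[openTriangle] (0, t)) (𝓝 (∫ η in y₀..t, β η)) := by
      have := intervalIntegral.continuousOn_primitive_interval' (iβ Y ⟨hY0.le, hY2⟩)
        (a := y₀) (by rw [Set.uIcc_of_le hY0.le]; exact ⟨hy₀.1.le, hyY.le⟩)
      have := this t (by rw [Set.uIcc_of_le hY0.le]; exact ⟨ht.1, htY.le⟩)
      refine Tendsto.comp this (tendsto_nhdsWithin_iff.mpr ⟨hsnd, ?_⟩)
      rw [Set.uIcc_of_le hY0.le]
      exact hsndY
    -- The double integral of h runs over a rectangle whose width tends to 0 and which stays away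
    -- from the oblique edge.
    have t3 : Tendsto (fun q : ℝ × ℝ => ∫ η in y₀..q.2, ∫ ξ in (0 : ℝ)..q.1, h (ξ, η))
        (𝓝[openTriangle] (0, t)) (𝓝 0) := by
      have hi := integrable_rectangle ha mh ih (by linarith : x₁ + Y < 1)
      have hk : IntervalIntegrable (fun ξ => ∫ η in Set.Ioc 0 Y, ‖h (ξ, η)‖) volume 0 x₁ := by
        rw [intervalIntegrable_iff_integrableOn_Ioc_of_le hx₁.le]
        exact hi.norm.integral_prod_left
      refine squeeze_zero_norm' ?_ ((tendsto_intervalIntegral_zero hx₁ hk).comp hfst)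
      filter_upwards [hsndY, hfst (Ioo_mem_nhdsGT hx₁)] with q h1 h2
      refine abs_integral_rectangle_le h2.1.le ⟨hy₀.1.le, hyY.le⟩ h1 ?_
      exact integrable_rectangle ha mh ih (by linarith [h2.2])
    have e : b₂ y₀ + (∫ η in y₀..0, β η) + ∫ s in (0 : ℝ)..t, β s =
        b₂ y₀ + 0 + (∫ η in y₀..t, β η) + 0 := by
      rw [add_zero, add_zero, add_assoc, intervalIntegral.integral_add_adjacent_intervals
        (iβ y₀ ⟨hy₀.1.le, hy₀.2⟩).symm (iβ t ht)]
    rw [e]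
    exact ((t1.const_add _).add t2).add t3

/-! ### Identities between a Sobolev function, its derivatives and its trace -/

/-- `g₁`, `g₂` are the first order weak derivatives of `F` and `h = ∂₁ ∂₂ F`, with the integrability
required by the approximation theorem. -/
structure IsSobolevFun (g : ℝ) (F g₁ g₂ h : ℝ × ℝ → ℝ) : Prop where
  weak₁ : IsWeakDeriv (1, 0) F g₁
  weak₂ : IsWeakDeriv (0, 1) F g₂
  weak₁₂ : IsWeakDeriv (1, 0) g₂ h
  memLp : MemLp F 2 (triMeasure 0 0 g)
  memLp₁ : MemLp g₁ 2 (triMeasure 0 0 g)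
  memLp₂ : MemLp g₂ 2 (triMeasure 0 0 g)
  memLp₁₂ : MemLp h 2 (triMeasure 0 0 (g + 2))

/-- The operator `(1 - x - y) ∂₂ - (g + 1)`. -/
def edgeOp (g : ℝ) (a : MvPolynomial (Fin 2) ℝ) : MvPolynomial (Fin 2) ℝ :=
  pz * D₂ a - MvPolynomial.C (g + 1) * a

/-- The operator `(1 - x - y) ∂₁ - (g + 1)`. -/
def lineOp (g : ℝ) (a : MvPolynomial (Fin 2) ℝ) : MvPolynomial (Fin 2) ℝ :=
  pz * D₁ a - MvPolynomial.C (g + 1) * a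

/-- The relations between a function `F`, its derivatives `v = ∂₃ F` and `h = ∂₁ ∂₂ F`, and its
trace `t ↦ c + ∫₀ᵗ β` on the edge `x = 0`. -/
structure TraceIdentities (g : ℝ) (F v h : ℝ × ℝ → ℝ) (β : ℝ → ℝ) (c : ℝ) : Prop where
  intervalIntegrable : IntervalIntegrable (fun t => β t * (1 - t) ^ (g + 1)) volume 0 1
  first : ∀ Y a : MvPolynomial (Fin 2) ℝ, (∀ t, ev (edgeOp g a) (0, t) = ev (py * Y) (0, t)) →
    (∫ q, F q * ev (D₃ (py * Y)) q ∂triMeasure 0 0 g) +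
      (∫ q, v q * ev (py * Y) q ∂triMeasure 0 0 g) +
      (∫ t in (0 : ℝ)..1, β t * ev a (0, t) * (1 - t) ^ (g + 1)) + c * ev a (0, 0) = 0
  second : ∀ φ a : MvPolynomial (Fin 2) ℝ,
    (∀ t, ev (edgeOp g a) (0, t) = ev (pz * lineOp (g + 1) φ) (0, t)) →
    (∫ q, h q * ev φ q ∂triMeasure 0 0 (g + 2)) +
      (∫ q, v q * ev (pz * lineOp (g + 1) φ) q ∂triMeasure 0 0 g) -
      (∫ q, F q * ev (lineOp g (lineOp (g + 1) φ)) q ∂triMeasure 0 0 g) +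
      (∫ t in (0 : ℝ)..1, β t * ev (pz * φ) (0, t) * (1 - t) ^ (g + 1)) +
      (∫ t in (0 : ℝ)..1, β t * ev a (0, t) * (1 - t) ^ (g + 1)) + c * ev a (0, 0) = 0

theorem IsSobolevFun.congr {g : ℝ} {F g₁ g₂ h F' g₁' g₂' h' : ℝ × ℝ → ℝ}
    (S : IsSobolevFun g F g₁ g₂ h) (hF : F =ᵐ[volume.restrict openTriangle] F')
    (h₁ : g₁ =ᵐ[volume.restrict openTriangle] g₁') (h₂ : g₂ =ᵐ[volume.restrict openTriangle] g₂')
    (hh : h =ᵐ[volume.restrict openTriangle] h') : IsSobolevFun g F' g₁' g₂' h' where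
  weak₁ := S.weak₁.congr hF h₁
  weak₂ := S.weak₂.congr hF h₂
  weak₁₂ := S.weak₁₂.congr h₂ hh
  memLp := S.memLp.ae_eq ((ae_triMeasure_iff g _).mpr hF)
  memLp₁ := S.memLp₁.ae_eq ((ae_triMeasure_iff g _).mpr h₁)
  memLp₂ := S.memLp₂.ae_eq ((ae_triMeasure_iff g _).mpr h₂)
  memLp₁₂ := S.memLp₁₂.ae_eq ((ae_triMeasure_iff (g + 2) _).mpr hh)

theorem TraceIdentities.congr {g : ℝ} {F v h F' v' h' : ℝ × ℝ → ℝ} {β : ℝ → ℝ} {c : ℝ}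
    (T : TraceIdentities g F v h β c) (hF : F =ᵐ[volume.restrict openTriangle] F')
    (hv : v =ᵐ[volume.restrict openTriangle] v') (hh : h =ᵐ[volume.restrict openTriangle] h') :
    TraceIdentities g F' v' h' β c := by
  have key : ∀ (r : ℝ) {f f' : ℝ × ℝ → ℝ}, f =ᵐ[volume.restrict openTriangle] f' →
      ∀ p : MvPolynomial (Fin 2) ℝ, ∫ q, f' q * ev p q ∂triMeasure 0 0 r =
        ∫ q, f q * ev p q ∂triMeasure 0 0 r := by
    intro r f f' hf p
    exact integral_congr_ae (((ae_triMeasure_iff r _).mpr hf).mono fun q hq => by simp only [hq])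
  refine ⟨T.intervalIntegrable, fun Y a h => ?_, fun φ a h => ?_⟩
  · rw [key g hF, key g hv]; exact T.first Y a h
  · rw [key g hF, key g hv, key _ hh]; exact T.second φ a h

theorem tendsto_line_nhdsWithin {y : ℝ} (hy : y ∈ Set.Ioo (0 : ℝ) 1) :
    Tendsto (fun x : ℝ => (x, y)) (𝓝[>] 0) (𝓝[openTriangle] (0, y)) := by
  refine tendsto_nhdsWithin_iff.mpr ⟨?_, ?_⟩
  · exact ((by fun_prop : Continuous fun x : ℝ => (x, y)).tendsto 0).mono_left nhdsWithin_le_nhds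
  · filter_upwards [Ioo_mem_nhdsGT (by linarith [hy.2] : (0 : ℝ) < 1 - y)] with x hx
    exact (mem_openTriangle_iff hy).mpr hx

theorem tendsto_diagonal_nhdsWithin {y : ℝ} (hy : y ∈ Set.Ioo (0 : ℝ) 1) :
    Tendsto (fun x : ℝ => refl₃ (x, y)) (𝓝[>] 0) (𝓝[openTriangle] (0, 1 - y)) := by
  refine tendsto_nhdsWithin_iff.mpr ⟨?_, ?_⟩
  · have := ((by fun_prop : Continuous fun x : ℝ => (x, 1 - x - y)).tendsto 0).mono_left
      (nhdsWithin_le_nhds (s := Set.Ioi 0))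
    rw [sub_zero] at this
    exact this
  · filter_upwards [Ioo_mem_nhdsGT (by linarith [hy.2] : (0 : ℝ) < 1 - y)] with x hx
    exact (isTriangleSymm_refl₃.mem_iff _).mpr ((mem_openTriangle_iff hy).mpr hx)

/-- Integration by parts along the lines parallel to the oblique edge. -/
theorem diagonal_ibp {g : ℝ} {F k F' : ℝ × ℝ → ℝ} {u : ℝ → ℝ} {r : ℝ} (mF : Measurable F)
    (mk : Measurable k) (w : IsWeakDeriv (1, -1) F k) (hr : 0 < r)
    (iF : IntegrableOn (fun q => F q * (1 - q.1 - q.2) ^ g) openTriangle)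
    (ik : IntegrableOn (fun q => k q * (1 - q.1 - q.2) ^ g) openTriangle)
    (hF : ∀ᵐ q : ℝ × ℝ, q ∈ openTriangle → q.1 < r → F q = F' q)
    (hu : ∀ t ∈ Set.Ico (0 : ℝ) 1, Tendsto F' (𝓝[openTriangle] (0, t)) (𝓝 (u t)))
    (Y : MvPolynomial (Fin 2) ℝ) :
    (∫ q in openTriangle, k q * ev (py * Y) q * (1 - q.1 - q.2) ^ g) -
      (∫ q in openTriangle, F q * ev (D₃ (py * Y)) q * (1 - q.1 - q.2) ^ g) +
      (∫ t in (0 : ℝ)..1, u t * ev (py * Y) (0, t) * (1 - t) ^ g) = 0 := by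
  have hA := isTriangleSymm_refl₃
  have mA : Measurable refl₃ := hA.continuous.measurable
  -- `refl₃` sends the direction (1, -1) to (1, 0), so oblique lines become horizontal ones.
  have w' := w.comp_symm hA (v := (1, 0)) (by simp)
  have iz : ∀ {f : ℝ × ℝ → ℝ},
      IntegrableOn (fun q => f q * (1 - q.1 - q.2) ^ g) openTriangle →
      IntegrableOn (fun q => f (refl₃ q) * q.2 ^ g) openTriangle := fun hf => by
    have := hA.integrableOn_comp hf
    simpa only [refl₃, sub_sub_cancel] using this
  -- After the reflection the weight z^g is y^g, constant on the line, and the factor y of the test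
  -- polynomial is 1 - x - y. Hence the exponent 1: this factor removes the boundary term on y = 0.
  have hint : ∀ᵐ y : ℝ, y ∈ Set.Ioo (0 : ℝ) 1 →
      IntegrableOn (fun x => k (refl₃ (x, y)) * (1 - y - x) ^ (1 : ℝ)) (Set.Ioo 0 (1 - y)) := by
    filter_upwards [(openTriangle_fubini (iz ik)).1] with y h1 hy
    have h2 := (h1 hy).mul_continuousOn (g := fun x => (1 - y - x) * y ^ (-g))
      (by fun_prop : Continuous fun x => (1 - y - x) * y ^ (-g)).continuousOn
    rw [intervalIntegrable_iff_integrableOn_Ioo_of_le (by linarith [hy.2])] at h2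
    refine h2.congr_fun (fun x _ => ?_) measurableSet_Ioo
    have h3 : y ^ g * y ^ (-g) = 1 := by
      rw [← Real.rpow_add hy.1, add_neg_cancel, Real.rpow_zero]
    simp only [Real.rpow_one]
    linear_combination (k (refl₃ (x, y)) * (1 - y - x)) * h3
  obtain ⟨b, hb⟩ := w'.exists_trace (mF.comp mA) (mk.comp mA) hint
  have hbu : ∀ᵐ y : ℝ, y ∈ Set.Ioo (0 : ℝ) 1 → b y = u (1 - y) := by
    refine trace_eq_of_tendsto (f := fun q => F (refl₃ q)) (k := fun q => k (refl₃ q))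
      (f' := fun q => F' (refl₃ q)) (u := fun y => u (1 - y)) hr hint hb ?_ fun y hy =>
      (hu (1 - y) ⟨by linarith [hy.2], by linarith [hy.1]⟩).comp (tendsto_diagonal_nhdsWithin hy)
    have h1 : ∀ᵐ q ∂volume.restrict openTriangle, q.1 < r → F q = F' q :=
      (ae_restrict_iff' measurableSet_openTriangle).mpr hF
    exact (ae_restrict_iff' measurableSet_openTriangle).mp (hA.ae_comp h1)
  have hb' : ∀ᵐ y : ℝ, y ∈ Set.Ioo (0 : ℝ) 1 →
      ∀ᵐ x : ℝ, x ∈ Set.Ioo 0 (1 - y) →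
        F (refl₃ (x, y)) = u (1 - y) + ∫ ξ in (0 : ℝ)..x, k (refl₃ (ξ, y)) := by
    filter_upwards [hb, hbu] with y h1 h2 hy
    rw [← h2 hy]; exact h1 hy
  have e1 : ∀ q : ℝ × ℝ, k (refl₃ q) * (ev Y (refl₃ q) * (1 - q.2 - q.1) ^ (1 : ℝ)) * q.2 ^ g =
      k (refl₃ q) * ev (py * Y) (refl₃ q) * (1 - (refl₃ q).1 - (refl₃ q).2) ^ g := fun q => by
    simp only [refl₃, sub_sub_cancel, ev_mul, ev_py, Real.rpow_one]
    ring
  have e2 : ∀ q : ℝ × ℝ, F (refl₃ q) * (((1 - q.2 - q.1) * (-ev (D₃ Y) (refl₃ q)) -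
      1 * ev Y (refl₃ q)) * (1 - q.2 - q.1) ^ ((1 : ℝ) - 1)) * q.2 ^ g =
      -(F (refl₃ q) * ev (D₃ (py * Y)) (refl₃ q) * (1 - (refl₃ q).1 - (refl₃ q).2) ^ g) :=
      fun q => by
    have e : D₃ (py * Y) = py * D₃ Y + Y := by simp [Derivation.leibniz, D₃_apply]
    rw [e]
    simp only [refl₃, sub_sub_cancel, ev_add, ev_mul, ev_py, sub_self, Real.rpow_zero]
    ring
  have i1 := hA.integrableOn_comp (integrableOn_mul_ev ik (py * Y))
  have i2 := hA.integrableOn_comp (integrableOn_mul_ev iF (D₃ (py * Y)))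
  have := horizontal_ibp (f := fun q => F (refl₃ q)) (k := fun q => k (refl₃ q))
    (b := fun y => u (1 - y)) (mk.comp mA) one_pos hint hb' (P := fun q => ev Y (refl₃ q))
    (P' := fun q => -ev (D₃ Y) (refl₃ q)) (fun x y => ?_)
    ((continuous_ev _).comp hA.continuous).neg (fun y => y ^ g) ?_ ?_
  · have h3 := this.2
    simp only [e1, e2] at h3
    rw [integral_neg, hA.setIntegral_comp (fun q => k q * ev (py * Y) q * (1 - q.1 - q.2) ^ g),
      hA.setIntegral_comp (fun q => F q * ev (D₃ (py * Y)) q * (1 - q.1 - q.2) ^ g)] at h3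
    have e3 := intervalIntegral.integral_comp_sub_left (a := 0) (b := 1)
      (fun t => u t * ev (py * Y) (0, t) * (1 - t) ^ g) 1
    simp only [sub_zero, sub_self, sub_sub_cancel] at e3
    have e4 : ∫ y in (0 : ℝ)..1, u (1 - y) * ev (py * Y) (0, 1 - y) * y ^ g =
        ∫ y in (0 : ℝ)..1, u (1 - y) * (ev Y (refl₃ (0, y)) * (1 - y) ^ (1 : ℝ)) * y ^ g := by
      refine intervalIntegral.integral_congr fun y _ => ?_
      simp only [refl₃, sub_zero, Real.rpow_one, ev_mul, ev_py]
      ring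
    rw [← e3, e4, sub_eq_add_neg]
    exact h3
  · refine (hasDerivAt_ev_comp Y (hasDerivAt_id x)
      (((hasDerivAt_const x (1 : ℝ)).sub (hasDerivAt_id x)).sub_const y)).congr_deriv ?_
    simp only [D₃_apply, ev_sub, refl₃, id, Pi.sub_apply]
    ring
  · simp only [e1]; exact i1
  · simp only [e2]; exact i2.neg

/-- Integrability of h gives ∂₂F a trace β, and F a trace u with u' = β. The identities combine four
integrations by parts: `J1` for ∂₂F and `J2` for F along x, `J3` for F along the oblique direction,
`J4` for u along the edge. The auxiliary polynomial a converts the integrals of u into integrals of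
β and the value c. -/
theorem exists_trace_identities_of_measurable {g : ℝ} (hg : -1 < g) {F g₁ g₂ h : ℝ × ℝ → ℝ}
    (S : IsSobolevFun g F g₁ g₂ h) (mF : Measurable F) (m₁ : Measurable g₁) (m₂ : Measurable g₂)
    (mh : Measurable h) :
    ∃ (β : ℝ → ℝ) (c : ℝ), TraceIdentities g F (fun q => g₂ q - g₁ q) h β c ∧
      ∀ t ∈ Set.Ico (0 : ℝ) 1, HasTrace F (0, t) (c + ∫ s in (0 : ℝ)..t, β s) := by
  have iF := integrableOn_mul_rpow_of_memLp hg S.memLp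
  have i1' := integrableOn_mul_rpow_of_memLp hg S.memLp₁
  have i2 := integrableOn_mul_rpow_of_memLp hg S.memLp₂
  have i1 := integrableOn_rpow_add_one i1'
  have ih := integrableOn_rpow_of_memLp_add_two hg S.memLp₁₂ mh
  obtain ⟨b, hb⟩ := S.weak₁₂.exists_trace m₂ mh (ae_integrableOn_line ih)
  have ib := (trace_ibp hg mh ih i2 hb 1).1
  simp only [ev_one, mul_one] at ib
  -- The weighted trace is integrable, hence measurable up to a null set; b may then be replaced by
  -- a measurable function.
  have hbm : AEStronglyMeasurable b (volume.restrict (Set.Ioo 0 1)) := by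
    have h1 := ((intervalIntegrable_iff_integrableOn_Ioo_of_le zero_le_one).mp ib).aestronglyMeasurable
    have h2 : Measurable fun t : ℝ => (1 - t) ^ (-(g + 1)) :=
      (measurable_const.sub measurable_id).pow_const _
    refine (h1.mul h2.aestronglyMeasurable).congr ?_
    refine (ae_restrict_iff' measurableSet_Ioo).mpr (Eventually.of_forall fun t ht => ?_)
    have hz : 0 < 1 - t := by linarith [ht.2]
    simp only [Pi.mul_apply]
    rw [mul_assoc, ← Real.rpow_add hz, add_neg_cancel, Real.rpow_zero, mul_one]
  set β := hbm.mk b with hβ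
  have mβ : Measurable β := hbm.stronglyMeasurable_mk.measurable
  have hbβ : ∀ᵐ t : ℝ, t ∈ Set.Ioo (0 : ℝ) 1 → b t = β t :=
    (ae_restrict_iff' measurableSet_Ioo).mp hbm.ae_eq_mk
  have hb' : ∀ᵐ y : ℝ, y ∈ Set.Ioo (0 : ℝ) 1 →
      ∀ᵐ x : ℝ, x ∈ Set.Ioo 0 (1 - y) → g₂ (x, y) = β y + ∫ ξ in (0 : ℝ)..x, h (ξ, y) := by
    filter_upwards [hb, hbβ] with y h1 h2 hy
    rw [← h2 hy]; exact h1 hy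
  have J1 := fun p => trace_ibp hg mh ih i2 hb' p
  have iβ : IntervalIntegrable (fun t => β t * (1 - t) ^ (g + 1)) volume 0 1 := by
    simpa only [ev_one, mul_one] using (J1 1).1
  have iβ' : IntegrableOn (fun t => β t * (1 - t) ^ (g + 1)) (Set.Ioo 0 1) :=
    (intervalIntegrable_iff_integrableOn_Ioo_of_le zero_le_one).mp iβ
  have iβ₀ : ∀ t ∈ Set.Ico (0 : ℝ) 1, IntervalIntegrable β volume 0 t := fun t ht =>
    intervalIntegrable_of_mul_sub_rpow iβ' ⟨le_rfl, one_pos⟩ ht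
  obtain ⟨r, hr, c, F', hF', hlim⟩ := exists_edge_rep (by linarith : 0 ≤ g + 1) mF m₁ m₂ mh mβ
    S.weak₁ S.weak₂ i1 ih iβ₀ hb'
  set u : ℝ → ℝ := fun t => c + ∫ s in (0 : ℝ)..t, β s with hu
  obtain ⟨b₂, hb₂⟩ := S.weak₁.exists_trace mF m₁ (ae_integrableOn_line i1)
  have hb₂u : ∀ᵐ y : ℝ, y ∈ Set.Ioo (0 : ℝ) 1 → b₂ y = u y :=
    trace_eq_of_tendsto hr (ae_integrableOn_line i1) hb₂ hF' fun y hy =>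
      (hlim y ⟨hy.1.le, hy.2⟩).comp (tendsto_line_nhdsWithin hy)
  have hb₂' : ∀ᵐ y : ℝ, y ∈ Set.Ioo (0 : ℝ) 1 →
      ∀ᵐ x : ℝ, x ∈ Set.Ioo 0 (1 - y) → F (x, y) = u y + ∫ ξ in (0 : ℝ)..x, g₁ (ξ, y) := by
    filter_upwards [hb₂, hb₂u] with y h1 h2 hy
    rw [← h2 hy]; exact h1 hy
  have J2 := fun p => (trace_ibp hg m₁ i1 iF hb₂' p).2
  have wk : IsWeakDeriv (1, -1) F (fun q => g₁ q + -1 * g₂ q) := by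
    have := S.weak₁.add_dir (S.weak₂.smul (-1))
    have e : ((1 : ℝ), (0 : ℝ)) + (-1 : ℝ) • ((0 : ℝ), (1 : ℝ)) = (1, -1) := by ext <;> simp
    rwa [e] at this
  have ik : IntegrableOn (fun q => (g₁ q + -1 * g₂ q) * (1 - q.1 - q.2) ^ g) openTriangle := by
    refine (i1'.sub i2).congr_fun (fun q _ => ?_) measurableSet_openTriangle
    simp only [Pi.sub_apply]; ring
  have mk : Measurable fun q => g₁ q + -1 * g₂ q := m₁.add (m₂.const_mul (-1))
  have J3 := fun Y => diagonal_ibp (u := u) mF mk wk hr iF ik hF' hlim Y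
  have J4 : ∀ a : MvPolynomial (Fin 2) ℝ,
      (∫ t in (0 : ℝ)..1, β t * ev a (0, t) * (1 - t) ^ (g + 1)) +
        (∫ t in (0 : ℝ)..1, u t * ev (edgeOp g a) (0, t) * (1 - t) ^ g) + c * ev a (0, 0) = 0 := by
    intro a
    have := (integral_primitive_mul (L := 1) (a := g + 1) one_pos (by linarith) mβ iβ'
      (p := fun t => ev a (0, t)) (p' := fun t => ev (D₂ a) (0, t)) (fun t => ?_)
      ((continuous_ev _).comp (by fun_prop)) c).2
    · have e1 : ∫ t in (0 : ℝ)..1, β t * ev a (0, t) * (1 - t) ^ (g + 1) =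
          ∫ t in (0 : ℝ)..1, β t * (ev a (0, t) * (1 - t) ^ (g + 1)) := by
        simp only [mul_assoc]
      have e2 : ∫ t in (0 : ℝ)..1, u t * ev (edgeOp g a) (0, t) * (1 - t) ^ g =
          ∫ t in (0 : ℝ)..1, (c + ∫ ξ in (0 : ℝ)..t, β ξ) *
            (((1 - t) * ev (D₂ a) (0, t) - (g + 1) * ev a (0, t)) * (1 - t) ^ (g + 1 - 1)) := by
        refine intervalIntegral.integral_congr fun t _ => ?_
        simp only [hu, edgeOp, ev_sub, ev_mul, ev_C, pz, ev_one, ev_px, ev_py, sub_zero,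
          add_sub_cancel_right]
        ring
      rw [Real.one_rpow, mul_one] at this
      rw [e1, e2]
      exact this
    · refine (hasDerivAt_ev_comp a (hasDerivAt_const t (0 : ℝ)) (hasDerivAt_id t)).congr_deriv ?_
      simp
  have iv : IntegrableOn (fun q => (g₂ q - g₁ q) * (1 - q.1 - q.2) ^ g) openTriangle := by
    refine (i2.sub i1').congr_fun (fun q _ => ?_) measurableSet_openTriangle
    simp only [Pi.sub_apply]; ring
  refine ⟨β, c, ⟨iβ, fun Y a hY => ?_, fun φ a hφ => ?_⟩, fun t ht => ?_⟩
  -- The first identity is `J4` minus `J3`, where the integrals of u cancel.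
  · rw [integral_triMeasure, integral_triMeasure]
    have h4 := J4 a
    simp only [hY] at h4
    have h3 := J3 Y
    have e : ∫ q in openTriangle, (g₁ q + -1 * g₂ q) * ev (py * Y) q * (1 - q.1 - q.2) ^ g =
        -∫ q in openTriangle, (g₂ q - g₁ q) * ev (py * Y) q * (1 - q.1 - q.2) ^ g := by
      rw [← integral_neg]
      exact setIntegral_congr_fun measurableSet_openTriangle fun q _ => by ring
    rw [e] at h3
    linarith
  · rw [integral_triMeasure, integral_triMeasure, integral_triMeasure]
    have h4 := J4 a
    simp only [hφ] at h4
    have h1 := (J1 (pz * φ)).2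
    have h2 := J2 (lineOp (g + 1) φ)
    have p1 : pz * D₁ (pz * φ) - MvPolynomial.C (g + 1) * (pz * φ) = pz * lineOp (g + 1) φ := by
      have : (MvPolynomial.C (g + 1 + 1) : MvPolynomial (Fin 2) ℝ) = MvPolynomial.C (g + 1) + 1 := by
        rw [MvPolynomial.C_add, MvPolynomial.C_1]
      rw [lineOp, this]
      simp only [pz, Derivation.leibniz, map_sub, smul_eq_mul, D₁_px, D₁_py,
        Derivation.map_one_eq_zero]
      ring
    rw [p1] at h1
    have e1 : ∫ q in openTriangle, h q * ev (pz * φ) q * (1 - q.1 - q.2) ^ (g + 1) =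
        ∫ q in openTriangle, h q * ev φ q * (1 - q.1 - q.2) ^ (g + 2) := by
      refine setIntegral_congr_fun measurableSet_openTriangle fun q hq => ?_
      have hz : 0 < 1 - q.1 - q.2 := by linarith [hq.2.2]
      have : g + 2 = g + 1 + 1 := by ring
      simp only [ev_mul, pz, ev_sub, ev_one, ev_px, ev_py]
      rw [this, Real.rpow_add_one hz.ne' (g + 1)]; ring
    -- ∂₂F = ∂₃F + ∂₁F: the first part is kept and the second is integrated by parts once more with
    -- `J2`.
    have e2 : ∫ q in openTriangle, g₂ q * ev (pz * lineOp (g + 1) φ) q * (1 - q.1 - q.2) ^ g =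
        (∫ q in openTriangle, (g₂ q - g₁ q) * ev (pz * lineOp (g + 1) φ) q *
          (1 - q.1 - q.2) ^ g) +
        ∫ q in openTriangle, g₁ q * ev (lineOp (g + 1) φ) q * (1 - q.1 - q.2) ^ (g + 1) := by
      rw [← integral_add (integrableOn_mul_ev iv _) (integrableOn_mul_ev i1 _)]
      refine setIntegral_congr_fun measurableSet_openTriangle fun q hq => ?_
      have hz : 0 < 1 - q.1 - q.2 := by linarith [hq.2.2]
      simp only [ev_mul, pz, ev_sub, ev_one, ev_px, ev_py]
      rw [Real.rpow_add_one hz.ne']; ring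
    have e3 : ∫ t in (0 : ℝ)..1, u t * ev (lineOp (g + 1) φ) (0, t) * (1 - t) ^ (g + 1) =
        ∫ t in (0 : ℝ)..1, u t * ev (pz * lineOp (g + 1) φ) (0, t) * (1 - t) ^ g := by
      rw [intervalIntegral.integral_of_le zero_le_one, intervalIntegral.integral_of_le zero_le_one,
        integral_Ioc_eq_integral_Ioo, integral_Ioc_eq_integral_Ioo]
      refine setIntegral_congr_fun measurableSet_Ioo fun t ht => ?_
      have hz : 0 < 1 - t := by linarith [ht.2]
      simp only [ev_mul, pz, ev_sub, ev_one, ev_px, ev_py]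
      rw [Real.rpow_add_one hz.ne']; ring
    rw [e1, e2] at h1
    rw [e3] at h2
    have e4 : ∫ q in openTriangle, F q * ev (pz * D₁ (lineOp (g + 1) φ) -
        MvPolynomial.C (g + 1) * lineOp (g + 1) φ) q * (1 - q.1 - q.2) ^ g =
        ∫ q in openTriangle, F q * ev (lineOp g (lineOp (g + 1) φ)) q * (1 - q.1 - q.2) ^ g := rfl
    rw [e4] at h2
    linarith
  · refine ⟨_, {q | q.1 < r}, (isOpen_lt continuous_fst continuous_const).mem_nhds hr, ?_, hlim t ht⟩
    exact (ae_restrict_iff' measurableSet_openTriangle).mpr hF'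

/-- A Sobolev function has an absolutely continuous trace on the edge `x = 0`. -/
theorem IsSobolevFun.exists_trace_identities {g : ℝ} (hg : -1 < g) {F g₁ g₂ h : ℝ × ℝ → ℝ}
    (S : IsSobolevFun g F g₁ g₂ h) :
    ∃ (β : ℝ → ℝ) (c : ℝ), TraceIdentities g F (fun q => g₂ q - g₁ q) h β c ∧
      ∀ t ∈ Set.Ico (0 : ℝ) 1, HasTrace F (0, t) (c + ∫ s in (0 : ℝ)..t, β s) := by
  obtain ⟨F', mF, hF⟩ := exists_measurable_ae_eq S.weak₁.1
  obtain ⟨g₁', m₁, h₁⟩ := exists_measurable_ae_eq S.weak₁.2.1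
  obtain ⟨g₂', m₂, h₂⟩ := exists_measurable_ae_eq S.weak₂.2.1
  obtain ⟨h', mh, hh⟩ := exists_measurable_ae_eq S.weak₁₂.2.1
  obtain ⟨β, c, T, hp⟩ :=
    exists_trace_identities_of_measurable hg (S.congr hF h₁ h₂ hh) mF m₁ m₂ mh
  refine ⟨β, c, T.congr hF.symm ?_ hh.symm, fun t ht => ?_⟩
  · filter_upwards [h₁, h₂] with q e1 e2
    rw [e1, e2]
  · exact (hp t ht).congr hF.symm

/-! ### Solving the equations for the test polynomials -/

theorem poly_induction {N : ℕ} {P : MvPolynomial (Fin 2) ℝ → Prop}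
    (mon : ∀ i j : ℕ, i + j ≤ N → P (px ^ i * py ^ j)) (add : ∀ p q, P p → P q → P (p + q))
    (smul : ∀ (a : ℝ) p, P p → P (MvPolynomial.C a * p)) {p : MvPolynomial (Fin 2) ℝ}
    (hp : p.totalDegree ≤ N) : P p := by
  have h0 : P 0 := by
    have := smul 0 _ (mon 0 0 (Nat.zero_le _))
    rwa [MvPolynomial.C_0, zero_mul] at this
  rw [MvPolynomial.as_sum p]
  refine Finset.sum_induction _ P (fun p q => add p q) h0 fun s hs => ?_
  have h1 := (MvPolynomial.le_totalDegree hs).trans hp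
  rw [Finsupp.sum_fintype _ _ fun _ => rfl, Fin.sum_univ_two] at h1
  rw [MvPolynomial.monomial_eq, Finsupp.prod_fintype _ _ fun _ => pow_zero _, Fin.prod_univ_two]
  exact smul _ _ (mon _ _ h1)

theorem totalDegree_monomial_le (i j : ℕ) :
    (px ^ i * py ^ j : MvPolynomial (Fin 2) ℝ).totalDegree ≤ i + j :=
  totalDegree_mul_le le_rfl (MvPolynomial.totalDegree_X_pow _ _).le
    (MvPolynomial.totalDegree_X_pow _ _).le

theorem C_inv_mul_cast (j : ℕ) : (MvPolynomial.C ((j : ℝ) + 1)⁻¹ * ((j : MvPolynomial (Fin 2) ℝ) + 1))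
    = 1 := by
  have : ((j : MvPolynomial (Fin 2) ℝ) + 1) = MvPolynomial.C ((j : ℝ) + 1) := by simp
  rw [this, ← MvPolynomial.C_mul, inv_mul_cancel₀ (by positivity), MvPolynomial.C_1]

/-- ∂₃(x^(i+1) y^(j+1)) is (j + 1)x^(i+1) y^j minus a multiple of x^i y^(j+1), so the power of x
decreases by induction. It makes every polynomial available in the identity `first`. -/
theorem exists_D₃_py_mul (i : ℕ) : ∀ j : ℕ, ∃ Y : MvPolynomial (Fin 2) ℝ,
    Y.totalDegree ≤ i + j ∧ D₃ (py * Y) = px ^ i * py ^ j := by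
  induction i with
  | zero =>
    intro j
    refine ⟨MvPolynomial.C ((j : ℝ) + 1)⁻¹ * py ^ j, ?_, ?_⟩
    · rw [zero_add]; exact totalDegree_C_mul_le _ (MvPolynomial.totalDegree_X_pow _ _).le
    · have e : py * (MvPolynomial.C ((j : ℝ) + 1)⁻¹ * py ^ j) =
          MvPolynomial.C ((j : ℝ) + 1)⁻¹ * py ^ (j + 1) := by ring
      rw [e, D₃_apply]
      simp only [Derivation.leibniz, Derivation.leibniz_pow, D₂_C, D₁_C, D₂_py, D₁_py, smul_eq_mul,
        nsmul_eq_mul, mul_zero, mul_one, add_zero, sub_zero, add_tsub_cancel_right, pow_zero,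
        one_mul]
      push_cast
      linear_combination py ^ j * C_inv_mul_cast j
  | succ i ih =>
    intro j
    obtain ⟨Y, hY, hD⟩ := ih (j + 1)
    refine ⟨MvPolynomial.C ((j : ℝ) + 1)⁻¹ *
      (px ^ (i + 1) * py ^ j + MvPolynomial.C ((i : ℝ) + 1) * Y), ?_, ?_⟩
    · exact totalDegree_C_mul_le _ (totalDegree_add_le (totalDegree_monomial_le _ _)
        (totalDegree_C_mul_le _ (hY.trans (by omega))))
    · have e : py * (MvPolynomial.C ((j : ℝ) + 1)⁻¹ *
          (px ^ (i + 1) * py ^ j + MvPolynomial.C ((i : ℝ) + 1) * Y)) =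
          MvPolynomial.C ((j : ℝ) + 1)⁻¹ *
            (px ^ (i + 1) * py ^ (j + 1) + MvPolynomial.C ((i : ℝ) + 1) * (py * Y)) := by ring
      have e2 : D₃ (px ^ (i + 1) * py ^ (j + 1)) =
          (j + 1) * (px ^ (i + 1) * py ^ j) - (i + 1) * (px ^ i * py ^ (j + 1)) := by
        rw [D₃_apply]
        simp only [Derivation.leibniz, Derivation.leibniz_pow, D₂_px, D₂_py, D₁_px, D₁_py,
          smul_eq_mul, nsmul_eq_mul, mul_zero, mul_one, add_zero, zero_add, add_tsub_cancel_right]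
        push_cast
        ring
      have e3 : MvPolynomial.C ((i : ℝ) + 1) = ((i : MvPolynomial (Fin 2) ℝ) + 1) := by simp
      rw [e, ← MvPolynomial.smul_eq_C_mul, Derivation.map_smul, map_add,
        ← MvPolynomial.smul_eq_C_mul (py * Y), Derivation.map_smul, hD, e2,
        MvPolynomial.smul_eq_C_mul, MvPolynomial.smul_eq_C_mul, e3]
      linear_combination (px ^ (i + 1) * py ^ j) * C_inv_mul_cast j

theorem ev_edgeOp (g : ℝ) (a : MvPolynomial (Fin 2) ℝ) (t : ℝ) :
    ev (edgeOp g a) (0, t) = (1 - t) * ev (D₂ a) (0, t) - (g + 1) * ev a (0, t) := by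
  simp [edgeOp]

/-- On the edge the operator sends t^j to j t^(j-1) - (j + g + 1)t^j: it is triangular with nonzero
diagonal since g > -1. Monomials containing x vanish on the edge. -/
theorem exists_edgeOp_eq {g : ℝ} (hg : -1 < g) {N : ℕ} {p : MvPolynomial (Fin 2) ℝ}
    (hp : p.totalDegree ≤ N) : ∃ a : MvPolynomial (Fin 2) ℝ, a.totalDegree ≤ N ∧
      ∀ t, ev (edgeOp g a) (0, t) = ev p (0, t) := by
  have hpow : ∀ j : ℕ, ∃ a : MvPolynomial (Fin 2) ℝ, a.totalDegree ≤ j ∧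
      ∀ t, ev (edgeOp g a) (0, t) = t ^ j := by
    intro j
    induction j with
    | zero =>
      have h1 : g + 1 ≠ 0 := by linarith
      refine ⟨MvPolynomial.C (-(g + 1)⁻¹), by simp, fun t => ?_⟩
      rw [ev_edgeOp]
      simp [h1]
    | succ j ih =>
      obtain ⟨a, ha, h⟩ := ih
      have h1 : (j : ℝ) + 1 + g + 1 ≠ 0 := by
        have : (0 : ℝ) ≤ j := Nat.cast_nonneg j
        linarith
      refine ⟨MvPolynomial.C (-((j : ℝ) + 1 + g + 1)⁻¹) *
        (py ^ (j + 1) - MvPolynomial.C ((j : ℝ) + 1) * a), ?_, fun t => ?_⟩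
      · exact totalDegree_C_mul_le _ (totalDegree_sub_le (MvPolynomial.totalDegree_X_pow _ _).le
          (totalDegree_C_mul_le _ (ha.trans (by omega))))
      · have h2 := h t
        rw [ev_edgeOp] at h2 ⊢
        simp only [Derivation.leibniz, Derivation.leibniz_pow, map_sub, D₂_C, D₂_py, smul_eq_mul,
          nsmul_eq_mul, mul_zero, mul_one, add_zero, add_tsub_cancel_right, ev_mul, ev_sub, ev_C,
          ev_pow, ev_py]
        have h3 : ev ((j + 1 : ℕ) : MvPolynomial (Fin 2) ℝ) (0, t) = (j : ℝ) + 1 := by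
          simp [ev]
        rw [h3]
        field_simp
        linear_combination ((j : ℝ) + 1) * h2
  refine poly_induction (P := fun p => ∃ a : MvPolynomial (Fin 2) ℝ, a.totalDegree ≤ N ∧
      ∀ t, ev (edgeOp g a) (0, t) = ev p (0, t)) ?_ ?_ ?_ hp
  · intro i j hij
    rcases Nat.eq_zero_or_pos i with rfl | hi
    · obtain ⟨a, ha, h⟩ := hpow j
      exact ⟨a, ha.trans (by omega), fun t => by rw [h]; simp⟩
    · refine ⟨0, by simp, fun t => ?_⟩
      rw [ev_edgeOp]
      simp [hi.ne']
  · rintro p q ⟨a, ha, h⟩ ⟨a', ha', h'⟩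
    refine ⟨a + a', totalDegree_add_le ha ha', fun t => ?_⟩
    rw [ev_add, ← h, ← h', ev_edgeOp, ev_edgeOp, ev_edgeOp, map_add, ev_add, ev_add]
    ring
  · rintro r p ⟨a, ha, h⟩
    refine ⟨MvPolynomial.C r * a, totalDegree_C_mul_le _ ha, fun t => ?_⟩
    rw [ev_mul, ev_C, ← h, ev_edgeOp, ev_edgeOp, ← MvPolynomial.smul_eq_C_mul, Derivation.map_smul,
      ev_smul, ev_smul]
    ring

theorem totalDegree_lineOp_le (g : ℝ) {N : ℕ} {p : MvPolynomial (Fin 2) ℝ}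
    (hp : p.totalDegree ≤ N) : (lineOp g p).totalDegree ≤ N := by
  refine totalDegree_sub_le ?_ (totalDegree_C_mul_le _ hp)
  rcases Nat.eq_zero_or_pos N with rfl | hN
  · rw [MvPolynomial.totalDegree_eq_zero_iff_eq_C.mp (Nat.le_zero.mp hp), D₁_C]
    simp
  · exact totalDegree_mul_le (by omega) totalDegree_pz_le (totalDegree_D₁_le hp)

/-! ### Orthogonality -/

/-- The Hilbert space form of `TraceIdentities`. -/
structure TraceVectors {g : ℝ} (hg : -1 < g) (hg' : -1 < g + 2) (e v : Lp ℝ 2 (triMeasure 0 0 g))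
    (h : Lp ℝ 2 (triMeasure 0 0 (g + 2))) (φ : MvPolynomial (Fin 2) ℝ →ₗ[ℝ] ℝ) (c : ℝ) : Prop where
  edge : ∀ p, (∀ t, ev p (0, t) = 0) → φ p = 0
  first : ∀ Y a : MvPolynomial (Fin 2) ℝ, (∀ t, ev (edgeOp g a) (0, t) = ev (py * Y) (0, t)) →
    inner ℝ e (toL2 hg (D₃ (py * Y))) + inner ℝ v (toL2 hg (py * Y)) + φ a + c * ev a (0, 0) = 0
  second : ∀ p a : MvPolynomial (Fin 2) ℝ,
    (∀ t, ev (edgeOp g a) (0, t) = ev (pz * lineOp (g + 1) p) (0, t)) →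
    inner ℝ h (toL2 hg' p) + inner ℝ v (toL2 hg (pz * lineOp (g + 1) p)) -
      inner ℝ e (toL2 hg (lineOp g (lineOp (g + 1) p))) + φ (pz * p) + φ a + c * ev a (0, 0) = 0

theorem TraceVectors.sub {g : ℝ} {hg : -1 < g} {hg' : -1 < g + 2}
    {e v e' v' : Lp ℝ 2 (triMeasure 0 0 g)} {h h' : Lp ℝ 2 (triMeasure 0 0 (g + 2))}
    {φ φ' : MvPolynomial (Fin 2) ℝ →ₗ[ℝ] ℝ} {c c' : ℝ} (T : TraceVectors hg hg' e v h φ c)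
    (T' : TraceVectors hg hg' e' v' h' φ' c') :
    TraceVectors hg hg' (e - e') (v - v') (h - h') (φ - φ') (c - c') where
  edge p hp := by rw [LinearMap.sub_apply, T.edge p hp, T'.edge p hp, sub_zero]
  first Y a ha := by
    have h1 := T.first Y a ha
    have h2 := T'.first Y a ha
    simp only [inner_sub_left, LinearMap.sub_apply]
    linarith
  second p a ha := by
    have h1 := T.second p a ha
    have h2 := T'.second p a ha
    simp only [inner_sub_left, LinearMap.sub_apply]
    linarith

/-- In `first` and `second` every term other than the one in question vanishes. The factors y and z
raise the degree by one, whence N + 1 against N. -/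
theorem TraceVectors.inner_eq_zero {g : ℝ} {hg : -1 < g} {hg' : -1 < g + 2}
    {e v : Lp ℝ 2 (triMeasure 0 0 g)} {h : Lp ℝ 2 (triMeasure 0 0 (g + 2))}
    {φ : MvPolynomial (Fin 2) ℝ →ₗ[ℝ] ℝ} {c : ℝ} (T : TraceVectors hg hg' e v h φ c) {N : ℕ}
    (hv : ∀ p : MvPolynomial (Fin 2) ℝ, p.totalDegree ≤ N + 1 → inner ℝ v (toL2 hg p) = 0)
    (hφ : ∀ p : MvPolynomial (Fin 2) ℝ, p.totalDegree ≤ N + 1 → φ p = 0) (hc : c = 0)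
    {p : MvPolynomial (Fin 2) ℝ} (hp : p.totalDegree ≤ N) :
    inner ℝ e (toL2 hg p) = 0 ∧ inner ℝ h (toL2 hg' p) = 0 := by
  have h1 : ∀ p : MvPolynomial (Fin 2) ℝ, p.totalDegree ≤ N → inner ℝ e (toL2 hg p) = 0 := by
    intro p hp
    refine poly_induction (P := fun p => inner ℝ e (toL2 hg p) = 0) ?_ ?_ ?_ hp
    · intro i j hij
      obtain ⟨Y, hY, hD⟩ := exists_D₃_py_mul i j
      have hYd : (py * Y).totalDegree ≤ N + 1 :=
        totalDegree_mul_le (n := 1) (by omega) (by simp) hY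
      obtain ⟨a, ha, hea⟩ := exists_edgeOp_eq hg hYd
      have := T.first Y a hea
      rw [hv _ hYd, hφ a ha, hc, hD] at this
      linarith
    · intro p q h1 h2
      rw [map_add, inner_add_right, h1, h2, add_zero]
    · intro a p h1
      rw [← MvPolynomial.smul_eq_C_mul, map_smul, inner_smul_right, h1, mul_zero]
  refine ⟨h1 p hp, ?_⟩
  have d1 := totalDegree_lineOp_le (g + 1) hp
  have d2 : (pz * lineOp (g + 1) p).totalDegree ≤ N + 1 :=
    totalDegree_mul_le (by omega) totalDegree_pz_le d1
  obtain ⟨a, ha, hea⟩ := exists_edgeOp_eq hg d2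
  have := T.second p a hea
  rw [hv _ d2, hφ a ha, hc, h1 _ (totalDegree_lineOp_le g d1),
    hφ _ (totalDegree_mul_le (by omega) totalDegree_pz_le hp)] at this
  linarith

/-! ### Telescoping sums in a Hilbert space -/

/-- Each index is within distance 2 of at most five indices, and 2|⟨a, b⟩| ≤ ‖a‖² + ‖b‖². -/
theorem norm_sum_sq_le_five {H : Type*} [NormedAddCommGroup H] [InnerProductSpace ℝ H] (Q : ℕ → H)
    (orth : ∀ i j, j + 3 ≤ i → inner ℝ (Q i) (Q j) = 0) (k : ℕ) :
    ‖∑ i ∈ Finset.range k, Q i‖ ^ 2 ≤ 5 * ∑ i ∈ Finset.range k, ‖Q i‖ ^ 2 := by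
  classical
  rw [← real_inner_self_eq_norm_sq, sum_inner]
  simp only [inner_sum]
  have h1 : ∀ i j : ℕ, inner ℝ (Q i) (Q j) ≤
      (if i < j + 3 ∧ j < i + 3 then ‖Q i‖ ^ 2 / 2 else 0) +
        (if j < i + 3 ∧ i < j + 3 then ‖Q j‖ ^ 2 / 2 else 0) := by
    intro i j
    by_cases h : i < j + 3 ∧ j < i + 3
    · rw [if_pos h, if_pos h.symm]
      have := real_inner_le_norm (Q i) (Q j)
      nlinarith [sq_nonneg (‖Q i‖ - ‖Q j‖)]
    · rw [if_neg h, if_neg fun h' => h h'.symm]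
      rcases not_and_or.mp h with h | h
      · rw [orth i j (by omega)]; simp
      · rw [real_inner_comm, orth j i (by omega)]; simp
  have h2 : ∑ i ∈ Finset.range k, ∑ j ∈ Finset.range k,
      (if i < j + 3 ∧ j < i + 3 then ‖Q i‖ ^ 2 / 2 else 0) ≤
        ∑ i ∈ Finset.range k, 5 * (‖Q i‖ ^ 2 / 2) := by
    refine Finset.sum_le_sum fun i _ => ?_
    rw [← Finset.sum_filter, Finset.sum_const, nsmul_eq_mul]
    refine mul_le_mul_of_nonneg_right ?_ (by positivity)
    have : ((Finset.range k).filter fun j => i < j + 3 ∧ j < i + 3).card ≤ 5 := by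
      refine (Finset.card_le_card (t := Finset.Ico (i - 2) (i + 3)) fun j hj => ?_).trans ?_
      · simp only [Finset.mem_filter] at hj
        simp only [Finset.mem_Ico]; omega
      · simp only [Nat.card_Ico]; omega
    exact_mod_cast this
  calc ∑ i ∈ Finset.range k, ∑ j ∈ Finset.range k, inner ℝ (Q i) (Q j)
      ≤ ∑ i ∈ Finset.range k, ∑ j ∈ Finset.range k,
        ((if i < j + 3 ∧ j < i + 3 then ‖Q i‖ ^ 2 / 2 else 0) +
          (if j < i + 3 ∧ i < j + 3 then ‖Q j‖ ^ 2 / 2 else 0)) :=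
        Finset.sum_le_sum fun i _ => Finset.sum_le_sum fun j _ => h1 i j
    _ ≤ ∑ i ∈ Finset.range k, 5 * (‖Q i‖ ^ 2 / 2) + ∑ i ∈ Finset.range k, 5 * (‖Q i‖ ^ 2 / 2) := by
        simp only [Finset.sum_add_distrib]
        refine add_le_add h2 ?_
        rw [Finset.sum_comm]
        exact h2
    _ = _ := by rw [← Finset.mul_sum, ← Finset.sum_div]; ring

/-- Pythagoras at each step, telescoped. -/
theorem sum_norm_sq_sub_le {H : Type*} [NormedAddCommGroup H] [InnerProductSpace ℝ H] (v : ℕ → H)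
    (orth : ∀ i, inner ℝ (v (i + 1)) (v i - v (i + 1)) = 0) (k : ℕ) :
    ∑ i ∈ Finset.range k, ‖v i - v (i + 1)‖ ^ 2 ≤ ‖v 0‖ ^ 2 := by
  have : ∑ i ∈ Finset.range k, ‖v i - v (i + 1)‖ ^ 2 + ‖v k‖ ^ 2 = ‖v 0‖ ^ 2 := by
    induction k with
    | zero => simp
    | succ k ih =>
      rw [Finset.sum_range_succ, ← ih]
      have e := norm_add_sq_real (v (k + 1)) (v k - v (k + 1))
      rw [orth, add_sub_cancel] at e
      linarith
  nlinarith [sq_nonneg ‖v k‖]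

/-! ### Density of the polynomials -/

/-- Evaluation of polynomials as an algebra morphism into the continuous functions. -/
def evHom : MvPolynomial (Fin 2) ℝ →ₐ[ℝ] C(ℝ × ℝ, ℝ) :=
  MvPolynomial.aeval ![⟨Prod.fst, continuous_fst⟩, ⟨Prod.snd, continuous_snd⟩]

theorem evHom_apply (p : MvPolynomial (Fin 2) ℝ) (q : ℝ × ℝ) : evHom p q = ev p q := by
  have h : ((ContinuousMap.evalAlgHom ℝ ℝ q).comp evHom) =
      MvPolynomial.aeval (R := ℝ) ![q.1, q.2] := by
    refine MvPolynomial.algHom_ext fun i => ?_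
    fin_cases i <;> simp [evHom]
  have := DFunLike.congr_fun h p
  simpa [ev, MvPolynomial.coe_aeval_eq_eval] using this

/-- Stone–Weierstrass: the coordinates separate points. -/
theorem exists_ev_near {f : ℝ × ℝ → ℝ} (hf : Continuous f) {ε : ℝ} (hε : 0 < ε) :
    ∃ p : MvPolynomial (Fin 2) ℝ, ∀ q ∈ triangle, |f q - ev p q| < ε := by
  have hsep : (evHom.range).SeparatesPoints := by
    intro a b hab
    by_cases h : a.1 = b.1
    · have h2 : a.2 ≠ b.2 := fun h2 => hab (Prod.ext h h2)
      exact ⟨_, ⟨evHom py, ⟨py, rfl⟩, rfl⟩, by simpa [evHom_apply] using h2⟩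
    · exact ⟨_, ⟨evHom px, ⟨px, rfl⟩, rfl⟩, by simpa [evHom_apply] using h⟩
  obtain ⟨_, ⟨p, rfl⟩, h⟩ :=
    ContinuousMap.exists_mem_subalgebra_near_continuous_of_isCompact_of_separatesPoints hsep
      ⟨f, hf⟩ (isCompact_Icc (a := ((0 : ℝ), (0 : ℝ))) (b := (1, 1))) hε
  refine ⟨p, fun q hq => ?_⟩
  have := h q ⟨⟨hq.1, hq.2.1⟩, ⟨by linarith [hq.2.1, hq.2.2], by linarith [hq.1, hq.2.2]⟩⟩
  rw [abs_sub_comm, ← evHom_apply]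
  exact this

theorem exists_toL2_near {g : ℝ} (hg : -1 < g) (e : Lp ℝ 2 (triMeasure 0 0 g)) {ε : ℝ}
    (hε : 0 < ε) : ∃ p, ‖e - toL2 hg p‖ ≤ ε := by
  have := isFiniteMeasure_triMeasure hg
  obtain ⟨f, hf, hfm⟩ := (Lp.memLp e).exists_boundedContinuous_eLpNorm_sub_le (by norm_num)
    (ε := ENNReal.ofReal (ε / 2)) (by simpa using hε)
  set M := (triMeasure 0 0 g Set.univ).toReal ^ ((2 : ℝ≥0∞).toReal⁻¹) with hM
  have hM0 : 0 ≤ M := by positivity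
  obtain ⟨p, hp⟩ := exists_ev_near f.continuous (ε := ε / 2 / (M + 1)) (by positivity)
  refine ⟨p, ?_⟩
  have hm := memLp_ev hg p
  have e1 : ‖hfm.toLp - toL2 hg p‖ ≤ ε / 2 := by
    have h1 : ‖hfm.toLp - toL2 hg p‖ ≤ M * (ε / 2 / (M + 1)) := by
      have := Lp.norm_le_of_ae_bound (μ := triMeasure 0 0 g) (p := 2)
        (f := hfm.toLp - toL2 hg p) (C := ε / 2 / (M + 1)) (by positivity) ?_
      · exact this
      · have h2 : ∀ᵐ q ∂triMeasure 0 0 g, q ∈ openTriangle := by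
          rw [ae_triMeasure_iff]; exact ae_restrict_mem measurableSet_openTriangle
        filter_upwards [Lp.coeFn_sub hfm.toLp (toL2 hg p), hfm.coeFn_toLp, coeFn_toL2 hg p, h2]
          with q a1 a2 a3 a4
        rw [a1, Pi.sub_apply, a2, a3]
        exact (hp q (openTriangle_subset_triangle a4)).le
    refine h1.trans ?_
    rw [mul_div_assoc', div_le_iff₀ (by positivity)]
    nlinarith
  have e2 : ‖e - hfm.toLp‖ ≤ ε / 2 := by
    have h1 : e - hfm.toLp = ((Lp.memLp e).sub hfm).toLp := by
      rw [MemLp.toLp_sub (Lp.memLp e) hfm, Lp.toLp_coeFn]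
    rw [h1, Lp.norm_toLp]
    exact ENNReal.toReal_le_of_le_ofReal (by positivity) hf
  calc ‖e - toL2 hg p‖ = ‖(e - hfm.toLp) + (hfm.toLp - toL2 hg p)‖ := by rw [sub_add_sub_cancel]
    _ ≤ ε / 2 + ε / 2 := (norm_add_le _ _).trans (add_le_add e2 e1)
    _ = ε := by ring

/-- By density e may be tested against polynomials close to itself. This replaces a proof that the
expansion converges. -/
theorem norm_le_of_inner_le {g : ℝ} (hg : -1 < g) {e : Lp ℝ 2 (triMeasure 0 0 g)} {B : ℝ}
    (hB : 0 ≤ B) (h : ∀ p, inner ℝ e (toL2 hg p) ≤ B * ‖toL2 hg p‖) : ‖e‖ ≤ B := by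
  refine le_of_forall_pos_le_add fun ε hε => ?_
  have key : ∀ δ : ℝ, 0 < δ → ‖e‖ * ‖e‖ ≤ B * ‖e‖ + (B + ‖e‖) * δ := by
    intro δ hδ
    obtain ⟨p, hp⟩ := exists_toL2_near hg e hδ
    have h1 := h p
    have h2 : inner ℝ e (e - toL2 hg p) ≤ ‖e‖ * δ :=
      (real_inner_le_norm _ _).trans (mul_le_mul_of_nonneg_left hp (norm_nonneg _))
    rw [inner_sub_right, real_inner_self_eq_norm_mul_norm] at h2
    have h3 : ‖toL2 hg p‖ ≤ ‖e‖ + δ := by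
      have := norm_sub_norm_le (toL2 hg p) e
      rw [norm_sub_rev] at this
      linarith
    nlinarith [mul_le_mul_of_nonneg_left h3 hB]
  have h0 : ‖e‖ * ‖e‖ ≤ B * ‖e‖ := by
    refine le_of_forall_pos_le_add fun η hη => ?_
    have := key (η / (B + ‖e‖ + 1)) (by positivity)
    have h4 : (B + ‖e‖) * (η / (B + ‖e‖ + 1)) ≤ η := by
      rw [mul_div_assoc', div_le_iff₀ (by positivity)]
      nlinarith [norm_nonneg e]
    linarith
  rcases eq_or_lt_of_le (norm_nonneg e) with h1 | h1
  · rw [← h1]; positivity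
  · linarith [le_of_mul_le_mul_right h0 h1]

/-! ### Weak derivatives of smooth functions -/

theorem isWeakDeriv_of_contDiff {f : ℝ × ℝ → ℝ} (hf : ContDiff ℝ ∞ f) (v : ℝ × ℝ) :
    IsWeakDeriv v f (fun q => fderiv ℝ f q v) := by
  have hc : Continuous fun q => fderiv ℝ f q v :=
    (hf.continuous_fderiv (by simp)).clm_apply continuous_const
  refine ⟨hf.continuous.locallyIntegrable.locallyIntegrableOn _,
    hc.locallyIntegrable.locallyIntegrableOn _, fun ψ h1 h2 h3 => ?_⟩
  have hψ' : Continuous fun q => fderiv ℝ ψ q v :=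
    (h1.continuous_fderiv (by simp)).clm_apply continuous_const
  have z : ∀ q ∉ openTriangle, ψ q = 0 := fun q hq => image_eq_zero_of_notMem_tsupport fun h => hq (h3 h)
  have hs' : HasCompactSupport fun q => fderiv ℝ ψ q v := h2.fderiv_apply (𝕜 := ℝ) v
  have z' : ∀ q ∉ openTriangle, fderiv ℝ ψ q v = 0 := fun q hq => by
    rw [image_eq_zero_of_notMem_tsupport fun h => hq (h3 (tsupport_fderiv_subset ℝ h))]; rfl
  rw [setIntegral_eq_integral_of_forall_compl_eq_zero fun q hq => by rw [z' q hq, mul_zero],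
    setIntegral_eq_integral_of_forall_compl_eq_zero fun q hq => by rw [z q hq, mul_zero]]
  refine integral_mul_fderiv_eq_neg_fderiv_mul_of_integrable
    ((hc.mul h1.continuous).integrable_of_hasCompactSupport h2.mul_left)
    ((hf.continuous.mul hψ').integrable_of_hasCompactSupport hs'.mul_left)
    ((hf.continuous.mul h1.continuous).integrable_of_hasCompactSupport h2.mul_left)
    (fun q _ => hf.differentiable (by simp) q) (fun q _ => h1.differentiable (by simp) q)

theorem isWeakDeriv_ev (p : MvPolynomial (Fin 2) ℝ) (v : ℝ × ℝ) :
    IsWeakDeriv v (ev p) (fun q => v.1 * ev (D₁ p) q + v.2 * ev (D₂ p) q) := by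
  have := isWeakDeriv_of_contDiff (contDiff_ev p) v
  convert this using 2 with q
  rw [(hasFDerivAt_ev p q).fderiv]
  simp [mul_comm]

theorem isWeakDeriv_ev₁ (p : MvPolynomial (Fin 2) ℝ) : IsWeakDeriv (1, 0) (ev p) (ev (D₁ p)) := by
  simpa using isWeakDeriv_ev p (1, 0)

theorem isWeakDeriv_ev₂ (p : MvPolynomial (Fin 2) ℝ) : IsWeakDeriv (0, 1) (ev p) (ev (D₂ p)) := by
  simpa using isWeakDeriv_ev p (0, 1)

theorem isWeakDeriv_ev₃ (p : MvPolynomial (Fin 2) ℝ) : IsWeakDeriv (-1, 1) (ev p) (ev (D₃ p)) := by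
  convert isWeakDeriv_ev p (-1, 1) using 2 with q
  rw [D₃_apply, ev_sub]; ring

theorem isSobolevFun_ev {g : ℝ} (hg : -1 < g) (p : MvPolynomial (Fin 2) ℝ) :
    IsSobolevFun g (ev p) (ev (D₁ p)) (ev (D₂ p)) (ev (D₁ (D₂ p))) where
  weak₁ := isWeakDeriv_ev₁ p
  weak₂ := isWeakDeriv_ev₂ p
  weak₁₂ := isWeakDeriv_ev₁ (D₂ p)
  memLp := memLp_ev hg _
  memLp₁ := memLp_ev hg _
  memLp₂ := memLp_ev hg _
  memLp₁₂ := memLp_ev (by linarith) _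

/-! ### Derivative of the trace -/

theorem mem_triangle_edge {t : ℝ} (ht : t ∈ Set.Ico (0 : ℝ) 1) : ((0 : ℝ), t) ∈ triangle :=
  ⟨le_rfl, ht.1, by simpa using ht.2.le⟩

/-- Lebesgue differentiation on the intervals [0, 1 - 1/(n + 2)], since β need not be integrable up
to 1. -/
theorem ae_hasDerivAt_of_eq_add_integral {r c : ℝ} {β u : ℝ → ℝ}
    (hβ : IntervalIntegrable (fun t => β t * (1 - t) ^ r) volume 0 1)
    (hu : ∀ t ∈ Set.Ico (0 : ℝ) 1, u t = c + ∫ s in (0 : ℝ)..t, β s) :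
    ∀ᵐ t : ℝ, t ∈ Set.Ioo (0 : ℝ) 1 → HasDerivAt u (β t) t := by
  have hloc : ∀ n : ℕ, IntervalIntegrable β volume 0 (1 - 1 / ((n : ℝ) + 2)) := by
    intro n
    have h1 : (0 : ℝ) < 1 / ((n : ℝ) + 2) := by positivity
    have h2 : 1 / ((n : ℝ) + 2) ≤ 1 := by
      rw [div_le_one (by positivity)]; linarith [(Nat.cast_nonneg n : (0 : ℝ) ≤ n)]
    have h3 := (hβ.mono_set (c := 0) (d := 1 - 1 / ((n : ℝ) + 2)) (by
      rw [Set.uIcc_of_le (by linarith), Set.uIcc_of_le zero_le_one]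
      exact Set.Icc_subset_Icc_right (by linarith))).mul_continuousOn
      (g := fun t => (1 - t) ^ (-r)) (by
        rw [Set.uIcc_of_le (by linarith)]
        exact ContinuousOn.rpow_const (by fun_prop) fun t ht => Or.inl (by linarith [ht.2]))
    refine h3.congr fun t ht => ?_
    rw [Set.uIoc_of_le (by linarith)] at ht
    have hz : 0 < 1 - t := by linarith [ht.2]
    rw [mul_assoc, ← Real.rpow_add hz, add_neg_cancel, Real.rpow_zero, mul_one]
  have h := fun n => (hloc n).ae_hasDerivAt_integral
  filter_upwards [ae_all_iff.mpr h] with t ht ht01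
  obtain ⟨n, hn⟩ := exists_nat_gt (1 / (1 - t))
  have hz : 0 < 1 - t := by linarith [ht01.2]
  have h1 : 1 / ((n : ℝ) + 2) < 1 - t := by
    rw [div_lt_iff₀ (by positivity)]
    rw [div_lt_iff₀ hz] at hn
    nlinarith
  have h0 : (0 : ℝ) ≤ 1 - 1 / ((n : ℝ) + 2) := by linarith [ht01.1]
  have h2 := ht n (by rw [Set.uIcc_of_le h0]; exact ⟨ht01.1.le, by linarith⟩) 0 Set.left_mem_uIcc
  refine (h2.const_add c).congr_of_eventuallyEq ?_
  filter_upwards [Ioo_mem_nhds ht01.1 ht01.2] with s hs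
  exact hu s ⟨hs.1.le, hs.2⟩

/-! ### Trace vectors -/

/-- The functional `p ↦ ∫₀¹ β p(0, ·) (1 - t) ^ (g + 1)`. -/
def edgeFun {g : ℝ} {β : ℝ → ℝ}
    (hβ : IntervalIntegrable (fun t => β t * (1 - t) ^ (g + 1)) volume 0 1) :
    MvPolynomial (Fin 2) ℝ →ₗ[ℝ] ℝ where
  toFun p := ∫ t in (0 : ℝ)..1, β t * ev p (0, t) * (1 - t) ^ (g + 1)
  map_add' p q := by
    have h : ∀ p, IntervalIntegrable (fun t => β t * ev p (0, t) * (1 - t) ^ (g + 1)) volume 0 1 := by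
      intro p
      refine (hβ.mul_continuousOn (g := fun t => ev p (0, t))
        ((continuous_ev p).comp (by fun_prop)).continuousOn).congr fun t _ => ?_
      ring
    rw [← intervalIntegral.integral_add (h p) (h q)]
    refine intervalIntegral.integral_congr fun t _ => ?_
    simp only [ev_add]; ring
  map_smul' a p := by
    rw [RingHom.id_apply, smul_eq_mul, ← intervalIntegral.integral_const_mul]
    refine intervalIntegral.integral_congr fun t _ => ?_
    simp only [ev_smul]; ring

theorem inner_toLp_toL2 {g : ℝ} (hg : -1 < g) {f : ℝ × ℝ → ℝ} (hf : MemLp f 2 (triMeasure 0 0 g))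
    (p : MvPolynomial (Fin 2) ℝ) :
    inner ℝ hf.toLp (toL2 hg p) = ∫ q, f q * ev p q ∂triMeasure 0 0 g := by
  rw [L2.inner_def]
  refine integral_congr_ae ?_
  filter_upwards [hf.coeFn_toLp, coeFn_toL2 hg p] with q h1 h2
  simp [h1, h2, mul_comm]

theorem TraceIdentities.traceVectors {g : ℝ} (hg : -1 < g) (hg' : -1 < g + 2)
    {F v h : ℝ × ℝ → ℝ} {β : ℝ → ℝ} {c : ℝ} (T : TraceIdentities g F v h β c)
    (hF : MemLp F 2 (triMeasure 0 0 g)) (hv : MemLp v 2 (triMeasure 0 0 g))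
    (hh : MemLp h 2 (triMeasure 0 0 (g + 2))) :
    TraceVectors hg hg' hF.toLp hv.toLp hh.toLp (edgeFun T.intervalIntegrable) c where
  edge p hp := by simp [edgeFun, hp]
  first Y a ha := by
    rw [inner_toLp_toL2, inner_toLp_toL2]
    exact T.first Y a ha
  second p a ha := by
    rw [inner_toLp_toL2, inner_toLp_toL2, inner_toLp_toL2]
    exact T.second p a ha

/-- The functional `q ↦ ∫₀¹ ∂₂p(0, ·) q(0, ·) (1 - t) ^ (g + 1)`. -/
def polyEdgeFun {g : ℝ} (hg : -1 < g) (p : MvPolynomial (Fin 2) ℝ) :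
    MvPolynomial (Fin 2) ℝ →ₗ[ℝ] ℝ where
  toFun q := edgeInt g (D₂ p * q)
  map_add' a b := by rw [mul_add, edgeInt_add hg]
  map_smul' a b := by
    rw [MvPolynomial.smul_eq_C_mul, mul_left_comm, edgeInt_C_mul]; rfl

/-- The general trace statement applied to a polynomial; uniqueness of the boundary value identifies
c with p(0, 0) and β with ∂₂p almost everywhere. -/
theorem traceVectors_toL2 {g : ℝ} (hg : -1 < g) (hg' : -1 < g + 2)
    (p : MvPolynomial (Fin 2) ℝ) :
    TraceVectors hg hg' (toL2 hg p) (toL2 hg (D₃ p)) (toL2 hg' (D₁ (D₂ p))) (polyEdgeFun hg p)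
      (ev p (0, 0)) := by
  obtain ⟨β, c, T, htr⟩ := (isSobolevFun_ev hg p).exists_trace_identities hg
  have hu : ∀ t ∈ Set.Ico (0 : ℝ) 1, ev p (0, t) = c + ∫ s in (0 : ℝ)..t, β s := by
    intro t ht
    have hm : AEStronglyMeasurable (ev p) (volume.restrict openTriangle) :=
      (continuous_ev p).aestronglyMeasurable
    rw [← (htr t ht).pval_eq (mem_triangle_edge ht) hm]
    exact ((hasTrace_of_continuous (continuous_ev p) _).pval_eq (mem_triangle_edge ht) hm).symm
  have hc : c = ev p (0, 0) := by
    have := hu 0 ⟨le_rfl, one_pos⟩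
    rw [intervalIntegral.integral_same, add_zero] at this
    exact this.symm
  have hβ : ∀ᵐ t : ℝ, t ∈ Set.Ioo (0 : ℝ) 1 → β t = ev (D₂ p) (0, t) := by
    filter_upwards [ae_hasDerivAt_of_eq_add_integral T.intervalIntegrable hu] with t ht ht01
    have h2 := hasDerivAt_ev_comp p (hasDerivAt_const t (0 : ℝ)) (hasDerivAt_id t)
    rw [(ht ht01).unique h2]
    simp
  have T2 := T.traceVectors hg hg' (memLp_ev hg p) ((memLp_ev hg _).sub (memLp_ev hg _))
    (memLp_ev hg' _)
  have e1 : edgeFun T.intervalIntegrable = polyEdgeFun hg p := by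
    refine LinearMap.ext fun q => ?_
    change (∫ t in (0 : ℝ)..1, _) = ∫ t in (0 : ℝ)..1, _
    rw [intervalIntegral.integral_of_le zero_le_one, intervalIntegral.integral_of_le zero_le_one,
      integral_Ioc_eq_integral_Ioo, integral_Ioc_eq_integral_Ioo]
    refine setIntegral_congr_ae measurableSet_Ioo ?_
    filter_upwards [hβ] with t ht ht01
    rw [ht ht01, ev_mul]
  have e2 : ((memLp_ev hg (D₂ p)).sub (memLp_ev hg (D₁ p))).toLp = toL2 hg (D₃ p) := by
    refine MemLp.toLp_congr _ (memLp_ev hg _) (Eventually.of_forall fun q => ?_)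
    rw [D₃_apply, ev_sub]; rfl
  rw [← e1, ← hc, ← e2]
  exact T2

/-! ### The partial sums in the Hilbert space setting -/

theorem sobOp_add (g : ℝ) (p q : MvPolynomial (Fin 2) ℝ) :
    sobOp g (p + q) = sobOp g p + sobOp g q := by
  simp only [sobOp, map_add]; ring

theorem sobOp_smul (g a : ℝ) (p : MvPolynomial (Fin 2) ℝ) :
    sobOp g (a • p) = a • sobOp g p := by
  simp only [sobOp, Derivation.map_smul]
  simp only [MvPolynomial.smul_eq_C_mul]; ring

theorem sobOp_sum_smul (g μ : ℝ) {ι : Type*} (s : Finset ι) (a : ι → ℝ)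
    (b : ι → MvPolynomial (Fin 2) ℝ) (h : ∀ i ∈ s, sobOp g (b i) = MvPolynomial.C μ * b i) :
    sobOp g (∑ i ∈ s, a i • b i) = MvPolynomial.C μ * ∑ i ∈ s, a i • b i := by
  classical
  induction s using Finset.induction_on with
  | empty => simp [sobOp]
  | insert i s hi ih =>
    rw [Finset.sum_insert hi, sobOp_add, sobOp_smul, h i (Finset.mem_insert_self _ _),
      ih fun j hj => h j (Finset.mem_insert_of_mem hj), mul_add, mul_smul_comm]

/-- The Sobolev inner product of a function with a polynomial, in terms of the derivative
`v = ∂₃ f`, of the functional `φ` given by the derivative of the trace, and of `c = f(0, 0)`. -/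
def sobPair {g : ℝ} (hg : -1 < g) (l l₀ : ℝ) (v : Lp ℝ 2 (triMeasure 0 0 g)) (φ : MvPolynomial (Fin 2) ℝ →ₗ[ℝ] ℝ)
    (c : ℝ) : MvPolynomial (Fin 2) ℝ →ₗ[ℝ] ℝ where
  toFun b := inner ℝ v (toL2 hg (D₃ b)) + l * (φ (D₂ b) + l₀ * (c * ev b (0, 0)))
  map_add' a b := by simp only [map_add, inner_add_right, ev_add]; ring
  map_smul' r b := by
    simp only [Derivation.map_smul, map_smul, inner_smul_right, ev_smul, smul_eq_mul,
      RingHom.id_apply]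
    ring

/-- The component of degree `m` of the expansion with the coefficients `Φ b / ⟨b, b⟩`. -/
def sobComp (l l₀ g : ℝ) (Φ : MvPolynomial (Fin 2) ℝ → ℝ) (m : ℕ) : MvPolynomial (Fin 2) ℝ :=
  ∑ k ∈ Finset.range (m + 1),
    (Φ (basPoly g k m) / sobForm l l₀ g (basPoly g k m) (basPoly g k m)) • basPoly g k m

/-- The partial sum of the expansion with the coefficients `Φ b / ⟨b, b⟩`. -/
def sobSum (l l₀ g : ℝ) (Φ : MvPolynomial (Fin 2) ℝ → ℝ) (n : ℕ) : MvPolynomial (Fin 2) ℝ :=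
  ∑ m ∈ Finset.range (n + 1), sobComp l l₀ g Φ m

theorem totalDegree_smul_le {n : ℕ} (a : ℝ) {p : MvPolynomial (Fin 2) ℝ} (hp : p.totalDegree ≤ n) :
    (a • p).totalDegree ≤ n := (MvPolynomial.totalDegree_smul_le _ _).trans hp

theorem totalDegree_sobComp_le (l l₀ g : ℝ) (Φ : MvPolynomial (Fin 2) ℝ → ℝ) (m : ℕ) :
    (sobComp l l₀ g Φ m).totalDegree ≤ m :=
  MvPolynomial.totalDegree_finsetSum_le fun _ hk =>
    totalDegree_smul_le _ (totalDegree_basPoly_le g (by simpa [Nat.lt_succ_iff] using hk))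

theorem totalDegree_sobSum_le (l l₀ g : ℝ) (Φ : MvPolynomial (Fin 2) ℝ → ℝ) (n : ℕ) :
    (sobSum l l₀ g Φ n).totalDegree ≤ n :=
  MvPolynomial.totalDegree_finsetSum_le fun m hm =>
    (totalDegree_sobComp_le l l₀ g Φ m).trans (by simpa [Nat.lt_succ_iff] using hm)

theorem sobOp_sobComp {g : ℝ} (hg : -1 < g) (l l₀ : ℝ) (Φ : MvPolynomial (Fin 2) ℝ → ℝ) (m : ℕ) :
    sobOp g (sobComp l l₀ g Φ m) = MvPolynomial.C ((m : ℝ) * (m + g)) * sobComp l l₀ g Φ m :=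
  sobOp_sum_smul _ _ _ _ _ fun _ hk =>
    sobOp_basPoly hg (by simpa [Nat.lt_succ_iff] using hk)

theorem sobPair_sub {g : ℝ} (hg : -1 < g) (l l₀ : ℝ) (v : Lp ℝ 2 (triMeasure 0 0 g))
    (φ : MvPolynomial (Fin 2) ℝ →ₗ[ℝ] ℝ) (c : ℝ) (S b : MvPolynomial (Fin 2) ℝ) :
    sobPair hg l l₀ (v - toL2 hg (D₃ S)) (φ - polyEdgeFun hg S) (c - ev S (0, 0)) b =
      sobPair hg l l₀ v φ c b - sobForm l l₀ g S b := by
  change inner ℝ _ _ + l * (φ (D₂ b) - edgeInt g (D₂ S * D₂ b) + l₀ * (_ * ev b (0, 0))) =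
    inner ℝ _ _ + l * (φ (D₂ b) + l₀ * (c * ev b (0, 0))) - _
  rw [inner_sub_left, inner_toL2, sobForm]
  ring

/-- Both sides are linear in b, so orthogonality reduces the claim to the basis. -/
theorem sobForm_sobSum {g l l₀ : ℝ} (hg : -1 < g) (hl : 0 < l) (hl₀ : 0 < l₀)
    (Φ : MvPolynomial (Fin 2) ℝ →ₗ[ℝ] ℝ) {n : ℕ} {b : MvPolynomial (Fin 2) ℝ}
    (hb : b.totalDegree ≤ n) : sobForm l l₀ g (sobSum l l₀ g Φ n) b = Φ b := by
  have hb' : b ∈ Submodule.span ℝ (Set.range fun i : basIndex n => basPoly g i.1.2 i.1.1) := by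
    rw [span_basPoly hg, MvPolynomial.mem_restrictTotalDegree]; exact hb
  have key := LinearMap.eqOn_span (f := sobBilin hg l l₀ (sobSum l l₀ g Φ n)) (g := Φ) ?_ hb'
  · exact key
  · rintro _ ⟨⟨⟨m, k⟩, hi⟩, rfl⟩
    obtain ⟨hm, hk⟩ := mem_basIndex.mp hi
    simp only at hm hk ⊢
    have hne := sobForm_self_ne_zero hg hl hl₀ (basPoly_ne_zero g k m)
    have h1 : ∀ p q, sobBilin hg l l₀ p q = sobForm l l₀ g p q := fun _ _ => rfl
    simp only [sobSum, sobComp, map_sum, map_smul, LinearMap.sum_apply, LinearMap.smul_apply, h1,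
      smul_eq_mul]
    rw [Finset.sum_eq_single m, Finset.sum_eq_single k, div_mul_cancel₀ _ hne]
    · intro k' hk' hkk
      rw [sobForm_basPoly hg l l₀ (by simpa [Nat.lt_succ_iff] using hk') hk (by simpa using hkk),
        mul_zero]
    · intro h; exact absurd (Finset.mem_range.mpr (Nat.lt_succ_of_le hk)) h
    · intro m' hm' hmm
      refine Finset.sum_eq_zero fun k' hk' => ?_
      rw [sobForm_basPoly hg l l₀ (by simpa [Nat.lt_succ_iff] using hk') hk
        (by simp [hmm]), mul_zero]
    · intro h; exact absurd (Finset.mem_range.mpr (Nat.lt_succ_of_le hm)) h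

/-- A function that is Sobolev orthogonal to the polynomials of degree `N + 2` vanishes at the
origin, and its derivatives are orthogonal to polynomials. -/
theorem TraceVectors.inner_eq_zero_of_sobPair {g l l₀ : ℝ} {hg : -1 < g} {hg' : -1 < g + 2}
    (hl : 0 < l) (hl₀ : 0 < l₀)
    {e v : Lp ℝ 2 (triMeasure 0 0 g)} {h : Lp ℝ 2 (triMeasure 0 0 (g + 2))}
    {φ : MvPolynomial (Fin 2) ℝ →ₗ[ℝ] ℝ} {c : ℝ} (T : TraceVectors hg hg' e v h φ c) {N : ℕ}
    (orth : ∀ b : MvPolynomial (Fin 2) ℝ, b.totalDegree ≤ N + 2 → sobPair hg l l₀ v φ c b = 0) :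
    (∀ p : MvPolynomial (Fin 2) ℝ, p.totalDegree ≤ N + 1 → inner ℝ v (toL2 hg p) = 0) ∧
    (∀ p : MvPolynomial (Fin 2) ℝ, p.totalDegree ≤ N → inner ℝ e (toL2 hg p) = 0) ∧
    (∀ p : MvPolynomial (Fin 2) ℝ, p.totalDegree ≤ N → inner ℝ h (toL2 hg' p) = 0) := by
  have orth' : ∀ b : MvPolynomial (Fin 2) ℝ, b.totalDegree ≤ N + 2 →
      inner ℝ v (toL2 hg (D₃ b)) + l * (φ (D₂ b) + l₀ * (c * ev b (0, 0))) = 0 := orth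
  have hc : c = 0 := by
    -- The constant 1 sees only the point term.
    have := orth' 1 (by simp)
    simpa [hl.ne', hl₀.ne'] using this
  have hφj : ∀ j ≤ N + 1, φ (py ^ j) = 0 := by
    intro j hj
    -- A power of x + y is killed by ∂₃, so only the edge term remains, and there it is a power of
    -- y.
    have h1 := orth' ((px + py) ^ (j + 1)) ((MvPolynomial.totalDegree_pow _ _).trans (by
      have : (px + py : MvPolynomial (Fin 2) ℝ).totalDegree ≤ 1 :=
        totalDegree_add_le (by simp) (by simp)
      nlinarith))
    have e1 : D₂ ((px + py) ^ (j + 1)) = ((j : ℝ) + 1) • (px + py) ^ j := by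
      rw [MvPolynomial.smul_eq_C_mul]
      simp [Derivation.leibniz_pow]
    have e2 : D₃ ((px + py) ^ (j + 1)) = 0 := by
      rw [D₃_apply]
      simp [Derivation.leibniz_pow]
    have e3 : φ ((px + py) ^ j) = φ (py ^ j) := by
      rw [← sub_eq_zero, ← map_sub]
      exact T.edge _ fun t => by simp
    rw [e1, e2, hc, map_zero, inner_zero_right, map_smul, e3] at h1
    have : ((j : ℝ) + 1) ≠ 0 := by positivity
    simpa [hl.ne', this] using h1
  have hφ : ∀ p : MvPolynomial (Fin 2) ℝ, p.totalDegree ≤ N + 1 → φ p = 0 := by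
    intro p hp
    refine poly_induction (P := fun p => φ p = 0) ?_ ?_ ?_ hp
    · intro i j hij
      rcases Nat.eq_zero_or_pos i with rfl | hi
      · rw [pow_zero, one_mul]; exact hφj j (by omega)
      · exact T.edge _ fun t => by simp [hi.ne']
    · intro p q h1 h2
      rw [map_add, h1, h2, add_zero]
    · intro a p h1
      rw [← MvPolynomial.smul_eq_C_mul, map_smul, h1, smul_zero]
  have hv : ∀ p : MvPolynomial (Fin 2) ℝ, p.totalDegree ≤ N + 1 → inner ℝ v (toL2 hg p) = 0 := by
    intro p hp
    refine poly_induction (P := fun p => inner ℝ v (toL2 hg p) = 0) ?_ ?_ ?_ hp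
    · intro i j hij
      obtain ⟨Y, hY, hD⟩ := exists_D₃_py_mul i j
      have hYd : (py * Y).totalDegree ≤ N + 2 :=
        totalDegree_mul_le (n := 1) (by omega) (by simp) hY
      -- With the edge and point terms gone, multiples of y suffice: their ∂₃ derivatives give every
      -- monomial of degree at most N + 1.
      have h1 := orth' _ hYd
      rw [hφ _ (totalDegree_D₂_le hYd), hc, hD] at h1
      linarith
    · intro p q h1 h2
      rw [map_add, inner_add_right, h1, h2, add_zero]
    · intro a p h1
      rw [← MvPolynomial.smul_eq_C_mul, map_smul, inner_smul_right, h1, mul_zero]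
  exact ⟨hv, fun p hp => (T.inner_eq_zero hv hφ hc hp).1, fun p hp =>
    (T.inner_eq_zero hv hφ hc hp).2⟩

theorem norm_sub_le_of_inner_eq_zero {H : Type*} [NormedAddCommGroup H] [InnerProductSpace ℝ H]
    {v s p : H} (h : inner ℝ (v - s) (s - p) = 0) : ‖v - s‖ ≤ ‖v - p‖ := by
  have e := norm_add_sq_real (v - s) (s - p)
  rw [h, sub_add_sub_cancel] at e
  nlinarith [sq_nonneg ‖s - p‖, norm_nonneg (v - s), norm_nonneg (v - p)]

/-- The factor 5 of almost orthogonality and the factor 2 of (s + t)² ≤ 2(s² + t²) give 10 ≤ 4². -/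
theorem le_of_sq_le_five_mul_sum {C x V H R : ℝ} (hC : 0 ≤ C) (hx : 0 < x) (hV : 0 ≤ V)
    (hH : 0 ≤ H) (hR : 0 ≤ R) {k : ℕ} {q a b : ℕ → ℝ}
    (h : R ^ 2 ≤ 5 * ∑ i ∈ Finset.range k, q i ^ 2) (hq : ∀ i, 0 ≤ q i)
    (hqab : ∀ i, q i ≤ C * (a i / x + b i / x ^ 2))
    (ha : ∑ i ∈ Finset.range k, a i ^ 2 ≤ V ^ 2) (hb : ∑ i ∈ Finset.range k, b i ^ 2 ≤ H ^ 2) :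
    R ≤ 4 * C * (V / x + H / x ^ 2) := by
  have h1 : ∀ i, q i ^ 2 ≤ 2 * C ^ 2 * (a i ^ 2 / x ^ 2 + b i ^ 2 / x ^ 4) := by
    intro i
    have e1 : a i ^ 2 / x ^ 2 = (a i / x) ^ 2 := by rw [div_pow]
    have e2 : b i ^ 2 / x ^ 4 = (b i / x ^ 2) ^ 2 := by rw [div_pow, ← pow_mul]
    rw [e1, e2]
    refine (pow_le_pow_left₀ (hq i) (hqab i) 2).trans ?_
    nlinarith [mul_nonneg (sq_nonneg C) (sq_nonneg (a i / x - b i / x ^ 2))]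
  have h3 : ∑ i ∈ Finset.range k, q i ^ 2 ≤ 2 * C ^ 2 * (V ^ 2 / x ^ 2 + H ^ 2 / x ^ 4) := by
    refine (Finset.sum_le_sum fun i _ => h1 i).trans ?_
    rw [← Finset.mul_sum, Finset.sum_add_distrib, ← Finset.sum_div, ← Finset.sum_div]
    gcongr
  have e1 : V ^ 2 / x ^ 2 = (V / x) ^ 2 := by rw [div_pow]
  have e2 : H ^ 2 / x ^ 4 = (H / x ^ 2) ^ 2 := by rw [div_pow, ← pow_mul]
  rw [e1, e2] at h3
  have h4 : 0 ≤ V / x := by positivity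
  have h5 : 0 ≤ H / x ^ 2 := by positivity
  generalize V / x = s at *
  generalize H / x ^ 2 = t at *
  refine (sq_le_sq₀ hR (by positivity)).mp ?_
  have h7 : 0 ≤ C ^ 2 * (s ^ 2 + t ^ 2) := by positivity
  have h8 : 0 ≤ C ^ 2 * (s * t) := by positivity
  nlinarith

/-- The approximation theorem in the Hilbert space setting. -/
theorem exists_norm_sub_sobSum_le {g : ℝ} (hg : -1 < g) (hg' : -1 < g + 2) :
    ∃ C : ℝ, 0 < C ∧ ∀ l l₀ : ℝ, 0 < l → 0 < l₀ → ∀ (e v : Lp ℝ 2 (triMeasure 0 0 g))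
      (h : Lp ℝ 2 (triMeasure 0 0 (g + 2))) (φ : MvPolynomial (Fin 2) ℝ →ₗ[ℝ] ℝ) (c : ℝ),
      TraceVectors hg hg' e v h φ c → ∀ n : ℕ, 2 ≤ n → ∀ p r : MvPolynomial (Fin 2) ℝ,
        p.totalDegree ≤ n - 1 → r.totalDegree ≤ n - 2 →
        ‖e - toL2 hg (sobSum l l₀ g (sobPair hg l l₀ v φ c) n)‖ ≤
          C * (‖v - toL2 hg p‖ / n + ‖h - toL2 hg' r‖ / (n : ℝ) ^ 2) := by
  obtain ⟨C, hC, hdeg⟩ := norm_le_of_degree hg hg'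
  refine ⟨4 * C, by positivity, ?_⟩
  intro l l₀ hl hl₀ e v h φ c T n hn p r hp hr
  obtain ⟨N, rfl⟩ := Nat.exists_eq_add_of_le' hn
  set Φ := sobPair hg l l₀ v φ c with hΦ
  set S : ℕ → MvPolynomial (Fin 2) ℝ := fun i => sobSum l l₀ g Φ (N + 2 + i) with hS
  have hSd : ∀ i, (S i).totalDegree ≤ N + i + 2 := fun i =>
    (totalDegree_sobSum_le l l₀ g Φ _).trans (by omega)
  -- S i has the same Sobolev products as f with polynomials of degree at most N + i + 2, so the
  -- remainder satisfies the orthogonality relations at every stage.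
  have horth := fun i => (T.sub (traceVectors_toL2 hg hg' (S i))).inner_eq_zero_of_sobPair hl hl₀
    (N := N + i) fun b hb => by
      rw [sobPair_sub, sobForm_sobSum hg hl hl₀ Φ (by omega), sub_self]
  set Q : ℕ → MvPolynomial (Fin 2) ℝ := fun i => sobComp l l₀ g Φ (N + 2 + (i + 1)) with hQ
  have hSQ : ∀ i, S (i + 1) = S i + Q i := fun i => Finset.sum_range_succ _ _
  have hQd : ∀ i, (Q i).totalDegree ≤ N + i + 3 := fun i =>
    (totalDegree_sobComp_le l l₀ g Φ _).trans (by omega)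
  have hv : ‖v - toL2 hg (D₃ (S 0))‖ ≤ ‖v - toL2 hg p‖ := by
    refine norm_sub_le_of_inner_eq_zero ?_
    rw [← map_sub]
    exact (horth 0).1 _ (totalDegree_sub_le (totalDegree_D₃_le (hSd 0)) (by omega))
  have hh : ‖h - toL2 hg' (D₁ (D₂ (S 0)))‖ ≤ ‖h - toL2 hg' r‖ := by
    refine norm_sub_le_of_inner_eq_zero ?_
    rw [← map_sub]
    exact (horth 0).2.2 _ (totalDegree_sub_le (totalDegree_D₁_le (totalDegree_D₂_le (hSd 0)))
      (by omega))
  set x : ℝ := ((N + 2 : ℕ) : ℝ) with hx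
  have hx0 : 0 < x := by rw [hx]; positivity
  set V := ‖v - toL2 hg (D₃ (S 0))‖ with hV
  set H := ‖h - toL2 hg' (D₁ (D₂ (S 0)))‖ with hH
  have hV0 : 0 ≤ V := norm_nonneg _
  have hH0 : 0 ≤ H := norm_nonneg _
  have hR : ∀ k, ‖∑ i ∈ Finset.range k, toL2 hg (Q i)‖ ≤ 4 * C * (V / x + H / x ^ 2) := by
    intro k
    -- Q i is a difference of two remainders, both orthogonal to degree N + i, and Q j has degree at
    -- most N + j + 3; hence the gap 3.
    have h1 := norm_sum_sq_le_five (fun i => toL2 hg (Q i)) (fun i j hij => by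
      have a := (horth i).2.1 (Q j) ((hQd j).trans (by omega))
      have b := (horth (i + 1)).2.1 (Q j) ((hQd j).trans (by omega))
      have e1 : toL2 hg (Q i) = (e - toL2 hg (S i)) - (e - toL2 hg (S (i + 1))) := by
        rw [hSQ, map_add]; abel
      rw [e1, inner_sub_left, a, b, sub_zero]) k
    have hvs := sum_norm_sq_sub_le (fun i => v - toL2 hg (D₃ (S i))) (fun i => by
      rw [sub_sub_sub_cancel_left, ← map_sub]
      exact (horth (i + 1)).1 _ (by
        rw [← map_sub, hSQ, add_sub_cancel_left]
        exact (totalDegree_D₃_le (hQd i)).trans (by omega))) k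
    have hhs := sum_norm_sq_sub_le (fun i => h - toL2 hg' (D₁ (D₂ (S i)))) (fun i => by
      rw [sub_sub_sub_cancel_left, ← map_sub]
      exact (horth (i + 1)).2.2 _ (by
        rw [← map_sub, ← map_sub, hSQ, add_sub_cancel_left]
        exact (totalDegree_D₁_le (totalDegree_D₂_le (hQd i))).trans (by omega))) k
    simp only [sub_sub_sub_cancel_left, ← map_sub, hSQ, add_sub_cancel_left] at hvs hhs
    refine le_of_sq_le_five_mul_sum hC.le hx0 hV0 hH0 (norm_nonneg _) h1 (fun i => norm_nonneg _)
      (fun i => ?_) hvs hhs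
    refine (hdeg (N + 2 + (i + 1)) (by omega) (Q i) (sobOp_sobComp hg l l₀ Φ _)).trans
      (mul_le_mul_of_nonneg_left ?_ hC.le)
    have hxm : x ≤ ((N + 2 + (i + 1) : ℕ) : ℝ) := by rw [hx]; exact_mod_cast Nat.le_add_right _ _
    gcongr
  have hfin : ‖e - toL2 hg (S 0)‖ ≤ 4 * C * (V / x + H / x ^ 2) := by
    refine norm_le_of_inner_le hg (by positivity) fun p => ?_
    have e1 : ∀ k, e - toL2 hg (S 0) =
        ∑ i ∈ Finset.range k, toL2 hg (Q i) + (e - toL2 hg (S k)) := by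
      intro k
      induction k with
      | zero => simp
      | succ k ih => rw [ih, Finset.sum_range_succ, hSQ, map_add]; abel
    -- Against p it suffices to sum deg p components: the remainder after them is orthogonal to p.
    rw [e1 p.totalDegree, inner_add_left, (horth p.totalDegree).2.1 p (by omega), add_zero]
    exact (real_inner_le_norm _ _).trans (mul_le_mul_of_nonneg_right (hR _) (norm_nonneg _))
  refine hfin.trans (mul_le_mul_of_nonneg_left (add_le_add ?_ ?_) (by positivity))
  · exact div_le_div_of_nonneg_right hv hx0.le
  · exact div_le_div_of_nonneg_right hh (by positivity)

/-! ### The approximation theorem for Sobolev functions -/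

/-- The Sobolev inner product in terms of the derivatives `v = ∂₃ f` and of the traces `u`. -/
def traceForm (l l₀ g : ℝ) (v₁ : ℝ × ℝ → ℝ) (u₁ : ℝ → ℝ) (v₂ : ℝ × ℝ → ℝ) (u₂ : ℝ → ℝ) : ℝ :=
  wInner 0 0 g v₁ v₂ + l * inner1L l₀ g u₁ u₂

/-- `v` is the weak derivative `∂₃ f` and `u` is the trace of `f` on the edge `x = 0`. -/
structure HasEdgeData (f : ℝ × ℝ → ℝ) (v : ℝ × ℝ → ℝ) (u : ℝ → ℝ) : Prop where
  weak : IsWeakDeriv (-1, 1) f v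
  trace : ∀ t ∈ Set.Ico (0 : ℝ) 1, HasTrace f (0, t) (u t)

theorem HasEdgeData.congr {f f' v : ℝ × ℝ → ℝ} {u : ℝ → ℝ} (h : HasEdgeData f v u)
    (hf : f =ᵐ[volume.restrict openTriangle] f') : HasEdgeData f' v u where
  weak := h.weak.congr hf (EventuallyEq.refl _ _)
  trace t ht := (h.trace t ht).congr hf

theorem hasEdgeData_ev (p : MvPolynomial (Fin 2) ℝ) :
    HasEdgeData (ev p) (ev (D₃ p)) fun t => ev p (0, t) where
  weak := isWeakDeriv_ev₃ p
  trace t _ := hasTrace_of_continuous (continuous_ev p) (0, t)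

theorem deriv_ev_edge (p : MvPolynomial (Fin 2) ℝ) (t : ℝ) :
    deriv (fun t => ev p (0, t)) t = ev (D₂ p) (0, t) := by
  have := hasDerivAt_ev_comp p (hasDerivAt_const t (0 : ℝ)) (hasDerivAt_id t)
  rw [mul_zero, zero_add, mul_one] at this
  exact this.deriv

theorem traceForm_ev (l l₀ g : ℝ) (p q : MvPolynomial (Fin 2) ℝ) :
    traceForm l l₀ g (ev (D₃ p)) (fun t => ev p (0, t)) (ev (D₃ q)) (fun t => ev q (0, t)) =
      sobForm l l₀ g p q := by
  simp only [traceForm, wInner, inner1L, sobForm, triInt, edgeInt, deriv_ev_edge, ev_mul]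

/-- The vertex t = 1 is left out because the trace is known only on [0, 1). -/
theorem inner1L_congr {l₀ a : ℝ} {u u' w w' : ℝ → ℝ} (hu : ∀ t ∈ Set.Ico (0 : ℝ) 1, u t = u' t)
    (hw : ∀ t ∈ Set.Ico (0 : ℝ) 1, w t = w' t) : inner1L l₀ a u w = inner1L l₀ a u' w' := by
  have hd : ∀ {u u' : ℝ → ℝ}, (∀ t ∈ Set.Ico (0 : ℝ) 1, u t = u' t) → ∀ t ∈ Set.Ioo (0 : ℝ) 1,
      deriv u t = deriv u' t := by
    intro u u' h t ht
    refine EventuallyEq.deriv_eq ?_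
    filter_upwards [Ioo_mem_nhds ht.1 ht.2] with s hs
    exact h s ⟨hs.1.le, hs.2⟩
  rw [inner1L, inner1L, hu 0 ⟨le_rfl, one_pos⟩, hw 0 ⟨le_rfl, one_pos⟩]
  congr 1
  rw [intervalIntegral.integral_of_le zero_le_one, intervalIntegral.integral_of_le zero_le_one,
    integral_Ioc_eq_integral_Ioo, integral_Ioc_eq_integral_Ioo]
  refine setIntegral_congr_fun measurableSet_Ioo fun t ht => ?_
  simp only [hd hu t ht, hd hw t ht]

theorem sobSum_congr {l l₀ g : ℝ} {Φ Ψ : MvPolynomial (Fin 2) ℝ → ℝ} {n : ℕ}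
    (h : ∀ k m, k ≤ m → Φ (basPoly g k m) = Ψ (basPoly g k m)) :
    sobSum l l₀ g Φ n = sobSum l l₀ g Ψ n := by
  refine Finset.sum_congr rfl fun m _ => Finset.sum_congr rfl fun k hk => ?_
  rw [h k m (by simpa [Nat.lt_succ_iff] using hk)]

theorem wNorm_sub_ev {g : ℝ} (hg : -1 < g) {f : ℝ × ℝ → ℝ} (hf : MemLp f 2 (triMeasure 0 0 g))
    (p : MvPolynomial (Fin 2) ℝ) :
    wNorm 0 0 g (fun q => f q - ev p q) = ENNReal.ofReal ‖hf.toLp - toL2 hg p‖ := by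
  have h1 : hf.toLp - toL2 hg p = (hf.sub (memLp_ev hg p)).toLp :=
    (MemLp.toLp_sub hf (memLp_ev hg p)).symm
  rw [h1, Lp.norm_toLp, ENNReal.ofReal_toReal (hf.sub (memLp_ev hg p)).eLpNorm_ne_top]
  rfl

theorem IsSobolevFun.weak₃ {g : ℝ} {F g₁ g₂ h : ℝ × ℝ → ℝ} (S : IsSobolevFun g F g₁ g₂ h) :
    IsWeakDeriv (-1, 1) F fun q => g₂ q - g₁ q := by
  have := S.weak₂.add_dir (S.weak₁.smul (-1))
  have e : ((0, 1) : ℝ × ℝ) + (-1 : ℝ) • (1, 0) = (-1, 1) := by simp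
  rw [e] at this
  exact this.congr (EventuallyEq.refl _ _) (Eventually.of_forall fun q => by ring)

theorem IsSobolevFun.exists_wNorm_sub_sobSum_le {g : ℝ} (hg : -1 < g) :
    ∃ C : ℝ, 0 < C ∧ ∀ l l₀ : ℝ, 0 < l → 0 < l₀ → ∀ F g₁ g₂ h : ℝ × ℝ → ℝ,
      IsSobolevFun g F g₁ g₂ h → ∃ u : ℝ → ℝ, HasEdgeData F (fun q => g₂ q - g₁ q) u ∧
        ∀ n : ℕ, 2 ≤ n →
          wNorm 0 0 g (fun q => F q - ev (sobSum l l₀ g (fun b => traceForm l l₀ g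
              (fun q => g₂ q - g₁ q) u (ev (D₃ b)) fun t => ev b (0, t)) n) q) ≤
            ENNReal.ofReal (C / n) * bestApprox (n - 1) (fun q => g₂ q - g₁ q) 0 0 g +
              ENNReal.ofReal (C / (n : ℝ) ^ 2) * bestApprox (n - 2) h 0 0 (g + 2) := by
  have hg' : -1 < g + 2 := by linarith
  obtain ⟨C, hC, key⟩ := exists_norm_sub_sobSum_le hg hg'
  refine ⟨C, hC, fun l l₀ hl hl₀ F g₁ g₂ h S => ?_⟩
  obtain ⟨β, c, T, htr⟩ := S.exists_trace_identities hg
  refine ⟨fun t => c + ∫ s in (0 : ℝ)..t, β s, ⟨S.weak₃, htr⟩, fun n hn => ?_⟩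
  have hd := ae_hasDerivAt_of_eq_add_integral T.intervalIntegrable
    (u := fun t => c + ∫ s in (0 : ℝ)..t, β s) fun t _ => rfl
  have hv : MemLp (fun q => g₂ q - g₁ q) 2 (triMeasure 0 0 g) := S.memLp₂.sub S.memLp₁
  have T2 := T.traceVectors hg hg' S.memLp hv S.memLp₁₂
  -- The derivative of the trace is β almost everywhere, so the coefficients of the stated expansion
  -- are those of the Hilbert space version.
  have hΦ : sobSum l l₀ g (fun b => traceForm l l₀ g (fun q => g₂ q - g₁ q)
      (fun t => c + ∫ s in (0 : ℝ)..t, β s) (ev (D₃ b)) fun t => ev b (0, t)) n =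
      sobSum l l₀ g (sobPair hg l l₀ hv.toLp (edgeFun T.intervalIntegrable) c) n := by
    refine sobSum_congr fun k m _ => ?_
    change _ = inner ℝ _ _ + l * ((∫ t in (0 : ℝ)..1, _) + _)
    rw [traceForm, inner1L, inner_toLp_toL2, wInner, intervalIntegral.integral_same, add_zero]
    congr 3
    rw [intervalIntegral.integral_of_le zero_le_one, intervalIntegral.integral_of_le zero_le_one,
      integral_Ioc_eq_integral_Ioo, integral_Ioc_eq_integral_Ioo]
    refine setIntegral_congr_ae measurableSet_Ioo ?_
    filter_upwards [hd] with t ht ht01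
    rw [(ht ht01).deriv, deriv_ev_edge]
  have hn0 : (0 : ℝ) < n := by exact_mod_cast (by omega : 0 < n)
  rw [hΦ, wNorm_sub_ev hg S.memLp, bestApprox, bestApprox]
  have a0 : ENNReal.ofReal (C / n) ≠ 0 := by simpa using div_pos hC hn0
  have b0 : ENNReal.ofReal (C / (n : ℝ) ^ 2) ≠ 0 := by simpa using div_pos hC (pow_pos hn0 2)
  simp only [ENNReal.mul_iInf_of_ne a0 ENNReal.ofReal_ne_top,
    ENNReal.mul_iInf_of_ne b0 ENNReal.ofReal_ne_top, ENNReal.iInf_add, ENNReal.add_iInf]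
  -- The infima pass through finite nonzero factors and sums, so the bound for each pair p, r is
  -- enough.
  refine le_iInf fun r => le_iInf fun hr => le_iInf fun p => le_iInf fun hp => ?_
  have e1 := wNorm_sub_ev hg hv p
  have e2 := wNorm_sub_ev hg' S.memLp₁₂ r
  simp only [ev] at e1 e2
  rw [e1, e2, ← ENNReal.ofReal_mul (by positivity), ← ENNReal.ofReal_mul (by positivity),
    ← ENNReal.ofReal_add (by positivity) (by positivity)]
  refine ENNReal.ofReal_le_ofReal ((key l l₀ hl hl₀ _ _ _ _ _ T2 n hn p r hp hr).trans
    (le_of_eq ?_))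
  ring

/-- The partial sums agree with `sobSum`, up to a change of variables. -/
theorem partialSum_comp_eq {l l₀ g : ℝ} {ip : (ℝ × ℝ → ℝ) → (ℝ × ℝ → ℝ) → ℝ}
    {B : ℕ → ℕ → ℝ × ℝ → ℝ} {A : ℝ × ℝ → ℝ × ℝ} {f v : ℝ × ℝ → ℝ} {u : ℝ → ℝ}
    (hip : ∀ f₁ f₂ v₁ v₂ u₁ u₂, HasEdgeData (fun q => f₁ (A q)) v₁ u₁ →
      HasEdgeData (fun q => f₂ (A q)) v₂ u₂ → ip f₁ f₂ = traceForm l l₀ g v₁ u₁ v₂ u₂)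
    (hB : ∀ k m, k ≤ m → ∀ q ∈ openTriangle, B k m (A q) = ev (basPoly g k m) q)
    (hf : HasEdgeData (fun q => f (A q)) v u) (n : ℕ) {q : ℝ × ℝ} (hq : q ∈ openTriangle) :
    partialSum ip B n f (A q) = ev (sobSum l l₀ g (fun b => traceForm l l₀ g v u (ev (D₃ b))
      fun t => ev b (0, t)) n) q := by
  -- The formula for B agrees with a polynomial on the open triangle only; weak derivatives and
  -- traces do not see the difference.
  have hd : ∀ k m, k ≤ m → HasEdgeData (fun q => B k m (A q)) (ev (D₃ (basPoly g k m)))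
      fun t => ev (basPoly g k m) (0, t) := fun k m hk =>
    (hasEdgeData_ev (basPoly g k m)).congr
      ((ae_restrict_iff' measurableSet_openTriangle).mpr
        (Eventually.of_forall fun q hq => (hB k m hk q hq).symm))
  simp only [partialSum, sobSum, sobComp, ev_sum, ev_smul]
  refine Finset.sum_congr rfl fun m _ => Finset.sum_congr rfl fun k hk => ?_
  have hk' : k ≤ m := by simpa [Nat.lt_succ_iff] using hk
  rw [hip _ _ _ _ _ _ hf (hd k m hk'), hip _ _ _ _ _ _ (hd k m hk') (hd k m hk'), traceForm_ev,
    hB k m hk' q hq]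

/-! ### Changes of variables -/

/-- An affine automorphism `A` of the triangle with inverse `A'`, under which derivatives in the
direction `w` become derivatives in the direction `L w`. -/
structure IsTriangleMap (A A' L : ℝ × ℝ → ℝ × ℝ) : Prop where
  left_inv : ∀ q, A' (A q) = q
  right_inv : ∀ q, A (A' q) = q
  continuous : Continuous A
  continuous_inv : Continuous A'
  measurePreserving : MeasurePreserving A (volume.restrict openTriangle)
    (volume.restrict openTriangle)
  mem_openTriangle : ∀ q ∈ openTriangle, A q ∈ openTriangle
  weak : ∀ {w f k}, IsWeakDeriv w f k → IsWeakDeriv (L w) (fun q => f (A q)) fun q => k (A q)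
  trace : ∀ {f p a}, HasTrace f (A p) a → HasTrace (fun q => f (A q)) p a

theorem IsTriangleSymm.isTriangleMap {A : ℝ × ℝ → ℝ × ℝ} {L : (ℝ × ℝ) →L[ℝ] (ℝ × ℝ)}
    (hA : IsTriangleSymm A L) : IsTriangleMap A A L where
  left_inv := hA.invol
  right_inv := hA.invol
  continuous := hA.continuous
  continuous_inv := hA.continuous
  measurePreserving := hA.measurePreserving_restrict
  mem_openTriangle q hq := (hA.mem_iff q).mpr hq
  weak h := h.comp_symm hA rfl
  trace h := h.comp_symm hA

namespace IsTriangleMap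

variable {A A' L B B' M : ℝ × ℝ → ℝ × ℝ}

protected theorem id : IsTriangleMap id id id where
  left_inv _ := rfl
  right_inv _ := rfl
  continuous := continuous_id
  continuous_inv := continuous_id
  measurePreserving := MeasurePreserving.id _
  mem_openTriangle _ hq := hq
  weak h := h
  trace h := h

theorem comp (hA : IsTriangleMap A A' L) (hB : IsTriangleMap B B' M) :
    IsTriangleMap (A ∘ B) (B' ∘ A') (M ∘ L) where
  left_inv q := by simp only [Function.comp_apply, hA.left_inv, hB.left_inv]
  right_inv q := by simp only [Function.comp_apply, hA.right_inv, hB.right_inv]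
  continuous := hA.continuous.comp hB.continuous
  continuous_inv := hB.continuous_inv.comp hA.continuous_inv
  measurePreserving := hA.measurePreserving.comp hB.measurePreserving
  mem_openTriangle q hq := hA.mem_openTriangle _ (hB.mem_openTriangle q hq)
  weak h := hB.weak (hA.weak h)
  trace h := hB.trace (hA.trace h)

theorem measurableEmbedding (hA : IsTriangleMap A A' L) : MeasurableEmbedding A :=
  (Homeomorph.mk ⟨A, A', hA.left_inv, hA.right_inv⟩ hA.continuous
    hA.continuous_inv).measurableEmbedding

theorem ae_comp (hA : IsTriangleMap A A' L) {p : ℝ × ℝ → Prop}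
    (h : ∀ᵐ q ∂volume.restrict openTriangle, p q) :
    ∀ᵐ q ∂volume.restrict openTriangle, p (A q) :=
  hA.measurePreserving.quasiMeasurePreserving.ae h

theorem measurePreserving_triMeasure (hA : IsTriangleMap A A' L) {α β γ g : ℝ}
    (hw : ∀ q ∈ openTriangle, weight α β γ (A q) = weight 0 0 g q) :
    MeasurePreserving A (triMeasure 0 0 g) (triMeasure α β γ) := by
  have hm : ∀ α β γ, Measurable fun q => ENNReal.ofReal (weight α β γ q) := fun α β γ =>
    ((((measurable_fst.pow_const α).mul (measurable_snd.pow_const β)).mul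
      (((measurable_const.sub measurable_fst).sub measurable_snd).pow_const γ))).ennreal_ofReal
  refine ⟨hA.continuous.measurable, Measure.ext fun s hs => ?_⟩
  have hs' := hA.continuous.measurable hs
  rw [Measure.map_apply hA.continuous.measurable hs, triMeasure, triMeasure, restrict_triangle,
    withDensity_apply _ hs, withDensity_apply _ hs',
    ← hA.measurePreserving.setLIntegral_comp_preimage hs (hm α β γ)]
  refine lintegral_congr_ae (ae_restrict_of_ae ?_)
  filter_upwards [ae_restrict_mem measurableSet_openTriangle] with q hq
  rw [hw q hq]

theorem wNorm_eq (hA : IsTriangleMap A A' L) {α β γ g : ℝ}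
    (hw : ∀ q ∈ openTriangle, weight α β γ (A q) = weight 0 0 g q) (f : ℝ × ℝ → ℝ) :
    wNorm α β γ f = wNorm 0 0 g fun q => f (A q) := by
  rw [wNorm, ← (hA.measurePreserving_triMeasure hw).map_eq,
    hA.measurableEmbedding.eLpNorm_map_measure]
  rfl

theorem wInner_eq (hA : IsTriangleMap A A' L) {α β γ g : ℝ}
    (hw : ∀ q ∈ openTriangle, weight α β γ (A q) = weight 0 0 g q) (f k : ℝ × ℝ → ℝ) :
    wInner α β γ f k = wInner 0 0 g (fun q => f (A q)) fun q => k (A q) :=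
  ((hA.measurePreserving_triMeasure hw).integral_comp hA.measurableEmbedding
    fun q => f q * k q).symm

/-- Composition with an affine map does not raise the degree, and the sign s does not change the
norm. -/
theorem bestApprox_le (hA : IsTriangleMap A A' L) {α β γ g : ℝ}
    (hw : ∀ q ∈ openTriangle, weight α β γ (A q) = weight 0 0 g q)
    {X Y : MvPolynomial (Fin 2) ℝ} (hX : X.totalDegree ≤ 1) (hY : Y.totalDegree ≤ 1)
    (hXY : ∀ q, A q = (ev X q, ev Y q)) {s : ℝ} (hs : |s| = 1) {f k : ℝ × ℝ → ℝ}
    (hk : ∀ᵐ q ∂volume.restrict openTriangle, k q = s * f (A q)) (n : ℕ) :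
    bestApprox n k 0 0 g ≤ bestApprox n f α β γ := by
  refine le_iInf fun p => le_iInf fun hp => ?_
  have hpow : ∀ {Z : MvPolynomial (Fin 2) ℝ}, Z.totalDegree ≤ 1 → ∀ i, (Z ^ i).totalDegree ≤ i :=
    fun hZ i => (MvPolynomial.totalDegree_pow _ _).trans (by nlinarith)
  obtain ⟨p', hp', he⟩ : ∃ p' : MvPolynomial (Fin 2) ℝ, p'.totalDegree ≤ n ∧
      ∀ q, ev p' q = ev p (A q) := by
    refine poly_induction (P := fun p => ∃ p' : MvPolynomial (Fin 2) ℝ, p'.totalDegree ≤ n ∧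
      ∀ q, ev p' q = ev p (A q)) ?_ ?_ ?_ hp
    · intro i j hij
      exact ⟨X ^ i * Y ^ j, totalDegree_mul_le hij (hpow hX i) (hpow hY j),
        fun q => by simp [hXY q]⟩
    · rintro p r ⟨p', h1, h2⟩ ⟨r', h3, h4⟩
      exact ⟨p' + r', totalDegree_add_le h1 h3, fun q => by simp [h2, h4]⟩
    · rintro a p ⟨p', h1, h2⟩
      exact ⟨MvPolynomial.C a * p', totalDegree_C_mul_le a h1, fun q => by simp [h2]⟩
  refine iInf_le_of_le (MvPolynomial.C s * p') (iInf_le_of_le (totalDegree_C_mul_le s hp') (le_of_eq ?_))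
  rw [hA.wNorm_eq hw]
  have e1 : (fun q : ℝ × ℝ => k q - MvPolynomial.eval ![q.1, q.2] (MvPolynomial.C s * p'))
      =ᵐ[triMeasure 0 0 g] s • fun q => f (A q) - MvPolynomial.eval ![(A q).1, (A q).2] p := by
    refine (ae_triMeasure_iff g _).mpr ?_
    filter_upwards [hk] with q hq
    have h1 := he q
    simp only [ev] at h1
    rw [hq, map_mul, MvPolynomial.eval_C, h1, Pi.smul_apply, smul_eq_mul, mul_sub]
  have hs' : ‖s‖ₑ = 1 := by rw [Real.enorm_eq_ofReal_abs, hs, ENNReal.ofReal_one]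
  rw [wNorm, eLpNorm_congr_ae e1, eLpNorm_const_smul, hs', one_mul]
  rfl

end IsTriangleMap

/-! ### The approximation theorem in arbitrary position -/

theorem HasEdgeData.pval_eq {A A' L' : ℝ × ℝ → ℝ × ℝ} (hA' : IsTriangleMap A' A L')
    {f v : ℝ × ℝ → ℝ} {u : ℝ → ℝ} (h : HasEdgeData (fun q => f (A q)) v u)
    {t : ℝ} (ht : t ∈ Set.Ico (0 : ℝ) 1) {p : ℝ × ℝ} (hp : p ∈ triangle) (hpt : A' p = (0, t)) :
    pval f p = u t := by
  have e : (fun q => f (A (A' q))) = f := funext fun q => by rw [hA'.left_inv]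
  have h1 := hA'.weak h.weak
  have h2 : HasTrace (fun q => f (A (A' q))) p (u t) := hA'.trace (f := fun q => f (A q)) (by
    rw [hpt]; exact h.trace t ht)
  simp only [e] at h1 h2
  exact h2.pval_eq hp h1.1.aestronglyMeasurable

theorem weakDeriv_ae_eq {w : ℝ × ℝ} {f k : ℝ × ℝ → ℝ} (h : IsWeakDeriv w f k) :
    weakDeriv w f =ᵐ[volume.restrict openTriangle] k := by
  have h' : ∃ k, IsWeakDeriv w f k := ⟨k, h⟩
  rw [weakDeriv, dif_pos h']
  exact h'.choose_spec.unique h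

theorem isWeakDeriv_weakDeriv {w : ℝ × ℝ} {f : ℝ × ℝ → ℝ} (h : ∃ k, IsWeakDeriv w f k) :
    IsWeakDeriv w f (weakDeriv w f) := by
  rw [weakDeriv, dif_pos h]
  exact h.choose_spec

theorem IsTriangleMap.weakDeriv_comp {A A' L L' : ℝ × ℝ → ℝ × ℝ} (hA : IsTriangleMap A A' L)
    (hA' : IsTriangleMap A' A L') {f v : ℝ × ℝ → ℝ} {w₀ : ℝ × ℝ}
    (h : IsWeakDeriv w₀ (fun q => f (A q)) v) {w : ℝ × ℝ} {s : ℝ} (hw : w = s • L' w₀) :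
    ∀ᵐ q ∂volume.restrict openTriangle, weakDeriv w f (A q) = s * v q := by
  have e : (fun q => f (A (A' q))) = f := funext fun q => by rw [hA'.left_inv]
  have h1 := (hA'.weak h).smul s
  simp only [e, ← hw] at h1
  filter_upwards [hA.ae_comp (weakDeriv_ae_eq h1)] with q hq
  rw [hq, hA.left_inv]

theorem wInner_congr {g : ℝ} {f f' k k' : ℝ × ℝ → ℝ} {s : ℝ} (hs : |s| = 1)
    (hf : ∀ᵐ q ∂volume.restrict openTriangle, f q = s * f' q)
    (hk : ∀ᵐ q ∂volume.restrict openTriangle, k q = s * k' q) :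
    wInner 0 0 g f k = wInner 0 0 g f' k' := by
  refine integral_congr_ae ((ae_triMeasure_iff g _).mpr ?_)
  have hss : s * s = 1 := by rw [← abs_mul_abs_self, hs, one_mul]
  filter_upwards [hf, hk] with q h1 h2
  rw [h1, h2]
  linear_combination f' q * k' q * hss

theorem IsWeakDeriv.const_mul {e : ℝ × ℝ} {f k : ℝ × ℝ → ℝ} (h : IsWeakDeriv e f k) (a : ℝ) :
    IsWeakDeriv e (fun q => a * f q) fun q => a * k q := by
  refine ⟨fun x hx => (h.1 x hx).smul a, fun x hx => (h.2.1 x hx).smul a, fun ψ h1 h2 h3 => ?_⟩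
  simp only [mul_assoc a]
  rw [integral_const_mul, integral_const_mul, h.2.2 ψ h1 h2 h3, mul_neg]

/-- The approximation theorem after a change of variables. -/
theorem IsTriangleMap.exists_wNorm_sub_partialSum_le {g : ℝ} (hg : -1 < g)
    {A A' L L' : ℝ × ℝ → ℝ × ℝ} (hA : IsTriangleMap A A' L) (hA' : IsTriangleMap A' A L')
    {X Y : MvPolynomial (Fin 2) ℝ} (hX : X.totalDegree ≤ 1) (hY : Y.totalDegree ≤ 1)
    (hXY : ∀ q, A q = (ev X q, ev Y q)) {α β γ α' β' γ' : ℝ}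
    (hw : ∀ q ∈ openTriangle, weight α β γ (A q) = weight 0 0 g q)
    (hw' : ∀ q ∈ openTriangle, weight α' β' γ' (A q) = weight 0 0 (g + 2) q)
    {i₁ i₂ i₃ : Fin 3} {s₁ s₂ s₃ : ℝ} (hs₁ : |s₁| = 1) (hs₂ : |s₂| = 1) (hs₃ : |s₃| = 1)
    (hi₁ : s₁ • L (dir i₁) = (1, 0)) (hi₂ : s₂ • L (dir i₂) = (0, 1))
    (hi₃ : dir i₃ = s₃ • L' (-1, 1))
    {bd : ℝ → (ℝ × ℝ → ℝ) → (ℝ × ℝ → ℝ) → ℝ} {B : ℕ → ℕ → ℝ × ℝ → ℝ}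
    (hbd : ∀ l₀ f₁ f₂ v₁ v₂ u₁ u₂, HasEdgeData (fun q => f₁ (A q)) v₁ u₁ →
      HasEdgeData (fun q => f₂ (A q)) v₂ u₂ → bd l₀ f₁ f₂ = inner1L l₀ g u₁ u₂)
    (hB : ∀ k m, ∀ q ∈ openTriangle, B k m (A q) = basisJ (-1) (-1) g k m q) :
    ∃ C : ℝ, 0 < C ∧ ∀ l l₀ : ℝ, 0 < l → 0 < l₀ → ∀ f : ℝ × ℝ → ℝ,
      MemSobolev α β γ 1 f → MemSobolev α' β' γ' 2 f → ∀ n : ℕ, 2 ≤ n →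
        wNorm α β γ (f - partialSum (fun f k => wInner α β γ (weakDeriv (dir i₃) f)
            (weakDeriv (dir i₃) k) + l * bd l₀ f k) B n f) ≤
          ENNReal.ofReal (C / n) * bestApprox (n - 1) (weakDeriv (dir i₃) f) α β γ +
            ENNReal.ofReal (C / (n : ℝ) ^ 2) *
              bestApprox (n - 2) (weakDeriv (dir i₁) (weakDeriv (dir i₂) f)) α' β' γ' := by
  obtain ⟨C, hC, key⟩ := IsSobolevFun.exists_wNorm_sub_sobSum_le hg
  refine ⟨C, hC, fun l l₀ hl hl₀ f M1 M2 n hn => ?_⟩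
  have hss : s₃ * s₃ = 1 := by rw [← abs_mul_abs_self, hs₃, one_mul]
  have mp := hA.measurePreserving_triMeasure hw
  have w₁ := ((hA.weak (isWeakDeriv_weakDeriv (M1.2 i₁).1)).smul s₁)
  have w₂ := ((hA.weak (isWeakDeriv_weakDeriv (M1.2 i₂).1)).smul s₂)
  have w₁₂ := ((hA.weak (isWeakDeriv_weakDeriv ((M2.2 i₂).2.2 i₁).1)).smul s₁)
  rw [hi₁] at w₁ w₁₂
  rw [hi₂] at w₂
  have m₁ : MemLp (weakDeriv (dir i₁) f) 2 (triMeasure α β γ) := (M1.2 i₁).2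
  have m₂ : MemLp (weakDeriv (dir i₂) f) 2 (triMeasure α β γ) := (M1.2 i₂).2
  have m₁₂ : MemLp (weakDeriv (dir i₁) (weakDeriv (dir i₂) f)) 2 (triMeasure α' β' γ') :=
    ((M2.2 i₂).2.2 i₁).2
  -- The signs compensate the orientation: the map sends the directions used for f to (1, 0) and (0,
  -- 1) only up to sign.
  have S : IsSobolevFun g (fun q => f (A q)) (fun q => s₁ * weakDeriv (dir i₁) f (A q))
      (fun q => s₂ * weakDeriv (dir i₂) f (A q))
      (fun q => s₂ * (s₁ * weakDeriv (dir i₁) (weakDeriv (dir i₂) f) (A q))) :=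
    { weak₁ := w₁
      weak₂ := w₂
      weak₁₂ := w₁₂.const_mul s₂
      memLp := M1.1.comp_measurePreserving mp
      memLp₁ := (m₁.comp_measurePreserving mp).const_mul s₁
      memLp₂ := (m₂.comp_measurePreserving mp).const_mul s₂
      memLp₁₂ := ((m₁₂.comp_measurePreserving
        (hA.measurePreserving_triMeasure hw')).const_mul s₁).const_mul s₂ }
  -- By uniqueness of weak derivatives, ∂₃ of the pulled back function is, up to sign, the pulled
  -- back derivative in the distinguished direction.
  have hd : ∀ᵐ q ∂volume.restrict openTriangle, s₂ * weakDeriv (dir i₂) f (A q) -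
      s₁ * weakDeriv (dir i₁) f (A q) = s₃ * weakDeriv (dir i₃) f (A q) := by
    filter_upwards [hA.weakDeriv_comp hA' S.weak₃ hi₃] with q hq
    rw [hq, ← mul_assoc, hss, one_mul]
  have hip : ∀ f₁ f₂ v₁ v₂ u₁ u₂, HasEdgeData (fun q => f₁ (A q)) v₁ u₁ →
      HasEdgeData (fun q => f₂ (A q)) v₂ u₂ →
      wInner α β γ (weakDeriv (dir i₃) f₁) (weakDeriv (dir i₃) f₂) + l * bd l₀ f₁ f₂ =
        traceForm l l₀ g v₁ u₁ v₂ u₂ := by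
    intro f₁ f₂ v₁ v₂ u₁ u₂ h₁ h₂
    rw [traceForm, hbd _ _ _ _ _ _ _ h₁ h₂, hA.wInner_eq hw,
      wInner_congr hs₃ (hA.weakDeriv_comp hA' h₁.weak hi₃) (hA.weakDeriv_comp hA' h₂.weak hi₃)]
  obtain ⟨u, hu, hle⟩ := key l l₀ hl hl₀ _ _ _ _ S
  have hB' : ∀ k m, k ≤ m → ∀ q ∈ openTriangle, B k m (A q) = ev (basPoly g k m) q := by
    intro k m _ q hq
    rw [hB k m q hq]
    exact (eval_basPoly hg k m q (by linarith [hq.1, hq.2.1] : 0 < q.1 + q.2).ne').symm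
  rw [hA.wNorm_eq hw]
  refine (le_of_eq ?_).trans ((hle n hn).trans (add_le_add
    (mul_le_mul_right (hA.bestApprox_le hw hX hY hXY hs₃ hd _) _)
    (mul_le_mul_right (hA.bestApprox_le hw' hX hY hXY (s := s₂ * s₁)
      (by rw [abs_mul, hs₁, hs₂, one_mul]) (Eventually.of_forall fun q => (mul_assoc _ _ _).symm) _)
      _)))
  refine eLpNorm_congr_ae ((ae_triMeasure_iff g _).mpr ?_)
  refine (ae_restrict_iff' measurableSet_openTriangle).mpr (Eventually.of_forall fun q hq => ?_)
  simp only [Pi.sub_apply]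
  rw [partialSum_comp_eq hip hB' hu n hq]

/-! ### The three families -/

theorem exists_wNorm_sub_sumJ_le {γ : ℝ} (hγ : -1 < γ) :
    ∃ C : ℝ, 0 < C ∧ ∀ l l₀ : ℝ, 0 < l → 0 < l₀ → ∀ f : ℝ × ℝ → ℝ,
      MemSobolev 0 0 γ 1 f → MemSobolev 0 0 (γ + 2) 2 f → ∀ n : ℕ, 2 ≤ n →
        wNorm 0 0 γ (f - sumJ l l₀ γ n f) ≤
          ENNReal.ofReal (C / n) * bestApprox (n - 1) (pd₃ f) 0 0 γ +
            ENNReal.ofReal (C / (n : ℝ) ^ 2) * bestApprox (n - 2) (pd₁ (pd₂ f)) 0 0 (γ + 2) := by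
  refine IsTriangleMap.id.exists_wNorm_sub_partialSum_le hγ IsTriangleMap.id (X := px) (Y := py)
    (by simp) (by simp) (fun q => by simp) (fun q _ => rfl) (fun q _ => rfl)
    (i₁ := 0) (i₂ := 1) (i₃ := 2) (s₁ := 1) (s₂ := 1) (s₃ := 1) (by simp) (by simp) (by simp)
    (by simp [dir]) (by simp [dir]) (by simp [dir])
    (bd := fun l₀ f k => inner1L l₀ γ (edgeX f) (edgeX k)) ?_ fun k m q _ => rfl
  intro l₀ f₁ f₂ v₁ v₂ u₁ u₂ h₁ h₂
  exact inner1L_congr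
    (fun t ht => h₁.pval_eq IsTriangleMap.id ht (mem_triangle_edge ht) rfl)
    fun t ht => h₂.pval_eq IsTriangleMap.id ht (mem_triangle_edge ht) rfl

theorem isTriangleMap_refl₃_comp_swap :
    IsTriangleMap (refl₃ ∘ Prod.swap) (Prod.swap ∘ refl₃) fun w => (-w.1 - w.2, w.1) :=
  isTriangleSymm_refl₃.isTriangleMap.comp isTriangleSymm_swap.isTriangleMap

theorem isTriangleMap_swap_comp_refl₃ :
    IsTriangleMap (Prod.swap ∘ refl₃) (refl₃ ∘ Prod.swap) fun w => (w.2, -w.2 - w.1) :=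
  isTriangleSymm_swap.isTriangleMap.comp isTriangleSymm_refl₃.isTriangleMap

/-- The map is (x, y) ↦ (y, 1 - x - y); it takes the point (0, t) of the edge to (t, 1 - t). -/
theorem exists_wNorm_sub_sumK_le {β : ℝ} (hβ : -1 < β) :
    ∃ C : ℝ, 0 < C ∧ ∀ l l₀ : ℝ, 0 < l → 0 < l₀ → ∀ f : ℝ × ℝ → ℝ,
      MemSobolev 0 β 0 1 f → MemSobolev 0 (β + 2) 0 2 f → ∀ n : ℕ, 2 ≤ n →
        wNorm 0 β 0 (f - sumK l l₀ β n f) ≤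
          ENNReal.ofReal (C / n) * bestApprox (n - 1) (pd₁ f) 0 β 0 +
            ENNReal.ofReal (C / (n : ℝ) ^ 2) * bestApprox (n - 2) (pd₂ (pd₃ f)) 0 (β + 2) 0 := by
  refine isTriangleMap_refl₃_comp_swap.exists_wNorm_sub_partialSum_le hβ
    isTriangleMap_swap_comp_refl₃ (X := py) (Y := pz) (by simp) totalDegree_pz_le
    (fun q => by simp [refl₃]; ring) (fun q _ => ?_) (fun q _ => ?_)
    (i₁ := 1) (i₂ := 2) (i₃ := 0) (s₁ := -1) (s₂ := -1) (s₃ := 1) (by simp) (by simp) (by simp)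
    (by simp [dir]) (by simp [dir]) (by simp [dir])
    (bd := fun l₀ f k => inner1L l₀ β (edgeZ f) (edgeZ k)) ?_ fun k m q hq => ?_
  · simp only [weight, Function.comp_apply, refl₃, Prod.fst_swap, Prod.snd_swap, Real.rpow_zero]
    ring_nf
  · simp only [weight, Function.comp_apply, refl₃, Prod.fst_swap, Prod.snd_swap, Real.rpow_zero]
    ring_nf
  · intro l₀ f₁ f₂ v₁ v₂ u₁ u₂ h₁ h₂
    have hm : ∀ t ∈ Set.Ico (0 : ℝ) 1, (t, 1 - t) ∈ triangle := fun t ht =>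
      ⟨ht.1, by simpa using ht.2.le, by simp⟩
    exact inner1L_congr
      (fun t ht => h₁.pval_eq isTriangleMap_swap_comp_refl₃ ht (hm t ht) (by simp [refl₃]))
      fun t ht => h₂.pval_eq isTriangleMap_swap_comp_refl₃ ht (hm t ht) (by simp [refl₃])
  · have h0 : q.1 + q.2 ≠ 0 := (by linarith [hq.1, hq.2.1] : 0 < q.1 + q.2).ne'
    have e1 : 1 - (1 - q.2 - q.1) = q.1 + q.2 := by ring
    have e2 : 2 * q.2 / (q.1 + q.2) - 1 = (q.2 - q.1) / (q.1 + q.2) := by field_simp; ring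
    have e3 : 2 * (1 - q.2 - q.1) - 1 = 1 - 2 * q.1 - 2 * q.2 := by ring
    simp only [basisK, basisJ, Function.comp_apply, refl₃, Prod.fst_swap, Prod.snd_swap, e1, e2, e3]

/-- The map is (x, y) ↦ (1 - x - y, x); it takes (0, t) to (1 - t, 0), so the edge is traversed
backwards. -/
theorem exists_wNorm_sub_sumL_le {α : ℝ} (hα : -1 < α) :
    ∃ C : ℝ, 0 < C ∧ ∀ l l₀ : ℝ, 0 < l → 0 < l₀ → ∀ f : ℝ × ℝ → ℝ,
      MemSobolev α 0 0 1 f → MemSobolev (α + 2) 0 0 2 f → ∀ n : ℕ, 2 ≤ n →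
        wNorm α 0 0 (f - sumL l l₀ α n f) ≤
          ENNReal.ofReal (C / n) * bestApprox (n - 1) (pd₂ f) α 0 0 +
            ENNReal.ofReal (C / (n : ℝ) ^ 2) * bestApprox (n - 2) (pd₃ (pd₁ f)) (α + 2) 0 0 := by
  refine isTriangleMap_swap_comp_refl₃.exists_wNorm_sub_partialSum_le hα
    isTriangleMap_refl₃_comp_swap (X := pz) (Y := px) totalDegree_pz_le (by simp)
    (fun q => by simp [refl₃]) (fun q _ => ?_) (fun q _ => ?_)
    (i₁ := 2) (i₂ := 0) (i₃ := 1) (s₁ := 1) (s₂ := -1) (s₃ := -1) (by simp) (by simp) (by simp)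
    (by simp [dir]) (by simp [dir]) (by simp [dir])
    (bd := fun l₀ f k => inner1R l₀ α (edgeY f) (edgeY k)) ?_ fun k m q hq => ?_
  · simp [weight, refl₃]
  · simp [weight, refl₃]
  · intro l₀ f₁ f₂ v₁ v₂ u₁ u₂ h₁ h₂
    have hm : ∀ t ∈ Set.Ico (0 : ℝ) 1, (1 - t, (0 : ℝ)) ∈ triangle := fun t ht =>
      ⟨by simpa using ht.2.le, le_rfl, by simpa using ht.1⟩
    rw [← inner1L_congr (u := fun t => edgeY f₁ (1 - t)) (w := fun t => edgeY f₂ (1 - t))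
      (fun t ht => h₁.pval_eq isTriangleMap_refl₃_comp_swap ht (hm t ht) (by simp [refl₃]))
      fun t ht => h₂.pval_eq isTriangleMap_refl₃_comp_swap ht (hm t ht) (by simp [refl₃])]
    -- The substitution t ↦ 1 - t turns `inner1R` into `inner1L`; the two signs of the derivatives
    -- cancel.
    simp only [inner1L, inner1R, sub_zero, deriv_comp_const_sub, neg_mul_neg]
    congr 1
    have := intervalIntegral.integral_comp_sub_left
      (fun t => deriv (edgeY f₁) t * deriv (edgeY f₂) t * t ^ (α + 1)) (a := 0) (b := 1) (1 : ℝ)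
    rw [sub_self, sub_zero] at this
    exact this.symm
  · have h0 : q.1 + q.2 ≠ 0 := (by linarith [hq.1, hq.2.1] : 0 < q.1 + q.2).ne'
    have e1 : 1 - (1 - q.1 - q.2) = q.1 + q.2 := by ring
    have e2 : 1 - 2 * q.1 / (q.1 + q.2) = (q.2 - q.1) / (q.1 + q.2) := by field_simp; ring
    have e3 : 2 * (1 - q.1 - q.2) - 1 = 1 - 2 * q.1 - 2 * q.2 := by ring
    simp only [basisL, basisJ, Function.comp_apply, refl₃, Prod.fst_swap, Prod.snd_swap, e1, e2, e3]

end

end TriangleSobolev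

theorem theorem13 :
    (∀ γ : ℝ, -1 < γ → ∃ c₁ c₂ : ℝ, 0 < c₁ ∧ 0 < c₂ ∧
      ∀ l l₀ : ℝ, 0 < l → 0 < l₀ → ∀ f : ℝ × ℝ → ℝ,
        TriangleSobolev.MemSobolev 0 0 γ 1 f → TriangleSobolev.MemSobolev 0 0 (γ + 2) 2 f →
        ∀ n : ℕ, 2 ≤ n →
          TriangleSobolev.wNorm 0 0 γ (f - TriangleSobolev.sumJ l l₀ γ n f) ≤
            ENNReal.ofReal (c₁ / n) *
                TriangleSobolev.bestApprox (n - 1) (TriangleSobolev.pd₃ f) 0 0 γ +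
              ENNReal.ofReal (c₂ / (n : ℝ) ^ 2) *
                TriangleSobolev.bestApprox (n - 2)
                  (TriangleSobolev.pd₁ (TriangleSobolev.pd₂ f)) 0 0 (γ + 2)) ∧
    (∀ β : ℝ, -1 < β → ∃ c₁ c₂ : ℝ, 0 < c₁ ∧ 0 < c₂ ∧
      ∀ l l₀ : ℝ, 0 < l → 0 < l₀ → ∀ f : ℝ × ℝ → ℝ,
        TriangleSobolev.MemSobolev 0 β 0 1 f → TriangleSobolev.MemSobolev 0 (β + 2) 0 2 f →
        ∀ n : ℕ, 2 ≤ n →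
          TriangleSobolev.wNorm 0 β 0 (f - TriangleSobolev.sumK l l₀ β n f) ≤
            ENNReal.ofReal (c₁ / n) *
                TriangleSobolev.bestApprox (n - 1) (TriangleSobolev.pd₁ f) 0 β 0 +
              ENNReal.ofReal (c₂ / (n : ℝ) ^ 2) *
                TriangleSobolev.bestApprox (n - 2)
                  (TriangleSobolev.pd₂ (TriangleSobolev.pd₃ f)) 0 (β + 2) 0) ∧
    (∀ α : ℝ, -1 < α → ∃ c₁ c₂ : ℝ, 0 < c₁ ∧ 0 < c₂ ∧
      ∀ l l₀ : ℝ, 0 < l → 0 < l₀ → ∀ f : ℝ × ℝ → ℝ,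
        TriangleSobolev.MemSobolev α 0 0 1 f → TriangleSobolev.MemSobolev (α + 2) 0 0 2 f →
        ∀ n : ℕ, 2 ≤ n →
          TriangleSobolev.wNorm α 0 0 (f - TriangleSobolev.sumL l l₀ α n f) ≤
            ENNReal.ofReal (c₁ / n) *
                TriangleSobolev.bestApprox (n - 1) (TriangleSobolev.pd₂ f) α 0 0 +
              ENNReal.ofReal (c₂ / (n : ℝ) ^ 2) *
                TriangleSobolev.bestApprox (n - 2)
                  (TriangleSobolev.pd₃ (TriangleSobolev.pd₁ f)) (α + 2) 0 0) := by
  refine ⟨fun γ hγ => ?_, fun β hβ => ?_, fun α hα => ?_⟩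
  · obtain ⟨C, hC, h⟩ := TriangleSobolev.exists_wNorm_sub_sumJ_le hγ
    exact ⟨C, C, hC, hC, h⟩
  · obtain ⟨C, hC, h⟩ := TriangleSobolev.exists_wNorm_sub_sumK_le hβ
    exact ⟨C, C, hC, hC, h⟩
  · obtain ⟨C, hC, h⟩ := TriangleSobolev.exists_wNorm_sub_sumL_le hα
    exact ⟨C, C, hC, hC, h⟩
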